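/- Let $(W,S)$ be a finite Coxeter system, $W=\langle s_1,\dots,s_n \mid (s_is_j)^{m_{ij}}=1\rangle$ with $m_{ii}=1$, $m_{ij}=m_{ji}\ge 2$ for $i\neq j$, $S=\{s_1,\dots,s_n\}$, length function $\ell$, and set of reflections $T=\{s^x \mid s\in S,\ x\in W\}$, where $y^x:=x^{-1}yx$. Let $W$ act as a reflection group on a finite-dimensional real vector space $V$, with simple roots $\alpha_i\in V$ and linear forms $\alpha_i^\vee$ on $V$ such that $s_i(x)=x-\alpha_i^\vee(x)\alpha_i$ and $\alpha_i^\vee(\alpha_j)=-2\cos(\pi/m_{ij})$ (for example the standard geometric representation on $\mathbb R^n$, or a Euclidean reflection group with unit simple roots $\alpha_i$ and $\alpha_i^\vee=2\langle\alpha_i,\cdot\rangle$). For $t\in T$ put $H_t=\ker(t-1)$, and let $\mathcal A_W=\{H_t \mid t\in T\}$. Give each $H\in\mathcal A_W$ a variable $a_H$. The chambers of $\mathcal A_W$ are the connected components of $V\setminus\bigcup_{H\in\mathcal A_W}H$, and $$\det\mathcal A_W:=\det\big(\mathsf B(C,D)\big)_{C,D}\in\mathbb Z[a_H\mid H\in\mathcal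 A_W],\qquad \mathsf B(C,C)=1,\quad \mathsf B(C,D)=\prod_{H\text{ separates }C,D}a_H\ \ (C\neq D),$$ where $C,D$ range over the chambers. For $J\subseteq S$ let $W_J=\langle J\rangle$, $T_J=T\cap W_J$, and let $X_J$ be the set of elements $x$ of minimal length in their coset $W_Jx$. Let $[J]$ be the set of all conjugates $J^w$ ($w\in W$) that are subsets of $S$, and for $J,K\subseteq S$ let $X(J,K)=\{w\in W_J\cap X_K\cap X_K^{-1}\mid K^w=K\}$. Call $J$ irreducible if it is nonempty and is not the disjoint union of two nonempty subsets commuting elementwise with each other. The support $J(x)$ of $x\in W$ is the set of simple reflections occurring in a reduced expression of $x$, and $\lfloor x\rceil=\{y\in W\mid J(y)=J(x),\ y\text{ is conjugate to }x\}$. Let $\mathcal I(S)$ be the set of classes $[J]$ with $J$ irreducible. For every irreducible $J$ there are a reflection $t_J$ with support $J$ and a simple reflection $s_J$ such that, for some $v\in W$, $t_J=v^{-1}s_Jv$ and $\ell(t_J)=2\ell(v)+1$. For any choice of one representative $J$ of each class in $\mathcal I(S)$, of such $t_J$ and $s_J$, and of a set $Y_J$ of representatives of the cosets $N_W(W_J)w$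 in $W$, $$\det\mathcal A_W=\prod_{[J]\in\mathcal I(S)}\ \prod_{w\in Y_J}\Big(1-\prod_{u\in T_J}a_{H_{u^w}}^2\Big)^{|\lfloor t_J\rceil|\cdot|[J]|\cdot|X(S,J)|\cdot|X(J,\{s_J\})|}.$$ -/

import Mathlib

noncomputable section

/-! ### Hyperplane arrangements and the Varchenko determinant -/

namespace Arrangement

variable {V : Type*} [NormedAddCommGroup V] [NormedSpace ℝ V]

/-- The complement of the union of the members of an arrangement. -/
def complement (A : Set (Submodule ℝ V)) : Set V :=
  (⋃ H ∈ A, (H : Set V))ᶜ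

/-- The chambers of `A`: the connected components of the complement of `A`. -/
def chambers (A : Set (Submodule ℝ V)) : Set (Set V) :=
  {C | ∃ x ∈ complement A, C = connectedComponentIn (complement A) x}

/-- `H` separates `C` and `D`: they lie strictly on opposite sides of `H`. -/
def Separates (H : Submodule ℝ V) (C D : Set V) : Prop :=
  ∃ f : Module.Dual ℝ V, H = LinearMap.ker f ∧ (∀ x ∈ C, 0 < f x) ∧ (∀ y ∈ D, f y < 0)

/-- The Varchenko matrix, with entries in the polynomial ring `ℤ[a_H | H ∈ A]`. -/
def varchenkoMatrix (A : Set (Submodule ℝ V)) :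
    Matrix (chambers A) (chambers A) (MvPolynomial A ℤ) :=
  open Classical in
  fun C D => if C = D then 1 else
    ∏ᶠ H : {H : A // Separates (H : Submodule ℝ V) (C : Set V) (D : Set V)},
      MvPolynomial.X (H : A)

/-- A finite arrangement has finitely many chambers. -/
theorem finite_chambers [FiniteDimensional ℝ V] (A : Set (Submodule ℝ V)) [Finite A] :
    Finite (chambers A) := by
  let L (H : Submodule ℝ V) : V →ₗ[ℝ] (Fin (Module.finrank ℝ (V ⧸ H)) → ℝ) :=
    (Module.finBasis ℝ (V ⧸ H)).equivFun.toLinearMap ∘ₗ H.mkQ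
  have hL (H : Submodule ℝ V) (x : V) : L H x = 0 ↔ x ∈ H := by
    simp [L]
  let σ (x : V) : (H : A) → Fin (Module.finrank ℝ (V ⧸ (H : Submodule ℝ V))) → SignType :=
    fun H k => SignType.sign (L H x k)
  have key (x y : V) (hx : x ∈ complement A) (hσ : σ x = σ y) :
      y ∈ connectedComponentIn (complement A) x := by
    have hseg : segment ℝ x y ⊆ complement A := by
      rintro z ⟨a, b, ha, hb, hab, rfl⟩
      simp only [complement, Set.mem_compl_iff, Set.mem_iUnion, not_exists] at hx ⊢
      intro H hH hz
      apply hx H hH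
      have hz' := (hL H _).2 hz
      refine (hL H x).1 ?_
      funext k
      have h1 : a * L H x k + b * L H y k = 0 := by
        have := congrFun hz' k
        simpa using this
      have h2 : SignType.sign (L H x k) = SignType.sign (L H y k) :=
        congrFun (congrFun hσ ⟨H, hH⟩) k
      have hpos : 0 < a ∨ 0 < b := by
        by_contra! h
        linarith
      rcases lt_trichotomy (L H x k) 0 with h | h | h
      · rw [sign_neg h, eq_comm, sign_eq_neg_one_iff] at h2
        rcases hpos with h3 | h3 <;> nlinarith
      · exact h
      · rw [sign_pos h, eq_comm, sign_eq_one_iff] at h2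
        rcases hpos with h3 | h3 <;> nlinarith
    exact (convex_segment x y).isPreconnected.subset_connectedComponentIn
      (left_mem_segment ℝ x y) hseg (right_mem_segment ℝ x y)
  choose p hp hpC using fun C : chambers A => C.2
  refine Finite.of_injective (fun C => σ (p C)) ?_
  intro C D hCD
  apply Subtype.ext
  rw [hpC C, hpC D]
  exact connectedComponentIn_eq (key _ _ (hp C) hCD)

/-- The Varchenko determinant of a finite arrangement. -/
def varchenkoDet [FiniteDimensional ℝ V] (A : Set (Submodule ℝ V)) [Finite A] :
    MvPolynomial A ℤ :=
  letI : Fintype (chambers A) := @Fintype.ofFinite _ (finite_chambers A)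
  open Classical in (varchenkoMatrix A).det

end Arrangement

/-! ### Geometric realizations of a Coxeter group -/

/-- A realization of the Coxeter matrix `M` in a real vector space `V`: simple roots `α i` and
linear forms `α∨ i` with `α∨ i (α j) = -2 cos (π / m_ij)`, so that the `i`-th simple reflection is
`x ↦ x - α∨ i (x) α i`. If `V` is Euclidean and the `α i` are unit simple roots of a reflection
group, then `α∨ i = 2 ⟪α i, ·⟫` (see `Realization.ofEuclidean`). Every Coxeter matrix has its
standard realization, on the space with basis `α i` (see `Realization.standard`). -/
structure CoxeterMatrix.Realization {B : Type*} (M : CoxeterMatrix B)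
    (V : Type*) [AddCommGroup V] [Module ℝ V] where
  root : B → V
  coroot : B → Module.Dual ℝ V
  coroot_root : ∀ i j, coroot i (root j) = -2 * Real.cos (Real.pi / M i j)

namespace CoxeterMatrix.Realization

variable {B : Type*} {M : CoxeterMatrix B} {V : Type*} [AddCommGroup V] [Module ℝ V]

/-- The standard geometric realization, on `ℝ^B`. -/
def standard [Fintype B] [DecidableEq B] (M : CoxeterMatrix B) : M.Realization (B → ℝ) where
  root i := Pi.single i 1
  coroot i := ∑ j, (-2 * Real.cos (Real.pi / M i j)) • LinearMap.proj j
  coroot_root i j := by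
    simp [LinearMap.sum_apply, Pi.single_apply]

/-- A system of unit vectors of a Euclidean space with `⟪α i, α j⟫ = -cos (π / m_ij)`. -/
def ofEuclidean {E : Type*} [NormedAddCommGroup E] [InnerProductSpace ℝ E] (M : CoxeterMatrix B)
    (α : B → E) (hα : ∀ i j, inner ℝ (α i) (α j) = -Real.cos (Real.pi / M i j)) :
    M.Realization E where
  root := α
  coroot i := (2 : ℝ) • (innerSL ℝ (α i)).toLinearMap
  coroot_root i j := by
    simp [hα]

theorem coroot_root_self (R : M.Realization V) (i : B) : R.coroot i (R.root i) = 2 := by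
  rw [R.coroot_root, M.diagonal]
  simp

/-- The simple reflection `x ↦ x - α∨ i (x) α i`. -/
def simpleReflection (R : M.Realization V) (i : B) : V ≃ₗ[ℝ] V :=
  Module.reflection (R.coroot_root_self i)

theorem isLiftable (R : M.Realization V) : M.IsLiftable R.simpleReflection := by
  intro i j
  have hij := R.coroot_root i j
  have hji := R.coroot_root j i
  rw [M.symmetric j i] at hji
  by_cases h0 : M i j = 0
  · rw [h0, pow_zero]
  by_cases h1 : i = j
  · subst h1
    rw [M.diagonal, pow_one]
    ext x
    exact Module.involutive_reflection (R.coroot_root_self i) x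
  have hne1 : M i j ≠ 1 := M.off_diagonal i j h1
  obtain h2 | h3 : M i j = 2 ∨ 3 ≤ M i j := by omega
  · rw [h2] at hij hji ⊢
    have hc : Real.cos (Real.pi / (2 : ℕ)) = 0 := by simp
    rw [hc, mul_zero] at hij hji
    ext x
    simp [pow_two, simpleReflection, Module.reflection_apply, hij, hji, coroot_root_self]
    module
  · ext x
    generalize hm : M i j = m at *
    have hm0 : (m : ℝ) ≠ 0 := by exact_mod_cast h0
    set θ : ℝ := 2 * (Real.pi / m) with hθ
    have hsin : Real.sin θ ≠ 0 := by
      have hm3 : (3 : ℝ) ≤ m := by exact_mod_cast h3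
      refine (Real.sin_pos_of_pos_of_lt_pi (by positivity) ?_).ne'
      rw [hθ, ← mul_div_assoc, div_lt_iff₀ (by positivity)]
      nlinarith [Real.pi_pos]
    have ht : 2 * Real.cos θ = R.coroot i (R.root j) * R.coroot j (R.root i) - 2 := by
      rw [hij, hji, hθ, Real.cos_two_mul]
      ring
    have hmθ : (m : ℝ) * θ = 2 * Real.pi := by
      rw [hθ]
      field_simp
    rw [simpleReflection, simpleReflection,
      Module.reflection_mul_reflection_pow_apply _ _ m x (2 * Real.cos θ) ht]
    obtain ⟨k, hk | hk⟩ := Nat.even_or_odd' m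
    · have e1 : ((m : ℤ) - 2) / 2 = k - 1 := by omega
      have e2 : ((m : ℤ) - 1) / 2 = k - 1 := by omega
      have hS : (Polynomial.Chebyshev.S ℝ ((k : ℤ) - 1)).eval (2 * Real.cos θ) = 0 := by
        have h := Polynomial.Chebyshev.S_two_mul_real_cos θ ((k : ℤ) - 1)
        have hkθ : (((k : ℤ) - 1 : ℤ) + 1 : ℝ) * θ = Real.pi := by
          rw [hk] at hmθ
          push_cast at hmθ ⊢
          linarith
        rw [hkθ, Real.sin_pi] at h
        exact (mul_eq_zero.1 h).resolve_right hsin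
      rw [e1, e2, hS]
      simp
    · have e1 : ((m : ℤ) - 2) / 2 = k - 1 := by omega
      have e2 : ((m : ℤ) - 1) / 2 = k := by omega
      have e3 : ((m : ℤ) - 3) / 2 = k - 1 := by omega
      have e4 : (m : ℤ) / 2 = k := by omega
      have hS : (Polynomial.Chebyshev.S ℝ (k : ℤ)).eval (2 * Real.cos θ) +
          (Polynomial.Chebyshev.S ℝ ((k : ℤ) - 1)).eval (2 * Real.cos θ) = 0 := by
        have h := Polynomial.Chebyshev.S_two_mul_real_cos θ (k : ℤ)
        have h' := Polynomial.Chebyshev.S_two_mul_real_cos θ ((k : ℤ) - 1)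
        have hkθ : (((k : ℤ) : ℝ) + 1) * θ =
            2 * Real.pi - (((k : ℤ) - 1 : ℤ) + 1 : ℝ) * θ := by
          rw [hk] at hmθ
          push_cast at hmθ ⊢
          linarith
        rw [hkθ, Real.sin_two_pi_sub] at h
        have hs : ((Polynomial.Chebyshev.S ℝ (k : ℤ)).eval (2 * Real.cos θ) +
          (Polynomial.Chebyshev.S ℝ ((k : ℤ) - 1)).eval (2 * Real.cos θ)) * Real.sin θ = 0 := by
          rw [add_mul, h, h']
          ring
        exact (mul_eq_zero.1 hs).resolve_right hsin
      rw [e1, e2, e3, e4, hS]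
      simp

variable {W : Type*} [Group W]

/-- The action of the Coxeter group on `V`. -/
def action (R : M.Realization V) (cs : CoxeterSystem M W) : W →* (V ≃ₗ[ℝ] V) :=
  cs.lift ⟨R.simpleReflection, R.isLiftable⟩

/-- `H_t = ker (t - 1)`. -/
def hyperplane (R : M.Realization V) (cs : CoxeterSystem M W) (t : W) : Submodule ℝ V :=
  LinearMap.ker ((R.action cs t : V →ₗ[ℝ] V) - LinearMap.id)

/-- The Coxeter arrangement `{H_t | t a reflection}`. -/
def arrangement (R : M.Realization V) (cs : CoxeterSystem M W) : Set (Submodule ℝ V) :=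
  {H | ∃ t, cs.IsReflection t ∧ H = R.hyperplane cs t}

instance finite_arrangement [Finite W] (R : M.Realization V) (cs : CoxeterSystem M W) :
    Finite (R.arrangement cs) :=
  ((Set.finite_range (R.hyperplane cs)).subset
    (by rintro _ ⟨t, -, rfl⟩; exact ⟨t, rfl⟩)).to_subtype

/-- The variable `a_{H_t}` attached to the hyperplane of a reflection `t`. -/
def hyperplaneVar (R : M.Realization V) (cs : CoxeterSystem M W) (t : {t // cs.IsReflection t}) :
    MvPolynomial (R.arrangement cs) ℤ :=
  MvPolynomial.X ⟨R.hyperplane cs t, t, t.2, rfl⟩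

end CoxeterMatrix.Realization

/-! ### Combinatorics of a Coxeter system -/

namespace CoxeterSystem

variable {B W : Type*} [Group W] {M : CoxeterMatrix B} (cs : CoxeterSystem M W)

/-- The set `S` of simple reflections. -/
def simples : Set W := Set.range cs.simple

/-- `x^w = w⁻¹ x w`, for subsets of `W`. -/
def conjSet (K : Set W) (w : W) : Set W := (fun x => w⁻¹ * x * w) '' K

/-- The reflections `T_J` of the parabolic subgroup `W_J = ⟨J⟩`. -/
def parabolicReflections (J : Set W) : Set W :=
  {t | cs.IsReflection t ∧ t ∈ Subgroup.closure J}

/-- `X_J`: the elements of minimal length in their coset `W_J x`. -/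
def minCosetReps (J : Set W) : Set W :=
  {x | ∀ y ∈ Subgroup.closure J, cs.length x ≤ cs.length (y * x)}

/-- `X(J, K) = {w ∈ W_J ∩ X_K ∩ X_K⁻¹ | K^w = K}`. -/
def doubleCosetReps (J K : Set W) : Set W :=
  {w | w ∈ Subgroup.closure J ∧ w ∈ cs.minCosetReps K ∧ w⁻¹ ∈ cs.minCosetReps K ∧
    conjSet K w = K}

/-- The Coxeter class `[J]`: the conjugates of `J` that are subsets of `S`. -/
def coxeterClass (J : Set W) : Set (Set W) :=
  {K | K ⊆ cs.simples ∧ ∃ w, K = conjSet J w}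

/-- `J ⊆ S` is irreducible: it is nonempty and is not the union of two disjoint nonempty subsets
that commute with each other elementwise. -/
def IsIrreducible (J : Set W) : Prop :=
  J ⊆ cs.simples ∧ J.Nonempty ∧
    ∀ J₁ J₂ : Set W, J₁ ∪ J₂ = J → Disjoint J₁ J₂ → J₁.Nonempty → J₂.Nonempty →
      ∃ a ∈ J₁, ∃ b ∈ J₂, ¬ Commute a b

/-- The support `J(x)`: the simple reflections that occur in a reduced expression of `x`. -/
def support (x : W) : Set W :=
  {s | ∃ ω : List B, cs.IsReduced ω ∧ cs.wordProd ω = x ∧ ∃ i ∈ ω, s = cs.simple i}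

/-- The elements conjugate to `x` with the same support as `x`. -/
def conjSameSupport (x : W) : Set W :=
  {y | cs.support y = cs.support x ∧ IsConj x y}

/-- `t` is a reflection with support `J`, and `s` is a simple reflection such that, for some `v`,
`s^v = v⁻¹ s v` is a reduced expression of `t`, that is, `ℓ(v⁻¹ s v) = ℓ(v) + 1 + ℓ(v)`. -/
def IsSupportReflection (J : Set W) (t s : W) : Prop :=
  cs.IsReflection t ∧ cs.support t = J ∧ s ∈ cs.simples ∧
    ∃ v, t = v⁻¹ * s * v ∧ cs.length t = 2 * cs.length v + 1

/-- The set of Coxeter classes `[J]` with `J` irreducible. -/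
def irreducibleClasses : Set (Set (Set W)) :=
  {c | ∃ J, cs.IsIrreducible J ∧ c = cs.coxeterClass J}

/-- `u^w` is a reflection if `u ∈ T_J`. -/
def conjReflection {J : Set W} (u : cs.parabolicReflections J) (w : W) :
    {t // cs.IsReflection t} :=
  ⟨w⁻¹ * u * w, by simpa using u.2.1.conj w⁻¹⟩

end CoxeterSystem

end

/-! Write `N(w)` for the set of left inversions of `w`. Chambers correspond to elements of `W`, and
the hyperplane of a reflection `t` separates those of `w` and `w'` iff `t` lies in the symmetric
difference of `N(w)` and `N(w')`. So the Varchenko matrix becomes a matrix `B_S` indexed by `W`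
(`varchenkoDet_eq`); this rests on the positivity of roots, proved for every realization. The
determinant is then computed with one variable per group element, and specialised at the end.

Factors. Let `B_J` keep only the entries with `w` and `w'` in the same coset `w W_J`. For `K ⊆ J`, a
shortest gallery from `w` to `w'` can be led through the projection of `w` to `w' W_K`; this gives
`B_J = G_{J,K} B_K` (`gateMatrix_mul_blockMatrix`). By inclusion-exclusion the alternating sum of
the `G_{J,K}` is the weighted permutation matrix of `w ↦ w w_J`, whose square is diagonal. By
induction on `J`, `det B_J` divides a power of the product of the `1 - a_A ^ 2`, where `a_A` is the
product of the variables of a flat `A`, the reflection set of a nontrivial parabolic subgroup. Sign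
changes of the variables do not affect `det B_S`, so its square is itself a product of powers of the
`1 - a_A ^ 2` (`exists_sq_eq_prod_of_dvd`).

Exponents. Put the variables outside a flat `A₀` equal to `0`. Passing to locally opposite chambers
relates the determinant at `a` to that at `a⁻¹` (`det_blockMatrix_reciprocity`). Comparing degrees
in `a_t` gives, for `t ∈ A₀`, that the exponents of the flats between `{t}` and `A₀` add up to the
number of `w` with `hull t w ⊆ A₀`. By induction on `A₀`, the exponent of `A` in the square is the
number of `w` with `hull t w = A`, for any `t ∈ A` (`exists_det_sq_eq`). Supports of reflections are
irreducible, so only conjugates of `W_J` with `J` irreducible contribute; these correspond to the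
cosets of the normalizer.

Count. For the flat of `W_J` take `t = t_J`. The relevant `w` factor uniquely as `v x d_K` with `K`
in `[J]`, `d_K` a fixed element conjugating `J` to `K`, `x` in `X(S, J)`, and `v` in `W_J` such that
`v⁻¹ t v` has support `J` (`card_conj_parabolic`). The elements of `⌊t⌉` are conjugate to `t`
already inside `W_J`, because the Coxeter graph is a forest (`isAcyclic_coxeterGraph`); so the
number of `v` is `|⌊t⌉|` times the order of a centralizer, which is `2 |X(J, {s})|`. The factor `2`
cancels the square, and the constant term `1` fixes the sign. -/

/-! ### The inversion cocycle -/

namespace CoxeterSystem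

section Cocycle

variable {B W : Type*} [Group W] {M : CoxeterMatrix B} (cs : CoxeterSystem M W)

open Classical in
/-- The involution of `W × ZMod 2` by which a simple reflection acts on signed elements. -/
noncomputable def signedConj (i : B) : Equiv.Perm (W × ZMod 2) :=
  Function.Involutive.toPerm
    (fun p => (cs.simple i * p.1 * cs.simple i, p.2 + if p.1 = cs.simple i then 1 else 0))
    (by
      rintro ⟨t, ε⟩
      have h : cs.simple i * t * cs.simple i = cs.simple i ↔ t = cs.simple i := by
        constructor
        · intro h
          have := congrArg (fun x => cs.simple i * x * cs.simple i) h
          simpa [mul_assoc] using this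
        · rintro rfl
          simp
      ext
      · simp [mul_assoc]
      · simp only [h, add_assoc]
        split_ifs
        · have h2 : (1 : ZMod 2) + 1 = 0 := by decide
          simp [h2]
        · simp)

open Classical in
theorem signedConj_apply (i : B) (t : W) (ε : ZMod 2) : cs.signedConj i (t, ε) =
    (cs.simple i * t * cs.simple i, ε + if t = cs.simple i then 1 else 0) := rfl

-- The elements `s_j (s_i s_j) ^ k` are the terms of the inversion sequence of the dihedral word;
-- the sign changes once for each term equal to `t`.
open Classical in
theorem signedConj_mul_pow_apply (i j : B) (n : ℕ) (t : W) (ε : ZMod 2) :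
    ((cs.signedConj i * cs.signedConj j) ^ n) (t, ε) =
      ((cs.simple i * cs.simple j) ^ n * t * ((cs.simple i * cs.simple j) ^ n)⁻¹,
        ε + ∑ k ∈ Finset.range (2 * n),
          if t = cs.simple j * (cs.simple i * cs.simple j) ^ k then 1 else 0) := by
  have hconj (k : ℕ) : ((cs.simple i * cs.simple j) ^ k)⁻¹ * cs.simple j =
      cs.simple j * (cs.simple i * cs.simple j) ^ k := by
    induction k with
    | zero => simp
    | succ k ih =>
      rw [pow_succ, mul_inv_rev, mul_assoc, ih, ← pow_succ, pow_succ']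
      simp [mul_assoc]
  induction n with
  | zero => simp
  | succ n ih =>
    set r := cs.simple i * cs.simple j with hr
    rw [pow_succ', Equiv.Perm.mul_apply, ih, Equiv.Perm.mul_apply, signedConj_apply,
      signedConj_apply]
    have h1 : r ^ n * t * (r ^ n)⁻¹ = cs.simple j ↔ t = cs.simple j * r ^ (2 * n) := by
      rw [two_mul, pow_add, ← mul_assoc, ← hconj n]
      constructor
      · intro h
        rw [← h]
        group
      · rintro rfl
        group
    have h2 : cs.simple j * (r ^ n * t * (r ^ n)⁻¹) * cs.simple j = cs.simple i ↔
        t = cs.simple j * r ^ (2 * n + 1) := by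
      have e : cs.simple j * r ^ (2 * n + 1) =
          (r ^ n)⁻¹ * (cs.simple j * cs.simple i * cs.simple j) * r ^ n := by
        rw [two_mul, add_assoc, pow_add, pow_succ', ← mul_assoc, ← hconj n, hr]
        simp [mul_assoc]
      rw [e]
      constructor
      · intro h
        rw [← h]
        simp [mul_assoc]
      · rintro rfl
        simp [mul_assoc]
    ext
    · simp [pow_succ', hr, mul_assoc]
    · simp only [h1, h2]
      rw [show 2 * (n + 1) = 2 * n + 1 + 1 by ring, Finset.sum_range_succ, Finset.sum_range_succ]
      ring

theorem isLiftable_signedConj : M.IsLiftable cs.signedConj := by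
  classical
  intro i j
  ext1 ⟨t, ε⟩
  rw [signedConj_mul_pow_apply, cs.simple_mul_simple_pow, two_mul, Finset.sum_range_add]
  -- The terms have period `M i j`, so the two halves of the sum cancel mod 2; for an infinite bond,
  -- `M i j = 0`, the sum is empty.
  have h : ∀ k, cs.simple j * (cs.simple i * cs.simple j) ^ (M i j + k) =
      cs.simple j * (cs.simple i * cs.simple j) ^ k := by
    intro k
    rw [pow_add, cs.simple_mul_simple_pow, one_mul]
  simp only [h, CharTwo.add_self_eq_zero]
  simp

/-- The action of `W` on signed elements. -/
noncomputable def signedConjHom : W →* Equiv.Perm (W × ZMod 2) :=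
  cs.lift ⟨cs.signedConj, cs.isLiftable_signedConj⟩

/-- The number of times, mod 2, that `t` is a right inversion of a word of `w`. -/
noncomputable def invParity (w t : W) : ZMod 2 := (cs.signedConjHom w (t, 0)).2

open Classical in
theorem signedConjHom_wordProd (ω : List B) (t : W) (ε : ZMod 2) :
    cs.signedConjHom (cs.wordProd ω) (t, ε) =
      (cs.wordProd ω * t * (cs.wordProd ω)⁻¹, ε + ((cs.rightInvSeq ω).count t : ZMod 2)) := by
  induction ω with
  | nil => simp
  | cons i ω ih =>
    rw [wordProd_cons, map_mul, Equiv.Perm.mul_apply, ih]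
    rw [signedConjHom, cs.lift_apply_simple cs.isLiftable_signedConj, signedConj_apply]
    have h : cs.wordProd ω * t * (cs.wordProd ω)⁻¹ = cs.simple i ↔
        (cs.wordProd ω)⁻¹ * cs.simple i * cs.wordProd ω = t := by
      constructor
      · intro h
        rw [← h]
        group
      · rintro rfl
        group
    ext
    · simp [mul_assoc]
    · simp only [h, rightInvSeq, List.count_cons, beq_iff_eq]
      push_cast
      ring

theorem signedConjHom_apply (w t : W) (ε : ZMod 2) :
    cs.signedConjHom w (t, ε) = (w * t * w⁻¹, ε + cs.invParity w t) := by
  classical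
  obtain ⟨ω, rfl⟩ := cs.wordProd_surjective w
  rw [invParity, signedConjHom_wordProd, signedConjHom_wordProd]
  simp

open Classical in
theorem invParity_wordProd (ω : List B) (t : W) :
    cs.invParity (cs.wordProd ω) t = ((cs.rightInvSeq ω).count t : ZMod 2) := by
  rw [invParity, signedConjHom_wordProd]
  simp

theorem invParity_one (t : W) : cs.invParity 1 t = 0 := by
  simp [invParity]

theorem invParity_mul (x y t : W) :
    cs.invParity (x * y) t = cs.invParity y t + cs.invParity x (y * t * y⁻¹) := by
  rw [invParity, map_mul, Equiv.Perm.mul_apply, signedConjHom_apply, signedConjHom_apply]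
  simp

theorem invParity_simple (i : B) : cs.invParity (cs.simple i) (cs.simple i) = 1 := by
  classical
  have := cs.invParity_wordProd [i] (cs.simple i)
  simpa using this

theorem IsReflection.invParity_self {cs : CoxeterSystem M W} {t : W} (ht : cs.IsReflection t) :
    cs.invParity t t = 1 := by
  obtain ⟨u, i, rfl⟩ := ht
  have h := cs.invParity_mul u u⁻¹ (u * cs.simple i * u⁻¹)
  rw [mul_inv_cancel, invParity_one] at h
  rw [invParity_mul, invParity_mul]
  have e : u⁻¹ * (u * cs.simple i * u⁻¹) * u⁻¹⁻¹ = cs.simple i := by group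
  rw [e] at h ⊢
  simp only [mul_inv_cancel_right, invParity_simple]
  rw [add_left_comm, ← h, add_zero]

/-- Odd parity forces `t` to occur in the inversion sequence of a reduced word. If the parity at `w`
is even, it is odd at `t w`, since `t` has odd parity at itself; then `t` is an inversion of `t w`,
hence not of `w`. -/
theorem isLeftInversion_iff_invParity {t : W} (ht : cs.IsReflection t) (w : W) :
    cs.IsLeftInversion w t ↔ cs.invParity w⁻¹ t = 1 := by
  classical
  have key (w : W) (h : cs.invParity w⁻¹ t = 1) : cs.IsLeftInversion w t := by
    obtain ⟨ω, hω, hw⟩ := cs.exists_isReduced w⁻¹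
    rw [← isRightInversion_inv_iff, hw]
    apply cs.isRightInversion_of_mem_rightInvSeq hω
    rw [hw, invParity_wordProd] at h
    by_contra hn
    rw [List.count_eq_zero_of_not_mem hn] at h
    simp at h
  refine ⟨fun h => ?_, key w⟩
  by_contra hn
  have h0 : cs.invParity w⁻¹ t = 0 := by
    have : ∀ x : ZMod 2, x ≠ 1 → x = 0 := by decide
    exact this _ hn
  have h1 : cs.IsLeftInversion (t * w) t := by
    apply key
    rw [mul_inv_rev, ht.inv, invParity_mul, ht.invParity_self, ht.mul_self, one_mul, ht.inv, h0,
      add_zero]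
  exact ht.isLeftInversion_mul_right_iff.1 h1 h

/-- The cocycle property of inversions: `N(xy) = N(x) ∆ x N(y) x⁻¹`. -/
theorem isLeftInversion_mul_iff {t : W} (ht : cs.IsReflection t) (x y : W) :
    cs.IsLeftInversion (x * y) t ↔
      ¬ (cs.IsLeftInversion x t ↔ cs.IsLeftInversion y (x⁻¹ * t * x)) := by
  have ht' : cs.IsReflection (x⁻¹ * t * x) := by simpa using ht.conj x⁻¹
  rw [isLeftInversion_iff_invParity _ ht, isLeftInversion_iff_invParity _ ht,
    isLeftInversion_iff_invParity _ ht', mul_inv_rev, invParity_mul, inv_inv]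
  generalize cs.invParity x⁻¹ t = a
  generalize cs.invParity y⁻¹ (x⁻¹ * t * x) = b
  revert a b
  decide

theorem not_isLeftInversion_one (t : W) : ¬ cs.IsLeftInversion 1 t := by
  rintro ⟨ht, h⟩
  simp at h

theorem IsReflection.isLeftInversion_self {cs : CoxeterSystem M W} {t : W}
    (ht : cs.IsReflection t) : cs.IsLeftInversion t t := by
  rw [cs.isLeftInversion_iff_invParity ht, ht.inv, ht.invParity_self]

theorem isLeftInversion_simple_iff {i : B} {t : W} :
    cs.IsLeftInversion (cs.simple i) t ↔ t = cs.simple i := by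
  constructor
  · rintro ⟨ht, h⟩
    rw [length_simple, Nat.lt_one_iff, length_eq_zero_iff] at h
    rw [← ht.inv]
    exact inv_eq_of_mul_eq_one_right h
  · rintro rfl
    exact (cs.isReflection_simple i).isLeftInversion_self

theorem isLeftInversion_inv_iff_conj {t : W} (ht : cs.IsReflection t) (x : W) :
    cs.IsLeftInversion x⁻¹ t ↔ cs.IsLeftInversion x (x * t * x⁻¹) := by
  have h := cs.isLeftInversion_mul_iff ht x⁻¹ x
  rw [inv_mul_cancel, inv_inv] at h
  have := cs.not_isLeftInversion_one t
  tauto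

/-- The exchange property. -/
theorem mem_leftInvSeq_of_isLeftInversion {ω : List B} {t : W}
    (h : cs.IsLeftInversion (cs.wordProd ω) t) : t ∈ cs.leftInvSeq ω := by
  classical
  have h1 := (cs.isLeftInversion_iff_invParity h.1 _).1 h
  rw [← wordProd_reverse, invParity_wordProd] at h1
  by_contra hn
  rw [List.count_eq_zero_of_not_mem (by rwa [rightInvSeq_reverse, List.mem_reverse])] at h1
  simp at h1

end Cocycle

/-! ### Parabolic subgroups -/

section Parabolic

variable {B W : Type*} [Group W] {M : CoxeterMatrix B} (cs : CoxeterSystem M W)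

open Subgroup (closure)

theorem isReflection_of_mem_simples {s : W} (hs : s ∈ cs.simples) : cs.IsReflection s := by
  obtain ⟨i, rfl⟩ := hs
  exact cs.isReflection_simple i

theorem exists_simple_isLeftInversion {w : W} (hw : w ≠ 1) :
    ∃ s ∈ cs.simples, cs.IsLeftInversion w s := by
  obtain ⟨i, hi⟩ := cs.exists_leftDescent_of_ne_one hw
  exact ⟨_, ⟨i, rfl⟩, (cs.isLeftInversion_simple_iff_isLeftDescent w i).2 hi⟩

/-- Every inversion of an element of a parabolic subgroup is conjugate to a generator in it. -/
theorem exists_conj_of_isLeftInversion {J : Set W} (hJ : J ⊆ cs.simples) {w : W}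
    (hw : w ∈ closure J) {t : W} (ht : cs.IsLeftInversion w t) :
    ∃ x ∈ closure J, ∃ s ∈ J, t = x * s * x⁻¹ := by
  induction hw using Subgroup.closure_induction generalizing t with
  | mem x hx =>
    obtain ⟨i, rfl⟩ := hJ hx
    rw [isLeftInversion_simple_iff] at ht
    exact ⟨1, one_mem _, _, hx, by simp [ht]⟩
  | one => exact absurd ht (cs.not_isLeftInversion_one t)
  | mul x y hx hy ihx ihy =>
    by_cases h : cs.IsLeftInversion x t
    · exact ihx h
    · have h2 := (cs.isLeftInversion_mul_iff ht.1 x y).1 ht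
      obtain ⟨z, hz, s, hs, e⟩ := ihy (t := x⁻¹ * t * x) (by tauto)
      refine ⟨x * z, mul_mem hx hz, s, hs, ?_⟩
      rw [mul_inv_rev, mul_assoc, mul_assoc, ← mul_assoc z, ← mul_assoc (z * s), ← e]
      group
  | inv x hx ih =>
    rw [isLeftInversion_inv_iff_conj _ ht.1] at ht
    obtain ⟨z, hz, s, hs, e⟩ := ih ht
    refine ⟨x⁻¹ * z, mul_mem (inv_mem hx) hz, s, hs, ?_⟩
    have : t = x⁻¹ * (x * t * x⁻¹) * x := by group
    rw [this, e]
    group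

theorem mem_closure_of_isLeftInversion {J : Set W} (hJ : J ⊆ cs.simples) {w : W}
    (hw : w ∈ closure J) {t : W} (ht : cs.IsLeftInversion w t) : t ∈ closure J := by
  obtain ⟨x, hx, s, hs, rfl⟩ := cs.exists_conj_of_isLeftInversion hJ hw ht
  exact mul_mem (mul_mem hx (Subgroup.subset_closure hs)) (inv_mem hx)

theorem exists_conj_of_mem_parabolicReflections {J : Set W} (hJ : J ⊆ cs.simples) {t : W}
    (ht : t ∈ cs.parabolicReflections J) : ∃ x ∈ closure J, ∃ s ∈ J, t = x * s * x⁻¹ :=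
  cs.exists_conj_of_isLeftInversion hJ ht.2 ht.1.isLeftInversion_self

/-- An element all of whose inversions lie in a subgroup `L` is a product of simple reflections
in `L`. -/
theorem mem_closure_inter_of_inversions {L : Subgroup W} {w : W}
    (h : ∀ t, cs.IsLeftInversion w t → t ∈ L) : w ∈ closure (cs.simples ∩ L) := by
  induction hn : cs.length w using Nat.strong_induction_on generalizing w with
  | _ n ih =>
    by_cases hw : w = 1
    · rw [hw]
      exact one_mem _
    obtain ⟨s, hs, hsw⟩ := cs.exists_simple_isLeftInversion hw
    have hsL := h s hsw
    have hss := hsw.1.mul_self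
    have hmem : s * w ∈ closure (cs.simples ∩ L) := by
      -- An inversion of `s w` other than `s` is the conjugate by `s ∈ L` of an inversion of `w`, so
      -- it stays in `L`.
      refine ih (cs.length (s * w)) (hn ▸ hsw.2) (w := s * w) ?_ rfl
      intro t ht
      by_cases hts : t = s
      · rwa [hts]
      rw [isLeftInversion_mul_iff _ ht.1] at ht
      obtain ⟨i, rfl⟩ := hs
      rw [isLeftInversion_simple_iff] at ht
      have h0 : cs.IsLeftInversion w ((cs.simple i)⁻¹ * t * cs.simple i) := by tauto
      have h1 := h _ h0
      have h2 := mul_mem (mul_mem hsL h1) hsL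
      simpa [mul_assoc] using h2
    have hs' : s ∈ closure (cs.simples ∩ L) := Subgroup.subset_closure ⟨hs, hsL⟩
    have := mul_mem hs' hmem
    rwa [← mul_assoc, hss, one_mul] at this

/-- Multiplying by a generator from `J` either lengthens a reduced word by that generator or, by
exchange, deletes a letter; letters outside `J` never enter. -/
theorem exists_isReduced_of_mem_closure {J : Set W} (hJ : J ⊆ cs.simples) {w : W}
    (hw : w ∈ closure J) :
    ∃ ω : List B, cs.IsReduced ω ∧ cs.wordProd ω = w ∧ ∀ i ∈ ω, cs.simple i ∈ J := by
  have step (s : W) (hs : s ∈ J) (y : W) (h : ∃ ω : List B, cs.IsReduced ω ∧ cs.wordProd ω = y ∧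
      ∀ i ∈ ω, cs.simple i ∈ J) : ∃ ω : List B, cs.IsReduced ω ∧ cs.wordProd ω = s * y ∧
      ∀ i ∈ ω, cs.simple i ∈ J := by
    obtain ⟨ω, hω, rfl, hωJ⟩ := h
    obtain ⟨i, rfl⟩ := hJ hs
    rcases cs.length_simple_mul (cs.wordProd ω) i with h | h
    · refine ⟨i :: ω, ?_, by simp [wordProd_cons], ?_⟩
      · rw [IsReduced, wordProd_cons, h, hω.eq]
        simp
      · simpa [hs] using hωJ
    · have hinv : cs.IsLeftInversion (cs.wordProd ω) (cs.simple i) :=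
        ⟨cs.isReflection_simple i, by lia⟩
      obtain ⟨k, hk, e⟩ := List.mem_iff_getElem.1 (cs.mem_leftInvSeq_of_isLeftInversion hinv)
      have hk' : k < ω.length := by simpa using hk
      have e2 := cs.getD_leftInvSeq_mul_wordProd ω k
      rw [List.getD_eq_getElem _ _ hk, e] at e2
      refine ⟨ω.eraseIdx k, ?_, e2.symm, fun j hj => hωJ j (List.mem_of_mem_eraseIdx hj)⟩
      have := List.length_eraseIdx_add_one hk'
      rw [IsReduced, ← e2]
      have := hω.eq
      lia
  refine Subgroup.closure_induction_left (p := fun w _ => ∃ ω : List B, cs.IsReduced ω ∧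
    cs.wordProd ω = w ∧ ∀ i ∈ ω, cs.simple i ∈ J) ?_ ?_ ?_ hw
  · exact ⟨[], by simp [IsReduced], by simp, by simp⟩
  · intro x hx y _ h
    exact step x hx y h
  · intro x hx y _ h
    rw [(cs.isReflection_of_mem_simples (hJ hx)).inv]
    exact step x hx y h

theorem mem_of_mem_simples_of_mem_closure {J : Set W} (hJ : J ⊆ cs.simples) {s : W}
    (hs : s ∈ cs.simples) (h : s ∈ closure J) : s ∈ J := by
  obtain ⟨ω, hω, rfl, hωJ⟩ := cs.exists_isReduced_of_mem_closure hJ h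
  obtain ⟨i, hi⟩ := hs
  have h1 : ω.length = 1 := by rw [← hω.eq, ← hi, length_simple]
  obtain ⟨j, rfl⟩ := List.length_eq_one_iff.1 h1
  simpa using hωJ j (by simp)

theorem closure_le_closure_iff {J K : Set W} (hJ : J ⊆ cs.simples) (hK : K ⊆ cs.simples) :
    closure J ≤ closure K ↔ J ⊆ K :=
  ⟨fun h _ hs => cs.mem_of_mem_simples_of_mem_closure hK (hJ hs) (h (Subgroup.subset_closure hs)),
    fun h => Subgroup.closure_mono h⟩

theorem subset_parabolicReflections {J : Set W} (hJ : J ⊆ cs.simples) :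
    J ⊆ cs.parabolicReflections J :=
  fun _ hs => ⟨cs.isReflection_of_mem_simples (hJ hs), Subgroup.subset_closure hs⟩

theorem closure_parabolicReflections {J : Set W} (hJ : J ⊆ cs.simples) :
    closure (cs.parabolicReflections J) = closure J :=
  le_antisymm ((Subgroup.closure_le _).2 fun _ ht => ht.2)
    (Subgroup.closure_mono (cs.subset_parabolicReflections hJ))

/-! ### Supports -/

theorem support_subset_simples (x : W) : cs.support x ⊆ cs.simples := by
  rintro _ ⟨_, _, _, i, _, rfl⟩
  exact ⟨i, rfl⟩

theorem wordProd_mem_closure {J : Set W} {ω : List B} (h : ∀ i ∈ ω, cs.simple i ∈ J) :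
    cs.wordProd ω ∈ closure J := by
  induction ω with
  | nil => simp
  | cons i ω ih =>
    rw [wordProd_cons]
    exact mul_mem (Subgroup.subset_closure (h i (by simp))) (ih fun j hj => h j (by simp [hj]))

theorem simple_mem_of_isReduced {J : Set W} (hJ : J ⊆ cs.simples) {ω : List B}
    (hω : cs.IsReduced ω) (h : cs.wordProd ω ∈ closure J) {i : B} (hi : i ∈ ω) :
    cs.simple i ∈ J := by
  induction ω with
  | nil => simp at hi
  | cons j ω ih =>
    have hj : cs.simple j ∈ closure J := by
      apply cs.mem_closure_of_isLeftInversion hJ h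
      exact cs.isLeftInversion_of_mem_leftInvSeq hω (by simp [leftInvSeq])
    have hω' : cs.IsReduced ω := by simpa using hω.drop 1
    rcases List.mem_cons.1 hi with rfl | hi
    · exact cs.mem_of_mem_simples_of_mem_closure hJ ⟨_, rfl⟩ hj
    · refine ih hω' ?_ hi
      rw [wordProd_cons] at h
      simpa using mul_mem hj h

theorem support_subset_iff {J : Set W} (hJ : J ⊆ cs.simples) {x : W} :
    cs.support x ⊆ J ↔ x ∈ closure J := by
  constructor
  · intro h
    obtain ⟨ω, hω, rfl⟩ := cs.exists_isReduced x
    exact cs.wordProd_mem_closure fun i hi => h ⟨ω, hω, rfl, i, hi, rfl⟩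
  · rintro h _ ⟨ω, hω, rfl, i, hi, rfl⟩
    exact cs.simple_mem_of_isReduced hJ hω h hi

theorem mem_closure_support (x : W) : x ∈ closure (cs.support x) :=
  (cs.support_subset_iff (cs.support_subset_simples x)).1 subset_rfl

theorem support_wordProd {ω : List B} (hω : cs.IsReduced ω) :
    cs.support (cs.wordProd ω) = {s | ∃ i ∈ ω, s = cs.simple i} := by
  apply subset_antisymm
  · rw [support_subset_iff]
    · exact cs.wordProd_mem_closure fun i hi => ⟨i, hi, rfl⟩
    · rintro _ ⟨i, _, rfl⟩
      exact ⟨i, rfl⟩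
  · rintro _ ⟨i, hi, rfl⟩
    exact ⟨ω, hω, rfl, i, hi, rfl⟩

theorem support_nonempty {x : W} (hx : x ≠ 1) : (cs.support x).Nonempty := by
  by_contra h
  rw [Set.not_nonempty_iff_eq_empty] at h
  have := cs.mem_closure_support x
  rw [h, Subgroup.closure_empty, Subgroup.mem_bot] at this
  exact hx this

theorem IsReflection.ne_one {cs : CoxeterSystem M W} {t : W} (ht : cs.IsReflection t) :
    t ≠ 1 := by
  rintro rfl
  exact cs.not_isLeftInversion_one 1 ht.isLeftInversion_self

/-! ### Minimal coset representatives and longest elements -/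

theorem eq_one_of_mem_closure {J : Set W} (hJ : J ⊆ cs.simples) {w : W} (hw : w ∈ closure J)
    (h : ∀ s ∈ J, ¬ cs.IsLeftInversion w s) : w = 1 := by
  by_contra hne
  obtain ⟨s, hs, hsw⟩ := cs.exists_simple_isLeftInversion hne
  exact h s (cs.mem_of_mem_simples_of_mem_closure hJ hs
    (cs.mem_closure_of_isLeftInversion hJ hw hsw)) hsw

theorem exists_mul_minimal (K : Set W) (x : W) :
    ∃ y ∈ closure K, ∀ t ∈ cs.parabolicReflections K, ¬ cs.IsLeftInversion (y * x) t := by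
  have hne : {n | ∃ y ∈ closure K, cs.length (y * x) = n}.Nonempty :=
    ⟨_, 1, one_mem _, rfl⟩
  obtain ⟨y, hy, hn⟩ := Nat.sInf_mem hne
  refine ⟨y, hy, fun t ht h => ?_⟩
  have := Nat.sInf_le (s := {n | ∃ y ∈ closure K, cs.length (y * x) = n})
    ⟨t * y, mul_mem ht.2 hy, rfl⟩
  rw [← hn, mul_assoc] at this
  exact absurd h.2 (not_lt.2 this)

/-- If `x` is minimal in `W_K x`, then the inversions of `y x` in `W_K` are those of `y`. -/
theorem isLeftInversion_mul_iff_of_minimal {K : Set W} {x y t : W}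
    (hx : ∀ t ∈ cs.parabolicReflections K, ¬ cs.IsLeftInversion x t) (hy : y ∈ closure K)
    (ht : t ∈ cs.parabolicReflections K) :
    cs.IsLeftInversion (y * x) t ↔ cs.IsLeftInversion y t := by
  have := hx (y⁻¹ * t * y)
    ⟨by simpa using ht.1.conj y⁻¹, mul_mem (mul_mem (inv_mem hy) ht.2) hy⟩
  rw [isLeftInversion_mul_iff _ ht.1]
  tauto

/-- With `y x` minimal in `W_K x`, the inversions of `x = y⁻¹ (y x)` in `W_K` are those of `y⁻¹`;
having none in `K`, the element `y⁻¹` is `1`. -/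
theorem minimal_of_simple {K : Set W} (hK : K ⊆ cs.simples) {x : W}
    (h : ∀ s ∈ K, ¬ cs.IsLeftInversion x s) {t : W} (ht : t ∈ cs.parabolicReflections K) :
    ¬ cs.IsLeftInversion x t := by
  obtain ⟨y, hy, hyx⟩ := cs.exists_mul_minimal K x
  have hy1 : y⁻¹ = 1 := by
    refine cs.eq_one_of_mem_closure hK (inv_mem hy) fun s hs => ?_
    rw [← cs.isLeftInversion_mul_iff_of_minimal hyx (inv_mem hy)
      (cs.subset_parabolicReflections hK hs), inv_mul_cancel_left]
    exact h s hs
  rw [inv_eq_one] at hy1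
  rw [hy1, one_mul] at hyx
  exact hyx t ht

theorem minimal_unique {K : Set W} (hK : K ⊆ cs.simples) {x y : W} (hy : y ∈ closure K)
    (hx : ∀ s ∈ K, ¬ cs.IsLeftInversion x s) (hyx : ∀ s ∈ K, ¬ cs.IsLeftInversion (y * x) s) :
    y = 1 := by
  refine cs.eq_one_of_mem_closure hK hy fun s hs => ?_
  rw [← cs.isLeftInversion_mul_iff_of_minimal (fun t ht => cs.minimal_of_simple hK hx ht) hy
    (cs.subset_parabolicReflections hK hs)]
  exact hyx s hs

theorem mem_minCosetReps_iff {K : Set W} (hK : K ⊆ cs.simples) {x : W} :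
    x ∈ cs.minCosetReps K ↔ ∀ t ∈ cs.parabolicReflections K, ¬ cs.IsLeftInversion x t := by
  constructor
  · intro h t ht hx
    exact absurd hx.2 (not_lt.2 (h t ht.2))
  · intro h y hy
    obtain ⟨z, hz, hzy⟩ : ∃ z ∈ closure K, ∀ w ∈ closure K,
        cs.length (z * x) ≤ cs.length (w * x) := by
      have hne : {n | ∃ y ∈ closure K, cs.length (y * x) = n}.Nonempty :=
        ⟨_, 1, one_mem _, rfl⟩
      obtain ⟨y, hy, hn⟩ := Nat.sInf_mem hne
      exact ⟨y, hy, fun w hw => hn ▸ Nat.sInf_le ⟨w, hw, rfl⟩⟩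
    have hz1 : z = 1 := by
      refine cs.minimal_unique hK hz (x := x)
        (fun s hs => h s (cs.subset_parabolicReflections hK hs)) fun s hs hn => ?_
      have := hzy (s * z) (mul_mem (Subgroup.subset_closure hs) hz)
      rw [mul_assoc] at this
      exact absurd hn.2 (not_lt.2 this)
    simpa [hz1] using hzy y hy

variable [Finite W]

theorem exists_longest {J : Set W} (hJ : J ⊆ cs.simples) :
    ∃ w ∈ closure J, ∀ t, cs.IsLeftInversion w t ↔ t ∈ cs.parabolicReflections J := by
  obtain ⟨w, hw, hmax⟩ := Set.exists_max_image (closure J : Set W) cs.length (Set.toFinite _)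
    ⟨1, one_mem _⟩
  refine ⟨w, hw, fun t => ⟨fun h => ⟨h.1, cs.mem_closure_of_isLeftInversion hJ hw h⟩,
    fun ht => ⟨ht.1, ?_⟩⟩⟩
  exact lt_of_le_of_ne (hmax _ (mul_mem ht.2 hw)) (ht.1.length_mul_right_ne w)

open Classical in
/-- The longest element of the parabolic subgroup generated by `J`. -/
noncomputable def longest (J : Set W) : W :=
  if hJ : J ⊆ cs.simples then (cs.exists_longest hJ).choose else 1

variable {J : Set W} (hJ : J ⊆ cs.simples)
include hJ

theorem longest_mem : cs.longest J ∈ closure J := by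
  rw [longest, dif_pos hJ]
  exact (cs.exists_longest hJ).choose_spec.1

theorem isLeftInversion_longest_iff {t : W} :
    cs.IsLeftInversion (cs.longest J) t ↔ t ∈ cs.parabolicReflections J := by
  rw [longest, dif_pos hJ]
  exact (cs.exists_longest hJ).choose_spec.2 t

theorem isLeftInversion_mul_longest_iff {x t : W} (hx : x ∈ closure J)
    (ht : t ∈ cs.parabolicReflections J) :
    cs.IsLeftInversion (x * cs.longest J) t ↔ ¬ cs.IsLeftInversion x t := by
  have h : x⁻¹ * t * x ∈ cs.parabolicReflections J :=
    ⟨by simpa using ht.1.conj x⁻¹, mul_mem (mul_mem (inv_mem hx) ht.2) hx⟩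
  rw [isLeftInversion_mul_iff _ ht.1, isLeftInversion_longest_iff _ hJ]
  tauto

theorem longest_mul_self : cs.longest J * cs.longest J = 1 := by
  have h := cs.longest_mem hJ
  refine cs.eq_one_of_mem_closure hJ (mul_mem h h) fun s hs => ?_
  have hs := cs.subset_parabolicReflections hJ hs
  rw [isLeftInversion_mul_longest_iff _ hJ h hs, isLeftInversion_longest_iff _ hJ]
  exact not_not.2 hs

theorem longest_inv : (cs.longest J)⁻¹ = cs.longest J :=
  inv_eq_of_mul_eq_one_right (cs.longest_mul_self hJ)

theorem eq_longest {u : W} (hu : u ∈ closure J) (h : ∀ s ∈ J, cs.IsLeftInversion u s) :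
    u = cs.longest J := by
  have : u * cs.longest J = 1 := by
    refine cs.eq_one_of_mem_closure hJ (mul_mem hu (cs.longest_mem hJ)) fun s hs => ?_
    rw [isLeftInversion_mul_longest_iff _ hJ hu (cs.subset_parabolicReflections hJ hs)]
    exact not_not.2 (h s hs)
  rw [← mul_one u, ← cs.longest_mul_self hJ, ← mul_assoc, this, one_mul]

end Parabolic

end CoxeterSystem

/-! ### The Varchenko matrix of a Coxeter group and its factorization -/

namespace CoxeterSystem

section Matrices

open Classical Subgroup Finset

variable {B W : Type*} [Group W] [Fintype W] {M : CoxeterMatrix B} (cs : CoxeterSystem M W)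
variable {A : Type*} [CommRing A]

/-- The reflections whose hyperplanes separate the chambers of `w` and `w'`. -/
noncomputable def sep (w w' : W) : Finset W :=
  {t | ¬ (cs.IsLeftInversion w t ↔ cs.IsLeftInversion w' t)}

theorem mem_sep {w w' t : W} :
    t ∈ cs.sep w w' ↔ ¬ (cs.IsLeftInversion w t ↔ cs.IsLeftInversion w' t) := by
  simp [sep]

theorem mem_sep_iff {w w' t : W} :
    t ∈ cs.sep w w' ↔ cs.IsLeftInversion (w⁻¹ * w') (w⁻¹ * t * w) := by
  rw [mem_sep]
  by_cases ht : cs.IsReflection t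
  · have h := cs.isLeftInversion_mul_iff ht w (w⁻¹ * w')
    rw [mul_inv_cancel_left] at h
    tauto
  · have h1 : ¬ cs.IsLeftInversion w t := fun h => ht h.1
    have h2 : ¬ cs.IsLeftInversion w' t := fun h => ht h.1
    have h3 : ¬ cs.IsLeftInversion (w⁻¹ * w') (w⁻¹ * t * w) := fun h => ht <| by
      have := h.1.conj w
      simpa [mul_assoc] using this
    tauto

theorem sep_self (w : W) : cs.sep w w = ∅ := by
  simp [sep]

theorem sep_comm (w w' : W) : cs.sep w w' = cs.sep w' w := by
  ext t
  simp only [mem_sep]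
  tauto

theorem isReflection_of_mem_sep {w w' t : W} (h : t ∈ cs.sep w w') : cs.IsReflection t := by
  by_contra hn
  rw [mem_sep] at h
  have h1 : ¬ cs.IsLeftInversion w t := fun h => hn h.1
  have h2 : ¬ cs.IsLeftInversion w' t := fun h => hn h.1
  tauto

/-- The reflections of the conjugate `w W_J w⁻¹` of the parabolic subgroup `W_J`. -/
noncomputable def conjReflections (J : Set W) (w : W) : Finset W :=
  {t | w⁻¹ * t * w ∈ cs.parabolicReflections J}

theorem mem_conjReflections {J : Set W} {w t : W} :
    t ∈ cs.conjReflections J w ↔ w⁻¹ * t * w ∈ cs.parabolicReflections J := by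
  simp [conjReflections]

theorem conjReflections_mul {J : Set W} {u : W} (hu : u ∈ closure J) (w : W) :
    cs.conjReflections J (w * u) = cs.conjReflections J w := by
  ext t
  rw [mem_conjReflections, mem_conjReflections]
  have e : (w * u)⁻¹ * t * (w * u) = u⁻¹ * (w⁻¹ * t * w) * u⁻¹⁻¹ := by group
  rw [e]
  refine and_congr (cs.isReflection_conj_iff _ _) ?_
  rw [inv_inv, Subgroup.mul_mem_cancel_right _ hu, Subgroup.mul_mem_cancel_left _ (inv_mem hu)]

theorem sep_subset_conjReflections {J : Set W} (hJ : J ⊆ cs.simples) {w w' : W}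
    (h : w⁻¹ * w' ∈ closure J) : cs.sep w w' ⊆ cs.conjReflections J w := by
  intro t ht
  rw [mem_sep_iff] at ht
  exact cs.mem_conjReflections.2 ⟨ht.1, cs.mem_closure_of_isLeftInversion hJ h ht⟩

theorem sep_mul_longest {J : Set W} (hJ : J ⊆ cs.simples) {w w' : W}
    (h : w⁻¹ * w' ∈ closure J) :
    cs.sep w (w' * cs.longest J) = cs.conjReflections J w \ cs.sep w w' := by
  ext t
  rw [mem_sdiff]
  by_cases ht : t ∈ cs.conjReflections J w
  · rw [mem_sep_iff, mem_sep_iff, ← mul_assoc,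
      cs.isLeftInversion_mul_longest_iff hJ h (cs.mem_conjReflections.1 ht)]
    tauto
  · have hsub := cs.sep_subset_conjReflections hJ (w := w) (w' := w' * cs.longest J)
      (by rw [← mul_assoc]; exact mul_mem h (cs.longest_mem hJ))
    exact iff_of_false (fun h => ht (hsub h)) fun h => ht h.1

/-- The restriction of the Varchenko matrix to the cosets of `W_J`. -/
noncomputable def blockMatrix (a : W → A) (J : Set W) : Matrix W W A :=
  fun w w' => if w⁻¹ * w' ∈ closure J then ∏ t ∈ cs.sep w w', a t else 0

/-- The part of `blockMatrix a J` supported on the pairs `(w, w')` for which `w'` is the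
projection of `w` to `w' W_K`. -/
noncomputable def gateMatrix (a : W → A) (J K : Set W) : Matrix W W A :=
  fun w w' => if ∀ s ∈ K, ¬ cs.IsLeftInversion (w'⁻¹ * w) s then cs.blockMatrix a J w w' else 0

/-- The weighted permutation matrix of `w ↦ w w_J`. -/
noncomputable def longestMatrix (a : W → A) (J : Set W) : Matrix W W A :=
  fun w w' => if w' = w * cs.longest J then ∏ t ∈ cs.conjReflections J w, a t else 0

variable (a : W → A)

/-- The coset `w' W_K` contains exactly one gate for `w`, so one summand survives. No reflection
separates both `w` from the gate and the gate from `w'`, so the two weights multiply to the weight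
of the pair. -/
theorem gateMatrix_mul_blockMatrix {J K : Set W} (hJ : J ⊆ cs.simples) (hKJ : K ⊆ J) :
    cs.gateMatrix a J K * cs.blockMatrix a K = cs.blockMatrix a J := by
  have hK := hKJ.trans hJ
  have hle : closure K ≤ closure J := Subgroup.closure_mono hKJ
  ext w w'
  rw [Matrix.mul_apply]
  -- The gate is `w' * y⁻¹`: seen from it, `w` is the element `y * (w'⁻¹ * w)`, minimal in its
  -- coset.
  obtain ⟨y, hy, hmin⟩ := cs.exists_mul_minimal K (w'⁻¹ * w)
  rw [Finset.sum_eq_single (w' * y⁻¹)]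
  · have e1 : (w' * y⁻¹)⁻¹ * w = y * (w'⁻¹ * w) := by group
    have e2 : (w' * y⁻¹)⁻¹ * w' = y := by group
    have hgate : ∀ s ∈ K, ¬ cs.IsLeftInversion ((w' * y⁻¹)⁻¹ * w) s := fun s hs => by
      rw [e1]
      exact hmin s (cs.subset_parabolicReflections hK hs)
    have hmem : w⁻¹ * (w' * y⁻¹) ∈ closure J ↔ w⁻¹ * w' ∈ closure J := by
      rw [← mul_assoc, Subgroup.mul_mem_cancel_right _ (hle (inv_mem hy))]
    rw [gateMatrix, if_pos hgate, blockMatrix, blockMatrix, blockMatrix, e2, if_pos hy]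
    simp only [hmem]
    split_ifs with hw
    · have hdisj : Disjoint (cs.sep w (w' * y⁻¹)) (cs.sep (w' * y⁻¹) w') := by
        rw [Finset.disjoint_left]
        intro t h1 h2
        rw [sep_comm, mem_sep_iff, e1] at h1
        rw [mem_sep_iff, e2] at h2
        exact hmin _ ⟨h2.1, cs.mem_closure_of_isLeftInversion hK hy h2⟩ h1
      rw [← Finset.prod_union hdisj]
      refine Finset.prod_congr ?_ fun _ _ => rfl
      ext t
      have := fun h => Finset.disjoint_left.1 hdisj (show t ∈ _ from h)
      simp only [mem_union, mem_sep] at this ⊢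
      tauto
    · rw [zero_mul]
  · intro w'' _ hne
    rw [gateMatrix, blockMatrix, blockMatrix]
    split_ifs with h1 h2 h3 <;> try simp
    exfalso
    apply hne
    have h4 : w''⁻¹ * w' * y⁻¹ = 1 := by
      refine cs.minimal_unique hK (mul_mem h3 (inv_mem hy)) (x := y * (w'⁻¹ * w))
        (fun s hs => hmin s (cs.subset_parabolicReflections hK hs)) ?_
      have e : w''⁻¹ * w' * y⁻¹ * (y * (w'⁻¹ * w)) = w''⁻¹ * w := by group
      rw [e]
      exact h1
    rw [mul_assoc, inv_mul_eq_one] at h4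
    exact h4
  · simp

theorem gateMatrix_self {J : Set W} (hJ : J ⊆ cs.simples) : cs.gateMatrix a J J = 1 := by
  ext w w'
  rw [gateMatrix, blockMatrix, Matrix.one_apply]
  by_cases h : w = w'
  · subst h
    simp [sep_self, not_isLeftInversion_one]
  · rw [if_neg h]
    split_ifs with h1 h2
    · exfalso
      apply h
      have hmem : w'⁻¹ * w ∈ closure J := by simpa using inv_mem h2
      exact (inv_mul_eq_one.1 (cs.eq_one_of_mem_closure hJ hmem h1)).symm
    · rfl
    · rfl

/-- The sum at `(w, w')` runs over the sets `K` of those elements of `J` that are not inversions of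
`w'⁻¹ w`. It vanishes unless there are none, and inside `W_J` only the longest element has all of
`J` as inversions. -/
theorem sum_gateMatrix {J : Finset W} (hJ : (J : Set W) ⊆ cs.simples) :
    ∑ K ∈ J.powerset, (-1 : A) ^ #K • cs.gateMatrix a J K = cs.longestMatrix a J := by
  ext w w'
  rw [Matrix.sum_apply]
  simp only [Matrix.smul_apply, gateMatrix, smul_eq_mul, mul_ite, mul_zero]
  rw [← Finset.sum_filter, ← Finset.sum_mul]
  have hfilter : Finset.filter
        (fun K : Finset W => ∀ s ∈ (K : Set W), ¬ cs.IsLeftInversion (w'⁻¹ * w) s) J.powerset =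
      ({s ∈ J | ¬ cs.IsLeftInversion (w'⁻¹ * w) s} : Finset W).powerset := by
    ext K
    simp only [mem_filter, mem_powerset, mem_coe, subset_iff]
    exact ⟨fun h s hs => ⟨h.1 hs, h.2 s hs⟩, fun h => ⟨fun s hs => (h hs).1, fun s hs => (h hs).2⟩⟩
  rw [hfilter]
  have hsum := Finset.sum_powerset_neg_one_pow_card
    (x := ({s ∈ J | ¬ cs.IsLeftInversion (w'⁻¹ * w) s} : Finset W))
  have hsum' := congrArg (Int.cast : ℤ → A) hsum
  push_cast at hsum'
  simp only [hsum', Finset.filter_eq_empty_iff, longestMatrix, blockMatrix]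
  by_cases hw : w⁻¹ * w' ∈ closure (J : Set W)
  · rw [if_pos hw]
    have hmem : w'⁻¹ * w ∈ closure (J : Set W) := by simpa using inv_mem hw
    by_cases hl : w' = w * cs.longest J
    · have e : w'⁻¹ * w = cs.longest J := by
        rw [hl, mul_inv_rev, inv_mul_cancel_right, cs.longest_inv hJ]
      rw [if_pos hl, if_pos, one_mul]
      · have := cs.sep_mul_longest hJ (w := w) (w' := w) (by simp)
        rw [hl, this, sep_self, sdiff_empty]
      · intro s hs
        rw [e, not_not, cs.isLeftInversion_longest_iff hJ]
        exact cs.subset_parabolicReflections hJ hs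
    · rw [if_neg hl, if_neg, zero_mul]
      intro h
      apply hl
      have := cs.eq_longest hJ hmem fun s hs => not_not.1 (h hs)
      rw [← cs.longest_inv hJ, ← this]
      group
  · rw [if_neg hw, mul_zero, if_neg]
    rintro rfl
    rw [inv_mul_cancel_left] at hw
    exact hw (cs.longest_mem hJ)

theorem longestMatrix_mul_self {J : Set W} (hJ : J ⊆ cs.simples) :
    cs.longestMatrix a J * cs.longestMatrix a J =
      Matrix.diagonal fun w => (∏ t ∈ cs.conjReflections J w, a t) ^ 2 := by
  ext w w'
  rw [Matrix.mul_apply, Finset.sum_eq_single (w * cs.longest J), longestMatrix, longestMatrix,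
    if_pos rfl, Matrix.diagonal_apply, mul_assoc, cs.longest_mul_self hJ, mul_one,
    cs.conjReflections_mul (cs.longest_mem hJ)]
  · by_cases h : w' = w
    · rw [if_pos h, if_pos h.symm, pow_two]
    · rw [if_neg h, if_neg (Ne.symm h), mul_zero]
  · intro w'' _ h
    rw [longestMatrix, if_neg h, zero_mul]
  · simp

/-- Formally `G_{J,K} = B_J B_K⁻¹`, so the alternating sum over proper subsets `K` makes `L - ε` a
right multiple of `B_J`, and `1 - L ^ 2 = -(L - ε) (L + ε)` is diagonal. Replacing inverses by
adjugates costs a power of `Δ`. -/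
theorem det_blockMatrix_dvd {J : Finset W} (hJ : (J : Set W) ⊆ cs.simples) :
    (cs.blockMatrix a J).det ∣ (∏ K ∈ J.ssubsets, (cs.blockMatrix a K).det) ^ Fintype.card W *
      ∏ w, (1 - (∏ t ∈ cs.conjReflections J w, a t) ^ 2) := by
  set Δ := ∏ K ∈ J.ssubsets, (cs.blockMatrix a K).det with hΔ
  set ε : A := (-1) ^ #J with hε
  set L := cs.longestMatrix a (J : Set W) with hL
  -- `Δ` times the alternating sum of the inverses of the `B_K`, written without division.
  let X : Matrix W W A := ∑ K ∈ J.ssubsets, (-1 : A) ^ #K •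
    (∏ K' ∈ J.ssubsets.erase K, (cs.blockMatrix a K').det) • (cs.blockMatrix a K).adjugate
  have hX : cs.blockMatrix a J * X = Δ • (L - ε • 1) := by
    have h1 : L - ε • 1 = ∑ K ∈ J.ssubsets, (-1 : A) ^ #K • cs.gateMatrix a J K := by
      rw [hL, ← sum_gateMatrix _ _ hJ, ← Finset.sum_erase_add _ _ (mem_powerset_self J),
        cs.gateMatrix_self a hJ, ← hε, add_sub_cancel_right]
      rfl
    rw [h1, Finset.smul_sum, Finset.mul_sum]
    refine Finset.sum_congr rfl fun K hK => ?_
    have hKJ : (K : Set W) ⊆ J := by exact_mod_cast (mem_ssubsets.1 hK).1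
    rw [Matrix.mul_smul, Matrix.mul_smul, ← cs.gateMatrix_mul_blockMatrix a hJ hKJ,
      Matrix.mul_assoc, Matrix.mul_adjugate, Matrix.mul_smul, Matrix.mul_one, hΔ,
      ← Finset.mul_prod_erase _ _ hK]
    simp only [smul_smul]
    congr 1
    ring
  have hεε : ε * ε = 1 := by
    rw [hε, ← pow_add, ← two_mul, pow_mul]
    simp
  have hprod : (-(L - ε • 1)) * (L + ε • 1) =
      Matrix.diagonal fun w => 1 - (∏ t ∈ cs.conjReflections J w, a t) ^ 2 := by
    have : (-(L - ε • 1)) * (L + ε • 1) = 1 - L * L := by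
      rw [neg_mul, sub_mul, mul_add, mul_add, Matrix.smul_mul, Matrix.smul_mul, Matrix.one_mul,
        Matrix.one_mul, Matrix.mul_smul, Matrix.mul_one, smul_smul, hεε, one_smul]
      abel
    rw [this, hL, longestMatrix_mul_self _ _ hJ, ← Matrix.diagonal_one, Matrix.diagonal_sub]
  have hdet : (cs.blockMatrix a J).det * (-X).det * (L + ε • 1).det = Δ ^ Fintype.card W *
      ∏ w, (1 - (∏ t ∈ cs.conjReflections J w, a t) ^ 2) := by
    rw [← Matrix.det_diagonal, ← hprod, ← Matrix.det_mul, mul_neg, hX, ← smul_neg,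
      Matrix.det_smul, Matrix.det_mul, mul_assoc]
  exact Dvd.intro _ (by rw [← hdet, mul_assoc])

theorem det_blockMatrix_empty : (cs.blockMatrix a ∅).det = 1 := by
  have : cs.blockMatrix a ∅ = 1 := by
    ext w w'
    rw [blockMatrix, Subgroup.closure_empty, Subgroup.mem_bot, inv_mul_eq_one, Matrix.one_apply]
    split_ifs with h
    · rw [h, sep_self, prod_empty]
    · rfl
  rw [this, Matrix.det_one]

/-- The nonempty sets of simple reflections. -/
noncomputable def nonemptyParabolics : Finset (Finset W) :=
  {K | (K : Set W) ⊆ cs.simples ∧ K.Nonempty}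

theorem det_blockMatrix_dvd_pow (J : Finset W) (hJ : (J : Set W) ⊆ cs.simples) :
    ∃ N, (cs.blockMatrix a J).det ∣ (∏ p ∈ cs.nonemptyParabolics ×ˢ (univ : Finset W),
      (1 - (∏ t ∈ cs.conjReflections p.1 p.2, a t) ^ 2)) ^ N := by
  induction J using Finset.strongInduction with
  | H J ih =>
    set Q := ∏ p ∈ cs.nonemptyParabolics ×ˢ (univ : Finset W),
      (1 - (∏ t ∈ cs.conjReflections p.1 p.2, a t) ^ 2) with hQ
    rcases J.eq_empty_or_nonempty with rfl | hne
    · exact ⟨0, by simp [det_blockMatrix_empty]⟩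
    have hΔ : ∃ N, ∏ K ∈ J.ssubsets, (cs.blockMatrix a K).det ∣ Q ^ N := by
      have h : ∀ K ∈ J.ssubsets, ∃ N, (cs.blockMatrix a K).det ∣ Q ^ N := fun K hK =>
        ih K (mem_ssubsets.1 hK) (subset_trans (by exact_mod_cast (mem_ssubsets.1 hK).1) hJ)
      choose! N hN using h
      exact ⟨∑ K ∈ J.ssubsets, N K, by
        rw [← Finset.prod_pow_eq_pow_sum]
        exact Finset.prod_dvd_prod_of_dvd _ _ hN⟩
    obtain ⟨N, hN⟩ := hΔ
    have hJ' : J ∈ cs.nonemptyParabolics := by simp [nonemptyParabolics, hJ, hne]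
    have hw : ∏ w, (1 - (∏ t ∈ cs.conjReflections J w, a t) ^ 2) ∣ Q := by
      rw [hQ, Finset.prod_product]
      exact Finset.dvd_prod_of_mem
        (fun K : Finset W => ∏ w, (1 - (∏ t ∈ cs.conjReflections K w, a t) ^ 2)) hJ'
    refine ⟨N * Fintype.card W + 1, (cs.det_blockMatrix_dvd a hJ).trans ?_⟩
    rw [pow_succ, pow_mul]
    exact mul_dvd_mul (pow_dvd_pow_of_dvd hN _) hw

end Matrices

end CoxeterSystem

/-! ### Polynomials dividing products of `1 - x_A ^ 2` -/

namespace MvPolynomial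

open Finset

variable {σ ι : Type*}

/-- The polynomial has degree one in a variable of `A` and its other coefficient is a unit, so it is
irreducible, and the ring is factorial. -/
theorem prime_one_sub_prod_X {A : Finset σ} (hA : A.Nonempty) (ε : ℤˣ) :
    Prime (1 - C (ε : ℤ) * ∏ t ∈ A, (X t : MvPolynomial σ ℤ)) := by
  classical
  obtain ⟨t, ht⟩ := hA
  rw [← UniqueFactorizationMonoid.irreducible_iff_prime]
  have hprod : (∏ t ∈ A.erase t, (X t : MvPolynomial σ ℤ)) ≠ 0 :=
    Finset.prod_ne_zero_iff.2 fun _ _ => X_ne_zero _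
  have hvars : t ∉ (∏ t ∈ A.erase t, (X t : MvPolynomial σ ℤ)).vars := by
    intro h
    have := vars_prod _ h
    simp [vars_X] at this
  have h := irreducible_mul_X_add (C (-(ε : ℤ)) * ∏ t ∈ A.erase t, (X t : MvPolynomial σ ℤ)) 1 t
    (mul_ne_zero (by simp) hprod) (by rwa [vars_C_mul _ (by simp)]) (by simp)
    isRelPrime_one_right
  have e : (1 - C (ε : ℤ) * ∏ t ∈ A, (X t : MvPolynomial σ ℤ)) =
      C (-(ε : ℤ)) * (∏ t ∈ A.erase t, (X t : MvPolynomial σ ℤ)) * X t + 1 := by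
    rw [← Finset.mul_prod_erase _ _ ht, C_neg]
    ring
  rw [e]
  exact h

/-- A divisor of a product of polynomials `1 - x_A ^ 2` that is invariant under all sign changes
of the variables has a square of the same shape. -/
theorem exists_sq_eq_prod_of_dvd [Fintype σ] {f : MvPolynomial σ ℤ} {s : Finset ι}
    {A : ι → Finset σ} (hA : ∀ i ∈ s, (A i).Nonempty) {N : ℕ}
    (hdvd : f ∣ (∏ i ∈ s, (1 - (∏ t ∈ A i, X t) ^ 2)) ^ N)
    (hflip : ∀ (u : σ → ℤˣ) (x : σ → ℤ), eval (fun t => (u t : ℤ) * x t) f = eval x f) :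
    ∃ c : ι → ℕ, f ^ 2 = ∏ i ∈ s, (1 - (∏ t ∈ A i, X t) ^ 2) ^ c i := by
  classical
  -- The middle index numbers the `N` copies of a factor, the last one distinguishes its two primes
  -- `1 - x_A` and `1 + x_A`.
  let p : ι × ℕ × ℤˣ → MvPolynomial σ ℤ := fun j => 1 - C (j.2.2 : ℤ) * ∏ t ∈ A j.1, X t
  have hp : ∀ j ∈ s ×ˢ range N ×ˢ (univ : Finset ℤˣ), Prime (p j) := fun j hj =>
    prime_one_sub_prod_X (hA _ (mem_product.1 hj).1) _
  have hprod : ∏ j ∈ s ×ˢ range N ×ˢ (univ : Finset ℤˣ), p j =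
      (∏ i ∈ s, (1 - (∏ t ∈ A i, X t) ^ 2)) ^ N := by
    rw [Finset.prod_product, ← Finset.prod_pow]
    refine Finset.prod_congr rfl fun i _ => ?_
    have huniv : (univ : Finset ℤˣ) = {1, -1} := rfl
    have hk (k : ℕ) : ∏ ε : ℤˣ, p (i, k, ε) = 1 - (∏ t ∈ A i, X t) ^ 2 := by
      rw [huniv, Finset.prod_pair (by decide)]
      simp [p]
      ring
    rw [Finset.prod_product, Finset.prod_congr rfl fun k _ => hk k, Finset.prod_const, card_range]
  obtain ⟨g, hg⟩ := hdvd
  rw [← hprod] at hg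
  obtain ⟨T, U, b, b', hTU, -, hb, hf, -⟩ :=
    mul_eq_mul_prime_prod (x := f) (y := g) (a := 1) hp (by rw [one_mul, hg])
  have hT : ∀ j ∈ T, j.1 ∈ s := fun j hj =>
    (mem_product.1 (hTU ▸ mem_union_left U hj : j ∈ s ×ˢ range N ×ˢ (univ : Finset ℤˣ))).1
  have hbu : IsUnit b := IsUnit.of_mul_eq_one b' hb.symm
  let h : MvPolynomial σ ℤ := ∏ j ∈ T, (1 - (∏ t ∈ A j.1, X t) ^ 2)
  have hh : h = ∏ i ∈ s, (1 - (∏ t ∈ A i, X t) ^ 2) ^ #{j ∈ T | j.1 = i} := by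
    simp only [h]
    rw [← Finset.prod_fiberwise_of_maps_to (g := fun j : ι × ℕ × ℤˣ => j.1) (t := s) hT]
    refine Finset.prod_congr rfl fun i _ => ?_
    rw [← Finset.prod_const]
    refine Finset.prod_congr rfl fun j hj => ?_
    rw [(mem_filter.1 hj).2]
  -- Multiplying over all sign changes forgets which of the two primes occurred: changing the sign
  -- of one variable of `A` exchanges them, so `u` is paired with `v * u`.
  have hjsq (j) (hj : j ∈ T) (x : σ → ℤ) :
      (∏ u : σ → ℤˣ, eval (fun t => (u t : ℤ) * x t) (p j)) ^ 2 =
        eval x (1 - (∏ t ∈ A j.1, X t) ^ 2) ^ Fintype.card (σ → ℤˣ) := by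
    obtain ⟨t₀, ht₀⟩ := hA _ (hT j hj)
    let v : σ → ℤˣ := Pi.mulSingle t₀ (-1)
    have hv : ∏ t ∈ A j.1, v t = -1 := by
      rw [Finset.prod_eq_single t₀]
      · simp [v]
      · intro t _ ht
        simp [v, ht]
      · exact fun h => absurd ht₀ h
    rw [pow_two]
    nth_rewrite 2 [← Equiv.prod_comp (Equiv.mulLeft v)]
    rw [← Finset.prod_mul_distrib, Fintype.card, ← Finset.prod_const]
    refine Finset.prod_congr rfl fun u _ => ?_
    have e1 (u : σ → ℤˣ) : ∏ t ∈ A j.1, ((u t : ℤ) * x t) =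
        ((∏ t ∈ A j.1, u t : ℤˣ) : ℤ) * ∏ t ∈ A j.1, x t := by
      rw [Finset.prod_mul_distrib]
      simp
    have e2 : ∏ t ∈ A j.1, (v * u) t = -∏ t ∈ A j.1, u t := by
      simp only [Pi.mul_apply, Finset.prod_mul_distrib, hv]
      simp
    simp only [p, Equiv.coe_mulLeft, map_sub, map_one, map_mul, map_prod, eval_X, eval_C, e1, e2,
      map_pow]
    generalize (∏ t ∈ A j.1, u t) = q
    have hq : (q : ℤ) ^ 2 = 1 := by
      rw [← Units.val_pow_eq_pow_val, Int.units_sq]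
      rfl
    have hε : ((j.2.2 : ℤˣ) : ℤ) ^ 2 = 1 := by
      rw [← Units.val_pow_eq_pow_val, Int.units_sq]
      rfl
    generalize (∏ t ∈ A j.1, x t) = y
    push_cast
    linear_combination (-(q : ℤ) ^ 2 * y ^ 2) * hε - y ^ 2 * hq
  have hpow (x : σ → ℤ) : (eval x f ^ 2) ^ Fintype.card (σ → ℤˣ) =
      eval x h ^ Fintype.card (σ → ℤˣ) := by
    have h1 : (eval x f) ^ Fintype.card (σ → ℤˣ) =
        ∏ u : σ → ℤˣ, eval (fun t => (u t : ℤ) * x t) f := by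
      simp only [hflip, Finset.prod_const, Fintype.card]
    rw [← pow_mul, mul_comm, pow_mul, h1, hf]
    simp only [map_mul, map_prod, Finset.prod_mul_distrib, mul_pow]
    have hb1 : (∏ u : σ → ℤˣ, eval (fun t => (u t : ℤ) * x t) b) ^ 2 = 1 := by
      rw [← Finset.prod_pow]
      refine Finset.prod_eq_one fun u _ => ?_
      have := hbu.map (eval fun t => (u t : ℤ) * x t)
      exact Int.isUnit_sq this
    rw [hb1, one_mul, Finset.prod_comm, ← Finset.prod_pow]
    simp only [h, map_prod]
    rw [← Finset.prod_pow]
    exact Finset.prod_congr rfl fun j hj => hjsq j hj x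
  -- Integers with equal powers agree in absolute value, hence their squares agree. The remaining
  -- sign between `f ^ 2` and `h` is decided at the origin, where `h` is `1`.
  have habs (x : σ → ℤ) : eval x ((f ^ 2) ^ 2) = eval x (h ^ 2) := by
    have h1 := congrArg abs (hpow x)
    rw [abs_pow, abs_pow (eval x h)] at h1
    have h2 := (pow_left_inj₀ (abs_nonneg _) (abs_nonneg _) Fintype.card_ne_zero).1 h1
    rw [map_pow, map_pow, map_pow, ← sq_abs, h2, sq_abs]
  refine ⟨fun i => #{j ∈ T | j.1 = i}, ?_⟩
  rw [← hh]
  rcases sq_eq_sq_iff_eq_or_eq_neg.1 (funext habs) with h1 | h1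
  · exact h1
  · exfalso
    have h2 := congrArg (eval (0 : σ → ℤ)) h1
    have h3 : eval (0 : σ → ℤ) h = 1 := by
      simp only [h, map_prod]
      refine Finset.prod_eq_one fun j hj => ?_
      obtain ⟨t, ht⟩ := hA _ (hT j hj)
      have : ∏ t ∈ A j.1, (0 : ℤ) = 0 := Finset.prod_eq_zero ht rfl
      simp [map_prod, this]
    rw [map_neg, h3, map_pow] at h2
    nlinarith [sq_nonneg (eval (0 : σ → ℤ) f)]

end MvPolynomial

/-! ### The exponents -/

namespace CoxeterSystem

section Exponents

open Classical Subgroup Finset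

variable {B W : Type*} [Group W] [Fintype W] {M : CoxeterMatrix B} (cs : CoxeterSystem M W)

theorem blockMatrix_simples_apply {A : Type*} [CommRing A] (a : W → A) (w w' : W) :
    cs.blockMatrix a cs.simples w w' = ∏ t ∈ cs.sep w w', a t := by
  have h : closure cs.simples = ⊤ := cs.subgroup_closure_range_simple
  simp [blockMatrix, h]

theorem map_det_blockMatrix {A A' : Type*} [CommRing A] [CommRing A'] (φ : A →+* A') (a : W → A)
    (J : Set W) : φ (cs.blockMatrix a J).det = (cs.blockMatrix (fun t => φ (a t)) J).det := by
  rw [RingHom.map_det]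
  congr 1
  ext w w'
  simp only [RingHom.mapMatrix_apply, Matrix.map_apply, blockMatrix]
  split_ifs <;> simp

/-- Separating sets are symmetric differences of inversion sets, so the change of signs is
multiplication on both sides by the diagonal matrix with entries `∏ u t` over the inversions `t` of
`w`; these entries are `±1`. -/
theorem det_blockMatrix_units_mul {A : Type*} [CommRing A] (u : W → ℤˣ) (a : W → A) :
    (cs.blockMatrix (fun t => ((u t : ℤ) : A) * a t) cs.simples).det =
      (cs.blockMatrix a cs.simples).det := by
  let d : W → ℤˣ := fun w => ∏ t with cs.IsLeftInversion w t, u t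
  let D : Matrix W W A := Matrix.diagonal fun w => ((d w : ℤ) : A)
  have hd (w w' : W) : ∏ t ∈ cs.sep w w', u t = d w * d w' := by
    simp only [d, sep, Finset.prod_filter]
    rw [← Finset.prod_mul_distrib]
    refine Finset.prod_congr rfl fun t _ => ?_
    by_cases h1 : cs.IsLeftInversion w t <;> by_cases h2 : cs.IsLeftInversion w' t <;>
      simp [h1, h2, Int.units_mul_self]
  have h : cs.blockMatrix (fun t => ((u t : ℤ) : A) * a t) cs.simples =
      D * cs.blockMatrix a cs.simples * D := by
    ext w w'
    rw [Matrix.mul_diagonal, Matrix.diagonal_mul, blockMatrix_simples_apply,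
      blockMatrix_simples_apply, Finset.prod_mul_distrib]
    have : ∏ t ∈ cs.sep w w', ((u t : ℤ) : A) = (((d w * d w' : ℤˣ) : ℤ) : A) := by
      rw [← hd]
      push_cast
      rfl
    rw [this]
    push_cast
    ring
  have hD : D.det * D.det = 1 := by
    rw [← Matrix.det_mul, Matrix.diagonal_mul_diagonal]
    have : (fun w => ((d w : ℤ) : A) * ((d w : ℤ) : A)) = fun _ => 1 := by
      ext w
      rw [← Int.cast_mul, ← Units.val_mul, Int.units_mul_self]
      simp
    rw [this, Matrix.diagonal_one, Matrix.det_one]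
  rw [h, Matrix.det_mul, Matrix.det_mul, mul_right_comm, hD, one_mul]

/-- The simple reflections `s` such that `w s w⁻¹` lies in `x W_J x⁻¹`. -/
def localSimples (J : Set W) (x w : W) : Set W :=
  cs.simples ∩ ((closure J).comap (MulAut.conj (x⁻¹ * w)).toMonoidHom : Subgroup W)

omit [Fintype W] in
theorem localSimples_subset (J : Set W) (x w : W) : cs.localSimples J x w ⊆ cs.simples :=
  Set.inter_subset_left

omit [Fintype W] in
theorem mem_comap_conj {J : Set W} {x w g : W} :
    g ∈ (closure J).comap (MulAut.conj (x⁻¹ * w)).toMonoidHom ↔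
      x⁻¹ * (w * g * w⁻¹) * x ∈ closure J := by
  rw [Subgroup.mem_comap]
  simp [mul_assoc]

omit [Fintype W] in
theorem closure_localSimples_le (J : Set W) (x w : W) : closure (cs.localSimples J x w) ≤
    (closure J).comap (MulAut.conj (x⁻¹ * w)).toMonoidHom :=
  (Subgroup.closure_le _).2 Set.inter_subset_right

/-- This describes which entries survive when the variables outside `x W_J x⁻¹` are set to `0`. An
element whose inversions all lie in one subgroup is a product of simple reflections of that
subgroup; here the subgroup is the conjugate of `x W_J x⁻¹` by `w`. -/
theorem sep_subset_iff {J : Set W} {x w w' : W} :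
    cs.sep w w' ⊆ cs.conjReflections J x ↔ w⁻¹ * w' ∈ closure (cs.localSimples J x w) := by
  constructor
  · intro h
    apply cs.mem_closure_inter_of_inversions
    intro t ht
    rw [mem_comap_conj]
    have h1 : w * t * w⁻¹ ∈ cs.sep w w' := by
      rw [mem_sep_iff]
      convert! ht using 1
      group
    exact (cs.mem_conjReflections.1 (h h1)).2
  · intro h t ht
    have h2 := ht
    rw [mem_sep_iff] at ht
    have h1 := cs.closure_localSimples_le J x w
      (cs.mem_closure_of_isLeftInversion (cs.localSimples_subset J x w) h ht)
    rw [mem_comap_conj] at h1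
    rw [mem_conjReflections]
    refine ⟨by simpa using (cs.isReflection_of_mem_sep h2).conj x⁻¹, ?_⟩
    convert h1 using 1
    group

omit [Fintype W] in
theorem localSimples_mul {J : Set W} {x w v : W} (hv : v ∈ closure (cs.localSimples J x w)) :
    cs.localSimples J x (w * v) = cs.localSimples J x w := by
  have hv' := cs.closure_localSimples_le J x w hv
  rw [mem_comap_conj] at hv'
  ext g
  refine and_congr_right fun _ => ?_
  rw [SetLike.mem_coe, SetLike.mem_coe, mem_comap_conj, mem_comap_conj]
  have e : x⁻¹ * (w * v * g * (w * v)⁻¹) * x = (x⁻¹ * (w * v * w⁻¹) * x) *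
      (x⁻¹ * (w * g * w⁻¹) * x) * (x⁻¹ * (w * v * w⁻¹) * x)⁻¹ := by group
  rw [e, Subgroup.mul_mem_cancel_right _ (inv_mem hv'), Subgroup.mul_mem_cancel_left _ hv']

theorem localSimples_mul_longest (J : Set W) (x w : W) :
    cs.localSimples J x (w * cs.longest (cs.localSimples J x w)) = cs.localSimples J x w :=
  cs.localSimples_mul (cs.longest_mem (cs.localSimples_subset J x w))

/-- The involution sending a chamber to the opposite one with respect to the hyperplanes of
`x W_J x⁻¹` bounding it. -/
noncomputable def localOpposite (J : Set W) (x : W) : Equiv.Perm W :=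
  Function.Involutive.toPerm (fun w => w * cs.longest (cs.localSimples J x w)) fun w => by
    simp only [localSimples_mul_longest]
    rw [mul_assoc, cs.longest_mul_self (cs.localSimples_subset J x w), mul_one]

theorem localOpposite_apply (J : Set W) (x w : W) :
    cs.localOpposite J x w = w * cs.longest (cs.localSimples J x w) := rfl

theorem localOpposite_localOpposite (J : Set W) (x w : W) :
    cs.localOpposite J x (cs.localOpposite J x w) = w :=
  Function.Involutive.toPerm_involutive _ w

/-! ### Reciprocity under inversion of the weights -/

variable {F : Type*} [Field F]

/-- Reciprocity for the Varchenko matrix of a localized arrangement. -/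
theorem det_blockMatrix_reciprocity (a : W → F) (ha : ∀ t, a t ≠ 0) (J : Set W) (x : W) :
    (cs.blockMatrix (fun t => if t ∈ cs.conjReflections J x then a t else 0)
        cs.simples).det ^ 2 =
      (∏ w, ∏ t ∈ cs.conjReflections (cs.localSimples J x w) w, a t) ^ 2 *
      (cs.blockMatrix (fun t => if t ∈ cs.conjReflections J x then (a t)⁻¹ else 0)
        cs.simples).det ^ 2 := by
  -- The localized matrix is block diagonal, with the cosets of `W_I` as blocks, where `I` is the
  -- set of local simple reflections of any member of the block.
  have happ (a : W → F) (w w' : W) :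
      cs.blockMatrix (fun t => if t ∈ cs.conjReflections J x then a t else 0) cs.simples w w' =
        if w⁻¹ * w' ∈ closure (cs.localSimples J x w) then ∏ t ∈ cs.sep w w', a t else 0 := by
    rw [blockMatrix_simples_apply]
    split_ifs with h
    · rw [← sep_subset_iff] at h
      exact Finset.prod_congr rfl fun t ht => if_pos (h ht)
    · rw [← sep_subset_iff, Finset.not_subset] at h
      obtain ⟨t, ht, ht'⟩ := h
      exact Finset.prod_eq_zero ht (if_neg ht')
  have hmem (w w' : W) (h : w⁻¹ * w' ∈ closure (cs.localSimples J x w)) :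
      cs.localSimples J x w' = cs.localSimples J x w ∧
      w⁻¹ * cs.localOpposite J x w' ∈ closure (cs.localSimples J x w) := by
    have e := cs.localSimples_mul h
    rw [mul_inv_cancel_left] at e
    refine ⟨e, ?_⟩
    rw [localOpposite_apply, e, ← mul_assoc]
    exact mul_mem h (cs.longest_mem (cs.localSimples_subset J x w))
  -- Moving columns to the locally opposite chamber complements the separating sets: each weight
  -- becomes the total weight of the block times the inverse of the old weight.
  have hmat : (cs.blockMatrix (fun t => if t ∈ cs.conjReflections J x then a t else 0)
      cs.simples).submatrix id (cs.localOpposite J x) =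
      Matrix.diagonal (fun w => ∏ t ∈ cs.conjReflections (cs.localSimples J x w) w, a t) *
      cs.blockMatrix (fun t => if t ∈ cs.conjReflections J x then (a t)⁻¹ else 0)
        cs.simples := by
    ext w w'
    rw [Matrix.submatrix_apply, id, Matrix.diagonal_mul, happ a, happ fun t => (a t)⁻¹]
    by_cases h : w⁻¹ * w' ∈ closure (cs.localSimples J x w)
    · obtain ⟨e, h'⟩ := hmem w w' h
      rw [if_pos h, if_pos h', localOpposite_apply, e,
        cs.sep_mul_longest (cs.localSimples_subset J x w) h, Finset.prod_inv_distrib,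
        ← Finset.prod_sdiff (cs.sep_subset_conjReflections (cs.localSimples_subset J x w) h),
        mul_assoc, mul_inv_cancel₀ (Finset.prod_ne_zero_iff.2 fun t _ => ha t), mul_one]
    · rw [if_neg h, if_neg, mul_zero]
      intro h'
      apply h
      have := (hmem w _ h').2
      rwa [localOpposite_localOpposite] at this
  have hdet := congrArg Matrix.det hmat
  rw [Matrix.det_permute', Matrix.det_mul, Matrix.det_diagonal] at hdet
  rw [← mul_pow, ← hdet, mul_pow, ← Int.cast_pow, ← Units.val_pow_eq_pow_val, Int.units_sq]
  simp

theorem eq_of_two_pow_mul_three_pow {x y x' y' : ℕ} (h : 2 ^ x * 3 ^ y = 2 ^ x' * 3 ^ y') :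
    x = x' := by
  have key (x y : ℕ) : (2 ^ x * 3 ^ y).factorization 2 = x := by
    rw [Nat.factorization_mul (by positivity) (by positivity), Nat.factorization_pow,
      Nat.factorization_pow]
    simp [Nat.Prime.factorization Nat.prime_two, Nat.Prime.factorization Nat.prime_three]
  rw [← key x y, h, key]

theorem conjReflections_nonempty {J : Set W} (hJ : J ⊆ cs.simples) (hne : J.Nonempty) (x : W) :
    (cs.conjReflections J x).Nonempty := by
  obtain ⟨s, hs⟩ := hne
  refine ⟨x * s * x⁻¹, cs.mem_conjReflections.2 ?_⟩
  have := cs.subset_parabolicReflections hJ hs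
  convert this using 1
  group

/-! ### Determination of the exponents -/

variable {s : Finset (Finset W × W)} {c : Finset W × W → ℕ}

/-- Since `1 - y ^ 2 = -y ^ 2 (1 - y⁻¹ ^ 2)`, inverting the weights in the product formula produces
a monomial. Reciprocity produces another one; both sides here are half the degree of that monomial
in `a_t`. -/
theorem sum_exponents_eq (hs : ∀ i ∈ s, (cs.conjReflections i.1 i.2).Nonempty)
    (hc : (cs.blockMatrix (fun t => (MvPolynomial.X t : MvPolynomial W ℤ)) cs.simples).det ^ 2 =
      ∏ i ∈ s, (1 - (∏ t ∈ cs.conjReflections i.1 i.2, MvPolynomial.X t) ^ 2) ^ c i)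
    (J : Set W) (x t : W) :
    ∑ i ∈ s with t ∈ cs.conjReflections i.1 i.2 ∧
        cs.conjReflections i.1 i.2 ⊆ cs.conjReflections J x, c i =
      #{w | t ∈ cs.conjReflections (cs.localSimples J x w) w} := by
  set A₀ := cs.conjReflections J x with hA₀
  -- A factor whose flat is not inside `A₀` becomes `1`.
  have heval (a : W → ℚ) : (cs.blockMatrix (fun t => if t ∈ A₀ then a t else 0)
      cs.simples).det ^ 2 = ∏ i ∈ s with cs.conjReflections i.1 i.2 ⊆ A₀,
        (1 - (∏ t ∈ cs.conjReflections i.1 i.2, a t) ^ 2) ^ c i := by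
    have h := congrArg (MvPolynomial.eval₂Hom (Int.castRingHom ℚ)
      (fun t => if t ∈ A₀ then a t else 0)) hc
    rw [map_pow, map_det_blockMatrix] at h
    simp only [MvPolynomial.coe_eval₂Hom, MvPolynomial.eval₂_X] at h
    rw [h, ← MvPolynomial.coe_eval₂Hom, map_prod, Finset.prod_filter]
    refine Finset.prod_congr rfl fun i _ => ?_
    simp only [map_pow, map_sub, map_one, map_prod, MvPolynomial.coe_eval₂Hom,
      MvPolynomial.eval₂_X]
    split_ifs with h
    · congr 3
      exact Finset.prod_congr rfl fun t ht => if_pos (h ht)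
    · rw [Finset.not_subset] at h
      obtain ⟨t, ht, ht'⟩ := h
      rw [Finset.prod_eq_zero ht (if_neg ht')]
      simp
  -- With weight `2` at `t` and `3` elsewhere, the exponent of the prime `2` is the degree in `a_t`.
  -- All weights are at least `2`, so the factors `1 - y ^ 2` can be cancelled.
  let b : W → ℕ := fun t' => if t' = t then 2 else 3
  have hb (t') : 2 ≤ b t' := by
    simp only [b]
    split_ifs <;> norm_num
  have hbprod (E : Finset W) : ∏ t' ∈ E, b t' = 2 ^ (if t ∈ E then 1 else 0) *
      3 ^ #(E.erase t) := by
    by_cases h : t ∈ E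
    · rw [← Finset.mul_prod_erase _ _ h, if_pos h, pow_one, Finset.prod_congr rfl
        (g := fun _ => 3) fun t' ht' => if_neg (ne_of_mem_erase ht'), Finset.prod_const]
      simp [b]
    · rw [if_neg h, pow_zero, one_mul, Finset.erase_eq_of_notMem h, Finset.prod_congr rfl
        (g := fun _ => 3) fun t' ht' => if_neg (ne_of_mem_of_not_mem ht' h), Finset.prod_const]
  have ha (t') : (b t' : ℚ) ≠ 0 := by
    have := hb t'
    positivity
  have hrec := cs.det_blockMatrix_reciprocity (fun t => (b t : ℚ)) ha J x
  rw [← hA₀, heval, heval fun t => (b t : ℚ)⁻¹] at hrec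
  set s' := {i ∈ s | cs.conjReflections i.1 i.2 ⊆ A₀} with hs'
  have hle (i) (hi : i ∈ s') : 2 ≤ ∏ t ∈ cs.conjReflections i.1 i.2, b t := by
    obtain ⟨t', ht'⟩ := hs i (mem_filter.1 hi).1
    exact (hb t').trans (Finset.single_le_prod' (f := b)
      (fun t'' _ => (hb t'').trans' one_le_two) ht')
  have hpos (i) (hi : i ∈ s') : (∏ t ∈ cs.conjReflections i.1 i.2, (b t : ℚ)) ≠ 0 :=
    Finset.prod_ne_zero_iff.2 fun t' _ => ha t'
  have hsplit : ∏ i ∈ s', (1 - (∏ t ∈ cs.conjReflections i.1 i.2, (b t : ℚ)) ^ 2) ^ c i =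
      (∏ i ∈ s', (-(∏ t ∈ cs.conjReflections i.1 i.2, (b t : ℚ)) ^ 2) ^ c i) *
      ∏ i ∈ s', (1 - (∏ t ∈ cs.conjReflections i.1 i.2, (b t : ℚ)⁻¹) ^ 2) ^ c i := by
    rw [← Finset.prod_mul_distrib]
    refine Finset.prod_congr rfl fun i hi => ?_
    rw [← mul_pow, Finset.prod_inv_distrib]
    congr 1
    have := hpos i hi
    field_simp
    ring
  have hne : ∏ i ∈ s', (1 - (∏ t ∈ cs.conjReflections i.1 i.2, (b t : ℚ)) ^ 2) ^ c i ≠ 0 := by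
    refine Finset.prod_ne_zero_iff.2 fun i hi => pow_ne_zero _ ?_
    have h2 : (2 : ℚ) ≤ ∏ t ∈ cs.conjReflections i.1 i.2, (b t : ℚ) := by
      exact_mod_cast hle i hi
    nlinarith
  rw [hsplit] at hrec hne
  have h1 := mul_right_cancel₀ (right_ne_zero_of_mul hne) hrec
  have h2 := congrArg abs h1
  rw [Finset.abs_prod] at h2
  simp only [abs_pow, abs_neg, sq_abs, ← pow_mul] at h2
  have h3 : (∏ i ∈ s', (∏ t ∈ cs.conjReflections i.1 i.2, b t) ^ c i) ^ 2 =
      (∏ w, ∏ t ∈ cs.conjReflections (cs.localSimples J x w) w, b t) ^ 2 := by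
    rw [← Finset.prod_pow]
    simp only [← pow_mul, mul_comm _ 2]
    exact_mod_cast h2
  have h4 := (pow_left_inj₀ (Nat.zero_le _) (Nat.zero_le _) two_ne_zero).1 h3
  simp only [hbprod, mul_pow, Finset.prod_mul_distrib, ← pow_mul, Finset.prod_pow_eq_pow_sum] at h4
  have h5 := eq_of_two_pow_mul_three_pow h4
  rw [Finset.card_filter, ← h5, hs', Finset.sum_filter, Finset.sum_filter]
  refine Finset.sum_congr rfl fun i _ => ?_
  by_cases h6 : t ∈ cs.conjReflections i.1 i.2 <;>
    by_cases h7 : cs.conjReflections i.1 i.2 ⊆ A₀ <;> simp [h6, h7]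

/-- The reflections of the smallest standard parabolic subgroup, seen from the chamber of `w`,
that contains `t`. -/
noncomputable def hull (t w : W) : Finset W :=
  cs.conjReflections (cs.support (w⁻¹ * t * w)) w

theorem mem_hull {t : W} (ht : cs.IsReflection t) (w : W) : t ∈ cs.hull t w :=
  cs.mem_conjReflections.2 ⟨by simpa using ht.conj w⁻¹, cs.mem_closure_support _⟩

/-- Turns the count supplied by reciprocity into a sum over the flats inside `A₀` of the numbers of
`w` with a given hull. -/
theorem hull_subset_iff {J : Set W} {x t : W} (ht : cs.IsReflection t) (w : W) :
    cs.hull t w ⊆ cs.conjReflections J x ↔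
      t ∈ cs.conjReflections (cs.localSimples J x w) w := by
  have ht' : cs.IsReflection (w⁻¹ * t * w) := by simpa using ht.conj w⁻¹
  have h1 : t ∈ cs.conjReflections (cs.localSimples J x w) w ↔
      cs.support (w⁻¹ * t * w) ⊆ cs.localSimples J x w := by
    rw [mem_conjReflections, support_subset_iff _ (cs.localSimples_subset J x w)]
    exact and_iff_right ht'
  rw [h1]
  constructor
  · intro h g hg
    have hgs := cs.support_subset_simples _ hg
    refine ⟨hgs, ?_⟩
    rw [SetLike.mem_coe, mem_comap_conj]
    have h2 : w * g * w⁻¹ ∈ cs.hull t w := by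
      rw [hull, mem_conjReflections]
      convert cs.subset_parabolicReflections (cs.support_subset_simples _) hg using 1
      group
    exact (cs.mem_conjReflections.1 (h h2)).2
  · intro h g hg
    have hg' := cs.mem_conjReflections.1 hg
    have h2 := (Subgroup.closure_mono h).trans (cs.closure_localSimples_le J x w) hg'.2
    rw [mem_comap_conj] at h2
    have h3 : w * (w⁻¹ * g * w) * w⁻¹ = g := by group
    rw [h3] at h2
    refine cs.mem_conjReflections.2 ⟨?_, h2⟩
    have := (hg'.1.conj w)
    rw [h3] at this
    simpa using this.conj x⁻¹

/-- The sets of reflections of the nontrivial parabolic subgroups. -/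
noncomputable def flats : Finset (Finset W) :=
  (cs.nonemptyParabolics ×ˢ (univ : Finset W)).image fun i => cs.conjReflections i.1 i.2

theorem mem_flats {A : Finset W} : A ∈ cs.flats ↔
    ∃ J : Set W, J ⊆ cs.simples ∧ J.Nonempty ∧ ∃ x, cs.conjReflections J x = A := by
  simp only [flats, nonemptyParabolics, mem_image, mem_product, mem_filter, mem_univ, true_and,
    and_true, Prod.exists]
  constructor
  · rintro ⟨K, x, ⟨h1, h2⟩, h3⟩
    exact ⟨K, h1, h2, x, h3⟩
  · rintro ⟨J, h1, h2, x, h3⟩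
    exact ⟨J.toFinset, x, by simpa using ⟨h1, h2⟩, by simpa using h3⟩

theorem hull_mem_flats {t : W} (ht : cs.IsReflection t) (w : W) : cs.hull t w ∈ cs.flats := by
  rw [mem_flats]
  have ht' : cs.IsReflection (w⁻¹ * t * w) := by simpa using ht.conj w⁻¹
  exact ⟨_, cs.support_subset_simples _, cs.support_nonempty ht'.ne_one, w, rfl⟩

theorem isReflection_of_mem_conjReflections {J : Set W} {x t : W}
    (h : t ∈ cs.conjReflections J x) : cs.IsReflection t := by
  have := (cs.mem_conjReflections.1 h).1.conj x
  simpa [mul_assoc] using this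

/-- Different pairs may describe the same flat, so their exponents are collected. The collected
exponents and the hull counts have equal sums over the flats `A` with `t ∈ A ⊆ A₀`, and induction on
`A₀` isolates the top term. -/
theorem exists_det_sq_eq : ∃ c : Finset W → ℕ,
    (cs.blockMatrix (fun t => (MvPolynomial.X t : MvPolynomial W ℤ)) cs.simples).det ^ 2 =
      ∏ A ∈ cs.flats, (1 - (∏ t ∈ A, MvPolynomial.X t) ^ 2) ^ c A ∧
    ∀ A ∈ cs.flats, ∀ t ∈ A, c A = #{w | cs.hull t w = A} := by
  obtain ⟨N, hN⟩ := cs.det_blockMatrix_dvd_pow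
    (fun t => (MvPolynomial.X t : MvPolynomial W ℤ)) cs.simples.toFinset (by simp)
  rw [Set.coe_toFinset] at hN
  set s := cs.nonemptyParabolics ×ˢ (univ : Finset W) with hs
  have hne : ∀ i ∈ s, (cs.conjReflections i.1 i.2).Nonempty := by
    intro i hi
    have := (mem_product.1 hi).1
    simp only [nonemptyParabolics, mem_filter, mem_univ, true_and] at this
    exact cs.conjReflections_nonempty this.1 (by exact_mod_cast this.2) _
  obtain ⟨c, hc⟩ := MvPolynomial.exists_sq_eq_prod_of_dvd hne hN (by
    intro u x
    rw [map_det_blockMatrix, map_det_blockMatrix]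
    simp only [MvPolynomial.eval_X]
    have := cs.det_blockMatrix_units_mul u x
    simpa using this)
  have hmaps : ∀ i ∈ s, cs.conjReflections i.1 i.2 ∈ cs.flats :=
    fun i hi => mem_image_of_mem _ hi
  refine ⟨fun A => ∑ i ∈ s with cs.conjReflections i.1 i.2 = A, c i, ?_, ?_⟩
  · rw [hc, ← Finset.prod_fiberwise_of_maps_to hmaps]
    refine Finset.prod_congr rfl fun A _ => ?_
    rw [← Finset.prod_pow_eq_pow_sum]
    refine Finset.prod_congr rfl fun i hi => ?_
    rw [(mem_filter.1 hi).2]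
  · intro A₀
    induction A₀ using Finset.strongInduction with
    | H A₀ ih =>
      intro hA₀ t ht
      obtain ⟨J, hJ, -, x, rfl⟩ := cs.mem_flats.1 hA₀
      have htr := cs.isReflection_of_mem_conjReflections ht
      have hsum := cs.sum_exponents_eq hne hc J x t
      set A₀ := cs.conjReflections J x with hA₀'
      have h1 : ∑ i ∈ s with t ∈ cs.conjReflections i.1 i.2 ∧ cs.conjReflections i.1 i.2 ⊆ A₀,
          c i = ∑ A ∈ cs.flats with t ∈ A ∧ A ⊆ A₀,
            ∑ i ∈ s with cs.conjReflections i.1 i.2 = A, c i := by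
        rw [← Finset.sum_fiberwise_of_maps_to (g := fun i => cs.conjReflections i.1 i.2)
          (t := {A ∈ cs.flats | t ∈ A ∧ A ⊆ A₀})]
        · refine Finset.sum_congr rfl fun A hA => Finset.sum_congr ?_ fun _ _ => rfl
          have := (mem_filter.1 hA).2
          ext i
          simp only [mem_filter]
          constructor
          · exact fun h => ⟨h.1.1, h.2⟩
          · rintro ⟨h, rfl⟩
            exact ⟨⟨h, this⟩, rfl⟩
        · intro i hi
          rw [mem_filter] at hi ⊢
          exact ⟨hmaps i hi.1, hi.2⟩
      have h2 : #{w | t ∈ cs.conjReflections (cs.localSimples J x w) w} =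
          ∑ A ∈ cs.flats with t ∈ A ∧ A ⊆ A₀, #{w | cs.hull t w = A} := by
        rw [Finset.card_eq_sum_card_fiberwise (f := cs.hull t)
          (t := {A ∈ cs.flats | t ∈ A ∧ A ⊆ A₀})]
        · refine Finset.sum_congr rfl fun A hA => congrArg _ ?_
          have := (mem_filter.1 hA).2
          ext w
          simp only [mem_filter, mem_univ, true_and]
          constructor
          · exact fun h => h.2
          · rintro rfl
            exact ⟨(cs.hull_subset_iff htr w).1 this.2, rfl⟩
        · intro w hw
          simp only [coe_filter, mem_univ, true_and] at hw ⊢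
          exact ⟨cs.hull_mem_flats htr w, cs.mem_hull htr w, (cs.hull_subset_iff htr w).2 hw⟩
      rw [h1, h2] at hsum
      have hmem : A₀ ∈ ({A ∈ cs.flats | t ∈ A ∧ A ⊆ A₀} : Finset (Finset W)) :=
        mem_filter.2 ⟨hA₀, ht, subset_rfl⟩
      rw [← Finset.add_sum_erase _ _ hmem, ← Finset.add_sum_erase _ (fun A => #{w | _}) hmem]
        at hsum
      have h3 : ∑ A ∈ ({A ∈ cs.flats | t ∈ A ∧ A ⊆ A₀} : Finset (Finset W)).erase A₀,
          ∑ i ∈ s with cs.conjReflections i.1 i.2 = A, c i =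
          ∑ A ∈ ({A ∈ cs.flats | t ∈ A ∧ A ⊆ A₀} : Finset (Finset W)).erase A₀,
            #{w | cs.hull t w = A} := by
        refine Finset.sum_congr rfl fun A hA => ?_
        obtain ⟨h4, h5⟩ := mem_erase.1 hA
        obtain ⟨h6, h7, h8⟩ := mem_filter.1 h5
        exact ih A (lt_of_le_of_ne h8 h4) h6 t h7
      rw [h3] at hsum
      exact Nat.add_right_cancel hsum

end Exponents

end CoxeterSystem

/-! ### Positivity of roots -/

namespace CoxeterMatrix.Realization

section Roots

variable {B : Type*} {M : CoxeterMatrix B} {V : Type*} [AddCommGroup V] [Module ℝ V]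
variable {W : Type*} [Group W] (R : M.Realization V) (cs : CoxeterSystem M W)

theorem action_simple (i : B) (x : V) :
    R.action cs (cs.simple i) x = x - R.coroot i x • R.root i := by
  rw [action, cs.lift_apply_simple R.isLiftable, simpleReflection, Module.reflection_apply]

theorem action_mul (w w' : W) (x : V) :
    R.action cs (w * w') x = R.action cs w (R.action cs w' x) := by
  rw [map_mul, LinearEquiv.mul_apply]

theorem action_one (x : V) : R.action cs 1 x = x := by
  rw [map_one, LinearEquiv.coe_one, id]

theorem action_action_inv (w : W) (x : V) : R.action cs w (R.action cs w⁻¹ x) = x := by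
  rw [← action_mul, mul_inv_cancel, action_one]

theorem action_inv_action (w : W) (x : V) : R.action cs w⁻¹ (R.action cs w x) = x := by
  rw [← action_mul, inv_mul_cancel, action_one]

theorem root_ne_zero (i : B) : R.root i ≠ 0 := by
  intro h
  have := R.coroot_root_self i
  simp [h] at this

theorem coroot_ne_zero (i : B) : R.coroot i ≠ 0 := by
  intro h
  have := R.coroot_root_self i
  simp [h] at this

/-- The cone spanned by the simple roots. -/
def cone : Submodule NNReal V := Submodule.span NNReal (Set.range R.root)

theorem smul_mem_cone {c : ℝ} (hc : 0 ≤ c) {v : V} (hv : v ∈ R.cone) : c • v ∈ R.cone :=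
  R.cone.smul_mem ⟨c, hc⟩ hv

/-- The coefficients are `sin (k π / m) / sin (π / m)`, nonnegative while the angle is at most `π`.
For the infinite bond, `m = 0`, division by zero makes the cosine `1` and `p k = k`. -/
theorem exists_dihedral_coefficients {m : ℕ} (hm : m ≠ 1) : ∃ p : ℕ → ℝ, p 0 = 0 ∧ p 1 = 1 ∧
    (∀ k, p (k + 2) = 2 * Real.cos (Real.pi / m) * p (k + 1) - p k) ∧
    ∀ k, (k ≤ m ∨ m = 0) → 0 ≤ p k := by
  by_cases h0 : m = 0
  · refine ⟨fun k => k, by simp, by simp, fun k => ?_, fun k _ => by positivity⟩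
    subst h0
    push_cast
    simp
    ring
  · have hm2 : (2 : ℝ) ≤ m := by exact_mod_cast (show 2 ≤ m by lia)
    set θ := Real.pi / m with hθ
    have hθpos : 0 < θ := by positivity
    have hmθ : m * θ = Real.pi := by
      rw [hθ]
      field_simp
    have hsin : 0 < Real.sin θ := by
      refine Real.sin_pos_of_pos_of_lt_pi hθpos ?_
      nlinarith
    refine ⟨fun k => Real.sin (k * θ) / Real.sin θ, by simp, by simp [hsin.ne'], fun k => ?_,
      fun k hk => ?_⟩
    · have h1 : Real.sin ((k + 2 : ℕ) * θ) =
          2 * Real.cos θ * Real.sin ((k + 1 : ℕ) * θ) - Real.sin (k * θ) := by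
        have e1 : ((k + 2 : ℕ) : ℝ) * θ = (k + 1 : ℕ) * θ + θ := by push_cast; ring
        have e2 : (k : ℝ) * θ = (k + 1 : ℕ) * θ - θ := by push_cast; ring
        rw [e1, e2, Real.sin_add, Real.sin_sub]
        ring
      simp only [h1]
      field_simp
    · have hk' : (k : ℝ) ≤ m := by exact_mod_cast (show k ≤ m by lia)
      refine div_nonneg (Real.sin_nonneg_of_nonneg_of_le_pi (by positivity) ?_) hsin.le
      rw [← hmθ]
      gcongr

theorem action_alternatingWord_root {i j : B} {p : ℕ → ℝ} (hp0 : p 0 = 0) (hp1 : p 1 = 1)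
    (hp : ∀ k, p (k + 2) = 2 * Real.cos (Real.pi / M i j) * p (k + 1) - p k) (k : ℕ) :
    R.action cs (cs.wordProd (CoxeterSystem.alternatingWord i j k)) (R.root i) =
      (if Even k then p (k + 1) else p k) • R.root i +
        (if Even k then p k else p (k + 1)) • R.root j := by
  have hji : R.coroot j (R.root i) = -2 * Real.cos (Real.pi / M i j) := by
    rw [R.coroot_root, M.symmetric j i]
  induction k with
  | zero => simp [CoxeterSystem.alternatingWord, hp0, hp1]
  | succ k ih =>
    rw [CoxeterSystem.alternatingWord_succ', cs.wordProd_cons, action_mul, ih]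
    by_cases hk : Even k
    · have hk' : ¬ Even (k + 1) := by rwa [Nat.even_add_one, not_not]
      simp only [if_pos hk, if_neg hk', action_simple, map_add, map_smul, hji,
        coroot_root_self, hp]
      module
    · have hk' : Even (k + 1) := by rwa [Nat.even_add_one]
      simp only [if_neg hk, if_pos hk', action_simple, map_add, map_smul,
        R.coroot_root i j, coroot_root_self, hp]
      module

/-- If `ℓ(w s_i) > ℓ(w)`, then `w α_i` is a nonnegative combination of simple roots. -/
theorem action_root_mem_cone {w : W} {i : B} (h : cs.length w < cs.length (w * cs.simple i)) :
    R.action cs w (R.root i) ∈ R.cone := by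
  induction hn : cs.length w using Nat.strong_induction_on generalizing w i with
  | _ n ih =>
    by_cases hw : w = 1
    · rw [hw, action_one]
      exact Submodule.subset_span ⟨i, rfl⟩
    obtain ⟨j, hj⟩ := cs.exists_rightDescent_of_ne_one hw
    have hij : i ≠ j := by
      rintro rfl
      exact absurd hj (not_lt.2 h.le)
    set m := M i j with hm
    obtain ⟨p, hp0, hp1, hp, hpos⟩ := exists_dihedral_coefficients (M.off_diagonal i j hij)
    let alt := fun k => cs.wordProd (CoxeterSystem.alternatingWord i j k)
    have halt_succ (k : ℕ) : alt (k + 1) = cs.simple (if Even k then j else i) * alt k := by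
      simp only [alt, CoxeterSystem.alternatingWord_succ', cs.wordProd_cons]
    have halt_len (k : ℕ) : cs.length (alt k) ≤ k := by
      simpa using cs.length_wordProd_le (CoxeterSystem.alternatingWord i j k)
    -- Split off an alternating suffix in `s_i, s_j`, with additive lengths, that cannot be
    -- prolonged. What remains, `v`, is lengthened by both `s_i` and `s_j`, so induction applies to
    -- it, while the suffix sends `α_i` to a nonnegative combination of `α_i` and `α_j`.
    let Q : ℕ → Prop := fun k => ∃ v, w = v * alt k ∧ cs.length v + k = cs.length w
    have hQ0 : Q 0 := ⟨w, by simp [alt, CoxeterSystem.alternatingWord], by simp⟩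
    have hQ1 : Q 1 := by
      refine ⟨w * cs.simple j, by simp [alt, CoxeterSystem.alternatingWord], ?_⟩
      exact cs.isRightDescent_iff.1 hj
    -- A suffix of full length `m` could be rewritten by the braid relation so as to end in `s_i`,
    -- which lengthens `w`.
    have hQm : m ≠ 0 → ¬ Q m := by
      rintro hm0 ⟨v, hv, hlen⟩
      have e1 : alt m = cs.wordProd (CoxeterSystem.alternatingWord j i m) := by
        have := cs.wordProd_braidWord_eq i j
        rwa [CoxeterSystem.braidWord, CoxeterSystem.braidWord, M.symmetric j i] at this
      obtain ⟨r, hr⟩ := Nat.exists_eq_succ_of_ne_zero hm0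
      rw [hr, Nat.succ_eq_add_one, CoxeterSystem.alternatingWord_succ, cs.wordProd_concat] at e1
      have e2 : w * cs.simple i = v * cs.wordProd (CoxeterSystem.alternatingWord i j r) := by
        rw [hv, hr, Nat.succ_eq_add_one, e1, ← mul_assoc, cs.simple_mul_simple_cancel_right]
      have h1 := cs.length_mul_le v (alt r)
      have h2 := halt_len r
      rw [e2] at h
      simp only [alt] at h1 h2
      lia
    have hQend : ∃ k, ¬ Q k := ⟨cs.length w + 1, by
      rintro ⟨v, -, hv⟩
      lia⟩
    classical
    obtain ⟨k, hk⟩ : ∃ k, Nat.find hQend = k + 1 := by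
      refine Nat.exists_eq_succ_of_ne_zero fun h0 => ?_
      have := Nat.find_spec hQend
      rw [h0] at this
      exact this hQ0
    have hQk : Q k := not_not.1 (Nat.find_min hQend (by lia))
    have hQk1 : ¬ Q (k + 1) := hk ▸ Nat.find_spec hQend
    have hk0 : k ≠ 0 := by
      rintro rfl
      exact hQk1 hQ1
    have hkm : k + 1 ≤ m ∨ m = 0 := by
      by_contra! hcon
      exact Nat.find_min hQend (m := m) (by lia) (hQm hcon.2)
    obtain ⟨v, hv, hlen⟩ := hQk
    have hy : cs.length v < cs.length (v * cs.simple (if Even k then j else i)) := by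
      by_contra! hcon
      apply hQk1
      have h1 := cs.length_mul_simple v (if Even k then j else i)
      refine ⟨v * cs.simple (if Even k then j else i), ?_, by lia⟩
      rw [halt_succ, ← mul_assoc, cs.simple_mul_simple_cancel_right, hv]
    have hx : cs.length v < cs.length (v * cs.simple (if Even k then i else j)) := by
      by_contra! hcon
      obtain ⟨r, rfl⟩ := Nat.exists_eq_succ_of_ne_zero hk0
      have e : (if Even (r + 1) then i else j) = if Even r then j else i := by
        simp only [Nat.even_add_one]
        split_ifs <;> rfl
      rw [Nat.succ_eq_add_one, e] at hcon
      have h1 := cs.length_mul_simple v (if Even r then j else i)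
      have h2 := cs.length_mul_le (v * cs.simple (if Even r then j else i)) (alt r)
      have h3 := halt_len r
      rw [mul_assoc, ← halt_succ, ← Nat.succ_eq_add_one, ← hv] at h2
      lia
    have hlt : cs.length v < n := by lia
    have hboth : R.action cs v (R.root i) ∈ R.cone ∧ R.action cs v (R.root j) ∈ R.cone := by
      by_cases hke : Even k
      · rw [if_pos hke] at hx hy
        exact ⟨ih _ hlt hx rfl, ih _ hlt hy rfl⟩
      · rw [if_neg hke] at hx hy
        exact ⟨ih _ hlt hy rfl, ih _ hlt hx rfl⟩
    rw [hv, action_mul, action_alternatingWord_root R cs hp0 hp1 hp, map_add, map_smul, map_smul]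
    have hpk := hpos k (by lia)
    have hpk1 := hpos (k + 1) hkm
    refine add_mem (R.smul_mem_cone ?_ hboth.1) (R.smul_mem_cone ?_ hboth.2)
    · split_ifs <;> assumption
    · split_ifs <;> assumption

theorem neg_action_root_mem_cone {w : W} {i : B}
    (h : cs.length (w * cs.simple i) < cs.length w) :
    -R.action cs w (R.root i) ∈ R.cone := by
  have h1 := R.action_root_mem_cone cs (w := w * cs.simple i) (i := i)
    (by rwa [cs.simple_mul_simple_cancel_right])
  rw [action_mul, action_simple, coroot_root_self, two_smul, sub_add_cancel_left, map_neg] at h1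
  exact h1

theorem pos_of_mem_cone {f : Module.Dual ℝ V} (hf : ∀ i, 0 < f (R.root i)) {v : V}
    (hv : v ∈ R.cone) (hne : v ≠ 0) : 0 < f v := by
  have key : v = 0 ∨ 0 < f v := by
    clear hne
    induction hv using Submodule.span_induction with
    | mem x hx =>
      obtain ⟨i, rfl⟩ := hx
      exact Or.inr (hf i)
    | zero => exact Or.inl rfl
    | add x y _ _ hx hy =>
      by_cases hx0 : x = 0
      · by_cases hy0 : y = 0
        · simp [hx0, hy0]
        · simpa only [hx0, zero_add] using hy
      · by_cases hy0 : y = 0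
        · simpa only [hy0, add_zero] using hx
        · right
          rw [map_add]
          have h1 := hx.resolve_left hx0
          have h2 := hy.resolve_left hy0
          linarith
    | smul c x _ hx =>
      by_cases hx0 : x = 0
      · simp [hx0]
      · by_cases hc : c = 0
        · simp [hc]
        · right
          have h1 := hx.resolve_left hx0
          have hc' : (0 : ℝ) < c := by exact_mod_cast pos_iff_ne_zero.2 hc
          rw [NNReal.smul_def, map_smul, smul_eq_mul]
          positivity
  exact key.resolve_left hne

/-! ### The free realization and regular vectors -/

/-- The standard realization on the free vector space on `B`, which may be infinite. -/
noncomputable def free (M : CoxeterMatrix B) : M.Realization (B →₀ ℝ) where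
  root i := Finsupp.single i 1
  coroot i := Finsupp.lsum ℝ fun j => (-2 * Real.cos (Real.pi / M i j)) • LinearMap.id
  coroot_root i j := by simp

theorem coroot_linearCombination (i : B) (v : B →₀ ℝ) :
    R.coroot i (Finsupp.linearCombination ℝ R.root v) = (free M).coroot i v := by
  have : R.coroot i ∘ₗ Finsupp.linearCombination ℝ R.root = (free M).coroot i := by
    ext j
    have h1 := R.coroot_root i j
    have h2 := (free M).coroot_root i j
    rw [← h1] at h2
    simpa [free] using h2.symm
  exact LinearMap.congr_fun this v

theorem nonneg_of_mem_cone_free {v : B →₀ ℝ} (hv : v ∈ (free M).cone) (k : B) : 0 ≤ v k := by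
  induction hv using Submodule.span_induction with
  | mem x hx =>
    classical
    obtain ⟨i, rfl⟩ := hx
    simp only [free, Finsupp.single_apply]
    split_ifs <;> norm_num
  | zero => simp
  | add x y _ _ hx hy =>
    rw [Finsupp.add_apply]
    exact add_nonneg hx hy
  | smul c x _ hx =>
    rw [Finsupp.smul_apply, NNReal.smul_def, smul_eq_mul]
    positivity

theorem simple_injective : Function.Injective cs.simple := by
  classical
  intro i j hij
  by_contra hne
  have h1 := (free M).action_simple cs i ((free M).root i)
  rw [hij, action_simple, coroot_root_self] at h1
  have h2 := DFunLike.congr_fun h1 i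
  simp [free, hne] at h2
  linarith

theorem action_root_eq_smul {w : W} {i k : B}
    (h : w * cs.simple i * w⁻¹ = cs.simple k) :
    R.action cs w (R.root i) = (R.coroot k (R.action cs w (R.root i)) / 2) • R.root k := by
  have h1 : R.action cs (cs.simple k) (R.action cs w (R.root i)) =
      -R.action cs w (R.root i) := by
    rw [← h, ← action_mul, inv_mul_cancel_right, action_mul, action_simple, coroot_root_self,
      two_smul, sub_add_cancel_left, map_neg]
  rw [action_simple, sub_eq_iff_eq_add, neg_add_eq_sub, eq_sub_iff_add_eq, ← two_smul ℝ] at h1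
  rw [div_eq_inv_mul, mul_smul, ← h1, smul_smul]
  norm_num

variable [Finite W]

-- The vector is the sum of the positive `w α_i` over pairs `(w, i)`. Applying `s_k` permutes these
-- summands except those proportional to `α_k`, which it negates, so `x - s_k x = α∨_k(x) α_k` is a
-- positive multiple of `α_k`. Signs are read off as coordinates, since the roots form a basis here.
include cs in
theorem exists_regular_free : ∃ x : B →₀ ℝ, ∀ k, 0 < (free M).coroot k x := by
  classical
  have : Finite B := Finite.of_injective _ (simple_injective cs)
  let _ := Fintype.ofFinite B
  let _ := Fintype.ofFinite W
  let R₀ := free M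
  let pos : W × B → Prop := fun p => cs.length p.1 < cs.length (p.1 * cs.simple p.2)
  let v : W × B → (B →₀ ℝ) := fun p => R₀.action cs p.1 (R₀.root p.2)
  refine ⟨∑ p with pos p, v p, fun k => ?_⟩
  set x := ∑ p with pos p, v p with hx
  let fixes : W × B → Prop := fun p => p.1 * cs.simple p.2 * p.1⁻¹ = cs.simple k
  have hpos (p : W × B) : pos (cs.simple k * p.1, p.2) ↔ ¬ (pos p ↔ fixes p) := by
    obtain ⟨w, i⟩ := p
    have hposinv (w : W) : pos (w, i) ↔ ¬ cs.IsLeftInversion w⁻¹ (cs.simple i) := by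
      rw [CoxeterSystem.isLeftInversion_inv_iff,
        CoxeterSystem.isRightInversion_simple_iff_isRightDescent, CoxeterSystem.IsRightDescent]
      have := cs.length_mul_simple w i
      simp only [pos]
      lia
    have h1 := cs.isLeftInversion_mul_iff (cs.isReflection_simple i) w⁻¹ (cs.simple k)
    rw [CoxeterSystem.isLeftInversion_simple_iff, inv_inv] at h1
    have h2 : (cs.simple k * w)⁻¹ = w⁻¹ * cs.simple k := by simp
    simp only [hposinv, h2, fixes]
    tauto
  have hv (p : W × B) : v (cs.simple k * p.1, p.2) = R₀.action cs (cs.simple k) (v p) :=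
    R₀.action_mul cs _ _ _
  have hsum : R₀.action cs (cs.simple k) x = ∑ p with ¬ (pos p ↔ fixes p), v p := by
    rw [hx, map_sum]
    simp only [← hv]
    refine Finset.sum_bij' (fun p _ => (cs.simple k * p.1, p.2))
      (fun p _ => (cs.simple k * p.1, p.2)) ?_ ?_ ?_ ?_ ?_
    · intro p hp
      simp only [Finset.mem_filter, Finset.mem_univ, true_and] at hp ⊢
      rw [← hpos]
      simpa using hp
    · intro p hp
      simp only [Finset.mem_filter, Finset.mem_univ, true_and] at hp ⊢
      rwa [hpos]
    · intro p _
      simp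
    · intro p _
      simp
    · intro p _
      rfl
  let c : W × B → ℝ := fun p => R₀.coroot k (v p) / 2
  have hfix (p) (hp : fixes p) : v p = c p • R₀.root k := R₀.action_root_eq_smul cs hp
  have hck (p) (hp : fixes p) : v p k = c p := by
    rw [hfix p hp]
    simp [R₀, free]
  have hcpos (p) (hp : fixes p) (h : pos p) : 0 ≤ c p := by
    rw [← hck p hp]
    exact nonneg_of_mem_cone_free (R₀.action_root_mem_cone cs h) k
  have hcneg (p) (hp : fixes p) (h : ¬ pos p) : c p ≤ 0 := by
    have h' : cs.length (p.1 * cs.simple p.2) < cs.length p.1 :=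
      lt_of_le_of_ne (not_lt.1 h) (cs.length_mul_simple_ne _ _)
    have h2 := nonneg_of_mem_cone_free (R₀.neg_action_root_mem_cone cs h') k
    rw [← hck p hp]
    simpa using h2
  have hdiff : x - R₀.action cs (cs.simple k) x =
      (∑ p with fixes p, |c p|) • R₀.root k := by
    rw [hsum, hx, Finset.sum_filter, Finset.sum_filter, ← Finset.sum_sub_distrib,
      Finset.sum_smul, Finset.sum_filter]
    refine Finset.sum_congr rfl fun p _ => ?_
    by_cases h1 : fixes p <;> by_cases h2 : pos p <;> simp only [h1, h2, not_true, not_false_iff,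
      if_true, if_false, iff_true, iff_false, sub_zero, zero_sub, sub_self]
    · rw [abs_of_nonneg (hcpos p h1 h2), hfix p h1]
    · rw [abs_of_nonpos (hcneg p h1 h2), hfix p h1, neg_smul]
  rw [action_simple, sub_sub_cancel] at hdiff
  have h3 : R₀.coroot k x = ∑ p with fixes p, |c p| := by
    have := DFunLike.congr_fun hdiff k
    simpa [R₀, free] using this
  change 0 < R₀.coroot k x
  rw [h3]
  refine Finset.sum_pos' (fun p _ => abs_nonneg _) ⟨(1, k), ?_, ?_⟩
  · simp [fixes]
  · have : c (1, k) = 1 := by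
      simp only [c, v, action_one, coroot_root_self]
      norm_num
    rw [this]
    simp

-- The roots of `R` may be linearly dependent, but they pair with the coroots as in the free
-- realization, so the vector found there can be carried over.
include cs in
theorem exists_regular : ∃ x : V, ∀ k, 0 < R.coroot k x := by
  obtain ⟨x, hx⟩ := exists_regular_free cs
  exact ⟨Finsupp.linearCombination ℝ R.root x, fun k => by
    rw [coroot_linearCombination]
    exact hx k⟩

omit [Finite W]

/-- The dual realization, with roots and coroots exchanged. -/
noncomputable def dual : M.Realization (Module.Dual ℝ V) where
  root := R.coroot
  coroot i := Module.Dual.eval ℝ V (R.root i)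
  coroot_root i j := by
    rw [Module.Dual.eval_apply, R.coroot_root, M.symmetric j i]

theorem dual_action_apply (w : W) (f : Module.Dual ℝ V) (x : V) :
    R.dual.action cs w f x = f (R.action cs w⁻¹ x) := by
  induction w using cs.simple_induction_left generalizing x with
  | one => simp
  | mul_simple_left w i ih =>
    rw [action_mul, action_simple, LinearMap.sub_apply, LinearMap.smul_apply, mul_inv_rev,
      action_mul, cs.inv_simple, action_simple, map_sub, map_sub, map_smul, map_smul]
    rw [ih]
    simp only [dual, Module.Dual.eval_apply, smul_eq_mul]
    change _ - R.dual.action cs w f (R.root i) * _ = _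
    rw [ih]
    ring

end Roots

end CoxeterMatrix.Realization

/-! ### Chambers of a Coxeter arrangement -/

namespace CoxeterMatrix.Realization

section Chambers

open Arrangement

variable {B : Type*} {M : CoxeterMatrix B} {V : Type*} [NormedAddCommGroup V] [NormedSpace ℝ V]
variable {W : Type*} [Group W] (R : M.Realization V) (cs : CoxeterSystem M W)

/-- The linear form `x ↦ α∨_i (u⁻¹ x)`, whose kernel is the hyperplane of `u s_i u⁻¹`. -/
def form (u : W) (i : B) : Module.Dual ℝ V :=
  R.coroot i ∘ₗ (R.action cs u⁻¹ : V →ₗ[ℝ] V)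

theorem form_apply (u : W) (i : B) (x : V) :
    R.form cs u i x = R.coroot i (R.action cs u⁻¹ x) := rfl

/-- The translate by `w` of the fundamental chamber. -/
def chamber (w : W) : Set V := {x | ∀ i, 0 < R.form cs w i x}

theorem hyperplane_conj (u : W) (i : B) :
    R.hyperplane cs (u * cs.simple i * u⁻¹) = LinearMap.ker (R.form cs u i) := by
  ext x
  rw [hyperplane, LinearMap.mem_ker, LinearMap.mem_ker, LinearMap.sub_apply, sub_eq_zero,
    LinearMap.id_apply, form_apply]
  change R.action cs (u * cs.simple i * u⁻¹) x = x ↔ _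
  rw [action_mul, action_mul, action_simple, map_sub, action_action_inv, sub_eq_self,
    EmbeddingLike.map_eq_zero_iff, smul_eq_zero_iff_left (R.root_ne_zero i)]

theorem form_action (u w : W) (i : B) (y : V) :
    R.form cs u i (R.action cs w y) = R.dual.action cs (w⁻¹ * u) (R.coroot i) y := by
  rw [dual_action_apply, form_apply, ← action_mul, mul_inv_rev, inv_inv]

theorem dual_action_coroot_ne_zero (w : W) (i : B) : R.dual.action cs w (R.coroot i) ≠ 0 := by
  rw [Ne, EmbeddingLike.map_eq_zero_iff]
  exact R.coroot_ne_zero i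

/-- Evaluation at `w⁻¹ x` is positive on all coroots, which are the simple roots of the dual
realization; so its sign at `w⁻¹ u α∨_i` is that of this root. -/
theorem form_pos_of_mem_chamber {u w : W} {i : B} {x : V} (hx : x ∈ R.chamber cs w)
    (h : ¬ cs.IsLeftInversion (u⁻¹ * w) (cs.simple i)) : 0 < R.form cs u i x := by
  have e : (w⁻¹ * u) = (u⁻¹ * w)⁻¹ := by group
  have hx' : R.action cs w (R.action cs w⁻¹ x) = x := R.action_action_inv cs w x
  rw [← hx', form_action]
  have hlen : cs.length (w⁻¹ * u) < cs.length (w⁻¹ * u * cs.simple i) := by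
    rw [← CoxeterSystem.isRightInversion_inv_iff, ← e,
      CoxeterSystem.isRightInversion_simple_iff_isRightDescent,
      CoxeterSystem.not_isRightDescent_iff] at h
    lia
  exact R.dual.pos_of_mem_cone (f := Module.Dual.eval ℝ V (R.action cs w⁻¹ x)) hx
    (R.dual.action_root_mem_cone cs hlen) (R.dual_action_coroot_ne_zero cs _ _)

theorem form_neg_of_mem_chamber {u w : W} {i : B} {x : V} (hx : x ∈ R.chamber cs w)
    (h : cs.IsLeftInversion (u⁻¹ * w) (cs.simple i)) : R.form cs u i x < 0 := by
  have e : (w⁻¹ * u) = (u⁻¹ * w)⁻¹ := by group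
  have hx' : R.action cs w (R.action cs w⁻¹ x) = x := R.action_action_inv cs w x
  rw [← hx', form_action]
  have hlen : cs.length (w⁻¹ * u * cs.simple i) < cs.length (w⁻¹ * u) := by
    rw [← CoxeterSystem.isRightInversion_inv_iff, ← e] at h
    exact h.2
  have := R.dual.pos_of_mem_cone (f := Module.Dual.eval ℝ V (R.action cs w⁻¹ x)) hx
    (R.dual.neg_action_root_mem_cone cs hlen) (neg_ne_zero.2 (R.dual_action_coroot_ne_zero cs _ _))
  rw [map_neg] at this
  exact neg_pos.1 this

theorem mem_complement_iff {x : V} :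
    x ∈ complement (R.arrangement cs) ↔ ∀ u i, R.form cs u i x ≠ 0 := by
  simp only [complement, Set.mem_compl_iff, Set.mem_iUnion, not_exists]
  constructor
  · intro h u i h0
    refine h _ ⟨_, (cs.isReflection_simple i).conj u, rfl⟩ ?_
    rw [hyperplane_conj]
    exact h0
  · rintro h _ ⟨_, ⟨u, i, rfl⟩, rfl⟩ hx
    rw [hyperplane_conj] at hx
    exact h u i hx

theorem chamber_subset_complement (w : W) :
    R.chamber cs w ⊆ complement (R.arrangement cs) := by
  intro x hx
  rw [mem_complement_iff]
  intro u i
  by_cases h : cs.IsLeftInversion (u⁻¹ * w) (cs.simple i)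
  · exact (R.form_neg_of_mem_chamber cs hx h).ne
  · exact (R.form_pos_of_mem_chamber cs hx h).ne'

theorem convex_chamber (w : W) : Convex ℝ (R.chamber cs w) := by
  intro x hx y hy a b ha hb hab i
  rw [map_add, map_smul, map_smul, smul_eq_mul, smul_eq_mul]
  have h1 := hx i
  have h2 := hy i
  rcases ha.eq_or_lt with rfl | ha
  · rw [zero_add] at hab
    rw [hab]
    linarith
  · have := mul_pos ha h1
    have := mul_nonneg hb h2.le
    linarith

section Finite

variable [Finite W]

theorem chamber_nonempty (w : W) : (R.chamber cs w).Nonempty := by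
  obtain ⟨x, hx⟩ := R.exists_regular cs
  refine ⟨R.action cs w x, fun i => ?_⟩
  rw [form_apply, action_inv_action]
  exact hx i

/-- Take `f` positive on the simple roots and `w` maximizing `f (w⁻¹ x)`. Since `s_i` cannot raise
this value, `α∨_i (w⁻¹ x)` is nonnegative, and it is nonzero off the hyperplanes. -/
theorem exists_mem_chamber {x : V} (hx : x ∈ complement (R.arrangement cs)) :
    ∃ w, x ∈ R.chamber cs w := by
  obtain ⟨f, hf⟩ := R.dual.exists_regular cs
  obtain ⟨w, hw⟩ := Finite.exists_max fun w => f (R.action cs w⁻¹ x)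
  refine ⟨w, fun i => ?_⟩
  have h1 := hw (w * cs.simple i)
  rw [mul_inv_rev, cs.inv_simple, action_mul, action_simple, map_sub, map_smul, smul_eq_mul] at h1
  have h2 : 0 < f (R.root i) := hf i
  have h3 := (R.mem_complement_iff cs).1 hx w i
  refine lt_of_le_of_ne ?_ h3.symm
  rw [form_apply]
  by_contra! hneg
  nlinarith

theorem separates_iff {w w' t : W} (ht : cs.IsReflection t) :
    Separates (R.hyperplane cs t) (R.chamber cs w) (R.chamber cs w') ↔
      ¬ (cs.IsLeftInversion w t ↔ cs.IsLeftInversion w' t) := by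
  obtain ⟨u, i, rfl⟩ := ht
  have key (w : W) : cs.IsLeftInversion (u⁻¹ * w) (cs.simple i) ↔
      ¬ (cs.IsLeftInversion u⁻¹ (cs.simple i) ↔
        cs.IsLeftInversion w (u * cs.simple i * u⁻¹)) := by
    simpa using cs.isLeftInversion_mul_iff (cs.isReflection_simple i) u⁻¹ w
  have hiff : ¬ (cs.IsLeftInversion w (u * cs.simple i * u⁻¹) ↔
      cs.IsLeftInversion w' (u * cs.simple i * u⁻¹)) ↔
      ¬ (cs.IsLeftInversion (u⁻¹ * w) (cs.simple i) ↔
        cs.IsLeftInversion (u⁻¹ * w') (cs.simple i)) := by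
    rw [key w, key w']
    tauto
  rw [hiff, hyperplane_conj]
  constructor
  · rintro ⟨f, hf, hpos, hneg⟩ hsame
    obtain ⟨x, hx⟩ := R.chamber_nonempty cs w
    obtain ⟨y, hy⟩ := R.chamber_nonempty cs w'
    have hfx := hpos x hx
    have hfy := hneg y hy
    -- A combination of `x` and `y` with positive coefficients in the common kernel: the form cannot
    -- have the same strict sign at both points.
    have hz : R.form cs u i ((-f y) • x + f x • y) = 0 := by
      rw [← LinearMap.mem_ker, hf, LinearMap.mem_ker, map_add, map_smul, map_smul, smul_eq_mul,
        smul_eq_mul]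
      ring
    rw [map_add, map_smul, map_smul, smul_eq_mul, smul_eq_mul] at hz
    by_cases h : cs.IsLeftInversion (u⁻¹ * w) (cs.simple i)
    · have h1 := R.form_neg_of_mem_chamber cs hx h
      have h2 := R.form_neg_of_mem_chamber cs hy (hsame.1 h)
      nlinarith
    · have h1 := R.form_pos_of_mem_chamber cs hx h
      have h2 := R.form_pos_of_mem_chamber cs hy (mt hsame.2 h)
      nlinarith
  · intro hdiff
    by_cases h : cs.IsLeftInversion (u⁻¹ * w) (cs.simple i)
    · refine ⟨-R.form cs u i, ?_, fun x hx => ?_, fun y hy => ?_⟩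
      · ext x
        simp
      · have := R.form_neg_of_mem_chamber cs hx h
        simpa using this
      · have := R.form_pos_of_mem_chamber cs hy (u := u) (i := i) (by tauto)
        simpa using this
    · exact ⟨R.form cs u i, rfl, fun x hx => R.form_pos_of_mem_chamber cs hx h,
        fun y hy => R.form_neg_of_mem_chamber cs hy (by tauto)⟩

/-- The only reflection whose hyperplane separates the adjacent chambers of `u` and `u s_i` is `u
s_i u⁻¹`. -/
theorem hyperplane_injOn {t t' : W} (ht : cs.IsReflection t) (ht' : cs.IsReflection t')
    (h : R.hyperplane cs t = R.hyperplane cs t') : t = t' := by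
  obtain ⟨u, i, rfl⟩ := id ht
  have key (r : W) (hr : cs.IsReflection r) :
      Separates (R.hyperplane cs r) (R.chamber cs u) (R.chamber cs (u * cs.simple i)) ↔
        u * cs.simple i * u⁻¹ = r := by
    have h1 := cs.isLeftInversion_mul_iff hr u (cs.simple i)
    rw [cs.isLeftInversion_simple_iff] at h1
    have h2 : u⁻¹ * r * u = cs.simple i ↔ u * cs.simple i * u⁻¹ = r := by
      constructor
      · intro h
        rw [← h]
        group
      · rintro rfl
        group
    rw [R.separates_iff cs hr, h1, ← h2]
    tauto
  exact (key t' ht').1 (h ▸ (key _ ht).2 rfl)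

variable [FiniteDimensional ℝ V]

omit [Finite W] in
theorem connectedComponentIn_eq_chamber {w : W} {x : V} (hx : x ∈ R.chamber cs w) :
    connectedComponentIn (complement (R.arrangement cs)) x = R.chamber cs w := by
  apply subset_antisymm
  · intro y hy i
    by_contra hneg
    have hcont : ContinuousOn (R.form cs w i)
        (connectedComponentIn (complement (R.arrangement cs)) x) :=
      (LinearMap.continuous_of_finiteDimensional _).continuousOn
    have hmem := isPreconnected_connectedComponentIn.intermediate_value hy
      (mem_connectedComponentIn (R.chamber_subset_complement cs w hx)) hcont
      ⟨not_lt.1 hneg, (hx i).le⟩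
    obtain ⟨z, hz, hz0⟩ := hmem
    exact (R.mem_complement_iff cs).1 (connectedComponentIn_subset _ _ hz) w i hz0
  · exact (R.convex_chamber cs w).isPreconnected.subset_connectedComponentIn hx
      (R.chamber_subset_complement cs w)

/-- The chambers are the translates of the fundamental chamber. -/
noncomputable def chamberEquiv : W ≃ chambers (R.arrangement cs) :=
  Equiv.ofBijective
    (fun w => ⟨R.chamber cs w, by
      obtain ⟨x, hx⟩ := R.chamber_nonempty cs w
      exact ⟨x, R.chamber_subset_complement cs w hx,
        (R.connectedComponentIn_eq_chamber cs hx).symm⟩⟩) (by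
    constructor
    · intro w w' h
      have h' : R.chamber cs w = R.chamber cs w' := congrArg Subtype.val h
      by_contra hne
      obtain ⟨s, hs, hsw⟩ := cs.exists_simple_isLeftInversion (w := w⁻¹ * w')
        (fun h1 => hne (inv_mul_eq_one.1 h1))
      have hr := (cs.isReflection_of_mem_simples hs).conj w
      have h1 := cs.isLeftInversion_mul_iff hr w (w⁻¹ * w')
      have e : w⁻¹ * (w * s * w⁻¹) * w = s := by group
      rw [mul_inv_cancel_left, e] at h1
      have h2 : Separates (R.hyperplane cs (w * s * w⁻¹)) (R.chamber cs w) (R.chamber cs w') := by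
        rw [R.separates_iff cs hr]
        tauto
      obtain ⟨f, -, hpos, hneg⟩ := h2
      obtain ⟨x, hx⟩ := R.chamber_nonempty cs w
      exact lt_asymm (hpos x hx) (hneg x (h' ▸ hx))
    · rintro ⟨_, x, hx, rfl⟩
      obtain ⟨w, hw⟩ := R.exists_mem_chamber cs hx
      exact ⟨w, Subtype.ext (R.connectedComponentIn_eq_chamber cs hw).symm⟩)

theorem chamberEquiv_apply (w : W) : (R.chamberEquiv cs w : Set V) = R.chamber cs w := rfl

end Finite

open Classical in
/-- The variable of the hyperplane of `t`, or `0` if `t` is not a reflection. -/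
noncomputable def reflectionVar (t : W) : MvPolynomial (R.arrangement cs) ℤ :=
  if h : cs.IsReflection t then R.hyperplaneVar cs ⟨t, h⟩ else 0

open Classical in
theorem varchenkoDet_eq [FiniteDimensional ℝ V] [Fintype W] :
    varchenkoDet (R.arrangement cs) =
      (cs.blockMatrix (R.reflectionVar cs) cs.simples).det := by
  let _ : Fintype (chambers (R.arrangement cs)) :=
    @Fintype.ofFinite _ (finite_chambers (R.arrangement cs))
  have h : cs.blockMatrix (R.reflectionVar cs) cs.simples =
      (varchenkoMatrix (R.arrangement cs)).submatrix (R.chamberEquiv cs) (R.chamberEquiv cs) := by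
    ext1 w w'
    rw [cs.blockMatrix_simples_apply, Matrix.submatrix_apply, varchenkoMatrix]
    simp only [EmbeddingLike.apply_eq_iff_eq]
    split_ifs with h
    · rw [h, cs.sep_self, Finset.prod_empty]
    · simp only [chamberEquiv_apply]
      let _ : Fintype {H : R.arrangement cs //
        Separates (H : Submodule ℝ V) (R.chamber cs w) (R.chamber cs w')} := Fintype.ofFinite _
      rw [finprod_eq_prod_of_fintype, ← Finset.prod_coe_sort]
      refine Fintype.prod_bijective (fun t : cs.sep w w' =>
        (⟨⟨R.hyperplane cs t, t, cs.isReflection_of_mem_sep t.2, rfl⟩,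
          (R.separates_iff cs (cs.isReflection_of_mem_sep t.2)).2 (cs.mem_sep.1 t.2)⟩ :
          {H : R.arrangement cs //
            Separates (H : Submodule ℝ V) (R.chamber cs w) (R.chamber cs w')})) ?_ _ _ ?_
      · constructor
        · intro t t' htt
          exact Subtype.ext (R.hyperplane_injOn cs (cs.isReflection_of_mem_sep t.2)
            (cs.isReflection_of_mem_sep t'.2) (congrArg (fun H => (H.1 : Submodule ℝ V)) htt))
        · rintro ⟨⟨_, t, ht, rfl⟩, hsep⟩
          exact ⟨⟨t, cs.mem_sep.2 ((R.separates_iff cs ht).1 hsep)⟩, rfl⟩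
      · intro t
        rw [reflectionVar, dif_pos (cs.isReflection_of_mem_sep t.2), hyperplaneVar]
  rw [h, Matrix.det_submatrix_equiv_self]
  rfl

end Chambers

end CoxeterMatrix.Realization

/-! ### Reflections with given support -/

namespace CoxeterSystem

section Supports

open Subgroup

variable {B W : Type*} [Group W] {M : CoxeterMatrix B} (cs : CoxeterSystem M W)

theorem commute_of_length_lt {s w : W} (hs : s ∈ cs.simples) (h1 : ¬ cs.IsLeftInversion w s)
    (h2 : cs.IsLeftInversion (w * s) s) : Commute s w := by
  obtain ⟨i, rfl⟩ := hs
  have h := cs.isLeftInversion_mul_iff (cs.isReflection_simple i) w (cs.simple i)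
  rw [cs.isLeftInversion_simple_iff] at h
  have h3 : w⁻¹ * cs.simple i * w = cs.simple i := by tauto
  rw [Commute, SemiconjBy]
  nth_rewrite 2 [← h3]
  group

/-- Let `q` be a simple left inversion of `w`. As `s` commutes with `w`, `s q s` is again an
inversion of `w`, so it lies in the parabolic subgroup of the support, which does not contain `s`.
Hence `s` is no inversion of `s q s`, which forces `s` and `q` to commute; then pass to `q w`. -/
theorem commute_of_mem_support {s w : W} (hs : s ∈ cs.simples) (hsw : s ∉ cs.support w)
    (h : Commute s w) {r : W} (hr : r ∈ cs.support w) : Commute s r := by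
  induction hn : cs.length w using Nat.strong_induction_on generalizing w r with
  | _ n ih =>
    have hsr := cs.isReflection_of_mem_simples hs
    have hsupp := cs.support_subset_simples w
    have hw1 : w ≠ 1 := by
      rintro rfl
      have : cs.support 1 ⊆ ∅ := (cs.support_subset_iff (Set.empty_subset _)).2 (one_mem _)
      exact this hr
    obtain ⟨q, hq, hqw⟩ := cs.exists_simple_isLeftInversion hw1
    have hqJ : q ∈ cs.support w := cs.mem_of_mem_simples_of_mem_closure hsupp hq
      (cs.mem_closure_of_isLeftInversion hsupp (cs.mem_closure_support w) hqw)
    have hsq : s ≠ q := fun e => hsw (e ▸ hqJ)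
    have hNs (t : W) : cs.IsLeftInversion s t ↔ t = s := by
      obtain ⟨i, rfl⟩ := hs
      exact cs.isLeftInversion_simple_iff
    have hNq (t : W) : cs.IsLeftInversion q t ↔ t = q := by
      obtain ⟨i, rfl⟩ := hq
      exact cs.isLeftInversion_simple_iff
    have hconj_eq (a b : W) : a⁻¹ * b * a = a ↔ b = a := by
      rw [mul_assoc, inv_mul_eq_iff_eq_mul, mul_left_inj]
    have hsqs : cs.IsReflection (s * q * s) := by
      simpa [hsr.inv] using hqw.1.conj s
    have hmem : cs.IsLeftInversion w (s * q * s) := by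
      have e : w = s * (w * s) := by rw [← h.eq, ← mul_assoc, hsr.mul_self, one_mul]
      have h1 := cs.isLeftInversion_mul_iff hsqs s (w * s)
      have h2 := cs.isLeftInversion_mul_iff hqw.1 w s
      have e2 : s⁻¹ * (s * q * s) * s = q := by
        rw [mul_assoc s q s, inv_mul_cancel_left, mul_assoc, hsr.mul_self, mul_one]
      rw [← e, e2] at h1
      rw [hNs] at h1 h2
      have h3 : s * q * s ≠ s := by
        intro h3
        apply hsq
        have : s⁻¹ * q * s = s := by rwa [hsr.inv]
        exact ((hconj_eq s q).1 this).symm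
      have h4 : w⁻¹ * q * w ≠ s := by
        intro h4
        apply hsq
        have : q = w * s * w⁻¹ := by
          rw [← h4]
          group
        rw [this, ← h.eq, mul_inv_cancel_right]
      tauto
    have hcomm : Commute s q := by
      have h1 : ¬ cs.IsLeftInversion (s * q * s) s := fun h1 => hsw <|
        cs.mem_of_mem_simples_of_mem_closure hsupp hs <| cs.mem_closure_of_isLeftInversion hsupp
          (cs.mem_closure_of_isLeftInversion hsupp (cs.mem_closure_support w) hmem) h1
      have h2 := cs.isLeftInversion_mul_iff hsr s (q * s)
      rw [inv_mul_cancel, one_mul, hNs, ← mul_assoc] at h2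
      refine cs.commute_of_length_lt hs (by rw [hNq]; exact hsq) ?_
      tauto
    have hqq := hqw.1.mul_self
    have hqmem : q ∈ closure (cs.support w) := Subgroup.subset_closure hqJ
    have hsub : cs.support (q * w) ⊆ cs.support w :=
      (cs.support_subset_iff hsupp).2 (mul_mem hqmem (cs.mem_closure_support w))
    have hcover : cs.support w ⊆ insert q (cs.support (q * w)) := by
      rw [support_subset_iff]
      · have h1 : q ∈ closure (insert q (cs.support (q * w))) :=
          Subgroup.subset_closure (Set.mem_insert _ _)
        have h2 : q * w ∈ closure (insert q (cs.support (q * w))) :=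
          Subgroup.closure_mono (Set.subset_insert _ _) (cs.mem_closure_support (q * w))
        have := mul_mem h1 h2
        rwa [← mul_assoc, hqq, one_mul] at this
      · exact Set.insert_subset hq (cs.support_subset_simples _)
    rcases hcover hr with rfl | hr'
    · exact hcomm
    · exact ih _ (hn ▸ hqw.2) (fun h => hsw (hsub h)) (hcomm.mul_right h) hr' rfl

/-- If `b` commuted with `t` it would commute with `a`, which is in the support. So conjugation by
`b` adds `2` to the length, and the palindromic reduced expression grows by `b` at both ends. -/
theorem IsSupportReflection.insert_simple {cs : CoxeterSystem M W} {J : Set W} {t s b a : W}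
    (h : cs.IsSupportReflection J t s) (hb : b ∈ cs.simples) (hbJ : b ∉ J) (ha : a ∈ J)
    (hab : ¬ Commute a b) : cs.IsSupportReflection (insert b J) (b * t * b) s := by
  obtain ⟨ht, hsupp, hs, v, hv, hlen⟩ := h
  have hbr := cs.isReflection_of_mem_simples hb
  have hbt : ¬ Commute b t := fun hc => hab
    (cs.commute_of_mem_support hb (hsupp ▸ hbJ) hc (hsupp ▸ ha)).symm
  have hJ : J ⊆ cs.simples := hsupp ▸ cs.support_subset_simples t
  have htJ : t ∈ closure J := hsupp ▸ cs.mem_closure_support t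
  have h1 : ¬ cs.IsLeftInversion t b := fun h => hbJ <|
    cs.mem_of_mem_simples_of_mem_closure hJ hb (cs.mem_closure_of_isLeftInversion hJ htJ h)
  have h2 : ¬ cs.IsLeftInversion (t * b) b := fun h => hbt (cs.commute_of_length_lt hb h1 h)
  have hlen2 : cs.length (b * t * b) = cs.length t + 2 := by
    obtain ⟨i, rfl⟩ := hb
    have e1 : cs.length (t * cs.simple i) = cs.length (cs.simple i * t) := by
      rw [← cs.length_inv, mul_inv_rev, ht.inv, cs.inv_simple]
    have e2 := cs.length_simple_mul t i
    have e3 := cs.length_simple_mul (t * cs.simple i) i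
    have h1' : ¬ cs.length (cs.simple i * t) < cs.length t := fun h => h1 ⟨hbr, h⟩
    have h2' : ¬ cs.length (cs.simple i * (t * cs.simple i)) < cs.length (t * cs.simple i) :=
      fun h => h2 ⟨hbr, h⟩
    rw [mul_assoc]
    lia
  have hrefl : cs.IsReflection (b * t * b) := by simpa [hbr.inv] using ht.conj b
  have hins : insert b J ⊆ cs.simples := Set.insert_subset hb hJ
  have hbmem : b ∈ closure (insert b J) := Subgroup.subset_closure (Set.mem_insert _ _)
  have htmem : t ∈ closure (insert b J) := Subgroup.closure_mono (Set.subset_insert _ _) htJ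
  refine ⟨hrefl, subset_antisymm ?_ ?_, hs, v * b, ?_, ?_⟩
  · exact (cs.support_subset_iff hins).2 (mul_mem (mul_mem hbmem htmem) hbmem)
  · have hS := cs.support_subset_simples (b * t * b)
    have hbinv : cs.IsLeftInversion (b * t * b) b := by
      refine ⟨hbr, ?_⟩
      rw [← mul_assoc, ← mul_assoc, hbr.mul_self, one_mul, hlen2]
      have := cs.length_mul_le t b
      obtain ⟨i, rfl⟩ := hb
      rw [cs.length_simple] at this
      lia
    have hbS : b ∈ closure (cs.support (b * t * b)) :=
      cs.mem_closure_of_isLeftInversion hS (cs.mem_closure_support _) hbinv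
    refine Set.insert_subset (cs.mem_of_mem_simples_of_mem_closure hS hb hbS) ?_
    rw [← hsupp, support_subset_iff _ hS]
    have := mul_mem (mul_mem hbS (cs.mem_closure_support (b * t * b))) hbS
    have e : b * (b * t * b) * b = t := by
      rw [← mul_assoc, ← mul_assoc, hbr.mul_self, one_mul, mul_assoc, hbr.mul_self, mul_one]
    rwa [e] at this
  · rw [hv, mul_inv_rev, hbr.inv]
    group
  · have h3 := cs.length_mul_le v b
    have h4 := cs.length_mul_le ((v * b)⁻¹ * s) (v * b)
    have h5 := cs.length_mul_le (v * b)⁻¹ s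
    have e : (v * b)⁻¹ * s * (v * b) = b * t * b := by
      rw [hv, mul_inv_rev, hbr.inv]
      group
    rw [e, hlen2] at h4
    rw [cs.length_inv] at h5
    obtain ⟨i, rfl⟩ := hb
    obtain ⟨j, rfl⟩ := hs
    rw [cs.length_simple] at h3 h5
    lia

theorem isSupportReflection_simple {s : W} (hs : s ∈ cs.simples) :
    cs.IsSupportReflection {s} s s := by
  refine ⟨cs.isReflection_of_mem_simples hs, ?_, hs, 1, by simp, ?_⟩
  · obtain ⟨i, rfl⟩ := hs
    have h : cs.IsReduced [i] := by simp [IsReduced]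
    have := cs.support_wordProd h
    simpa using this
  · obtain ⟨i, rfl⟩ := hs
    simp

/-- A largest subset of `J` carrying such a reflection is `J`: otherwise irreducibility provides `b`
outside it not commuting with some element inside, and `b` can be added. -/
theorem exists_isSupportReflection [Finite W] {J : Set W} (hJ : cs.IsIrreducible J) :
    ∃ t s, cs.IsSupportReflection J t s := by
  obtain ⟨hJS, ⟨s₀, hs₀⟩, hirr⟩ := hJ
  obtain ⟨I, ⟨hIJ, hne, t, s, ht⟩, hmax⟩ := Set.exists_max_image
    {I : Set W | I ⊆ J ∧ I.Nonempty ∧ ∃ t s, cs.IsSupportReflection I t s} Set.ncard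
    (Set.toFinite _)
    ⟨{s₀}, by simpa using hs₀, by simp, s₀, s₀, cs.isSupportReflection_simple (hJS hs₀)⟩
  by_cases hI : I = J
  · exact ⟨t, s, hI ▸ ht⟩
  obtain ⟨a, ha, b, hb, hab⟩ := hirr I (J \ I) (Set.union_sdiff_cancel hIJ)
    Set.disjoint_sdiff_right hne (Set.nonempty_of_ssubset (lt_of_le_of_ne hIJ hI))
  have h1 := hmax (insert b I) ⟨Set.insert_subset hb.1 hIJ, ⟨b, Set.mem_insert _ _⟩, _, _,
    ht.insert_simple (hJS hb.1) hb.2 ha hab⟩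
  rw [Set.ncard_insert_of_notMem hb.2 (Set.toFinite _)] at h1
  lia

theorem mem_closure_left_of_commute {J₁ J₂ : Set W}
    (hcomm : ∀ a ∈ J₁, ∀ b ∈ J₂, Commute a b) {x y : W} (hx : x ∈ closure (J₁ ∪ J₂))
    (hy : y ∈ closure J₁) : x * y * x⁻¹ ∈ closure J₁ := by
  have hle : closure (J₁ ∪ J₂) ≤ Subgroup.normalizer (closure J₁ : Set W) := by
    rw [Subgroup.closure_le]
    rintro z (hz | hz)
    · exact Subgroup.le_normalizer (Subgroup.subset_closure hz)
    · have hz' : z ∈ Subgroup.centralizer (closure J₁ : Set W) := by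
        rw [Subgroup.centralizer_closure, Subgroup.mem_centralizer_iff]
        exact fun a ha => hcomm a ha z hz
      rw [SetLike.mem_coe, Subgroup.mem_normalizer_iff]
      intro g
      constructor
      · intro hg
        rwa [← Subgroup.mem_centralizer_iff.1 hz' g hg, mul_inv_cancel_right]
      · intro hg
        have := Subgroup.mem_centralizer_iff.1 hz' _ hg
        rw [inv_mul_cancel_right] at this
        rw [← mul_left_cancel this] at hg
        exact hg
  exact (Subgroup.mem_normalizer_iff.1 (hle hx) y).1 hy

/-- `t` is conjugate, inside the parabolic subgroup of its support, to an element of the support. If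
the support were a union of two commuting parts, each would generate a normal subgroup, and one of
these would contain `t`. -/
theorem isIrreducible_support {t : W} (ht : cs.IsReflection t) :
    cs.IsIrreducible (cs.support t) := by
  refine ⟨cs.support_subset_simples t, cs.support_nonempty ht.ne_one, ?_⟩
  intro J₁ J₂ hunion hdisj hne₁ hne₂
  by_contra! hcomm
  obtain ⟨x, hx, s, hs, e⟩ := cs.exists_conj_of_mem_parabolicReflections
    (cs.support_subset_simples t) ⟨ht, cs.mem_closure_support t⟩
  have hsub : J₁ ∪ J₂ ⊆ cs.simples := hunion ▸ cs.support_subset_simples t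
  rw [← hunion] at hx hs
  rcases hs with hs | hs
  · have h1 : t ∈ closure J₁ :=
      e ▸ mem_closure_left_of_commute hcomm hx (Subgroup.subset_closure hs)
    rw [← cs.support_subset_iff (Set.subset_union_left.trans hsub), ← hunion] at h1
    obtain ⟨z, hz⟩ := hne₂
    exact Set.disjoint_left.1 hdisj (h1 (Or.inr hz)) hz
  · rw [Set.union_comm] at hx
    have h1 : t ∈ closure J₂ := e ▸ mem_closure_left_of_commute
      (fun a ha b hb => (hcomm b hb a ha).symm) hx (Subgroup.subset_closure hs)
    rw [← cs.support_subset_iff (Set.subset_union_right.trans hsub), ← hunion] at h1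
    obtain ⟨z, hz⟩ := hne₁
    exact Set.disjoint_left.1 hdisj hz (h1 (Or.inl hz))

/-! ### The Coxeter graph of a finite Coxeter group is a forest -/

/-- The Coxeter graph. -/
def coxeterGraph (M : CoxeterMatrix B) : SimpleGraph B where
  Adj i j := i ≠ j ∧ M i j ≠ 2
  symm := ⟨fun i j h => ⟨h.1.symm, by rw [M.symmetric]; exact h.2⟩⟩
  loopless := ⟨fun _ h => h.1 rfl⟩

theorem one_le_two_mul_cos {m : ℕ} (h1 : m ≠ 1) (h2 : m ≠ 2) :
    1 ≤ 2 * Real.cos (Real.pi / m) := by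
  by_cases h0 : m = 0
  · simp [h0]
  · have hm : (3 : ℝ) ≤ m := by exact_mod_cast (show 3 ≤ m by lia)
    have h := Real.cos_le_cos_of_nonneg_of_le_pi (x := Real.pi / m) (y := Real.pi / 3)
      (by positivity) (by linarith [Real.pi_pos]) (by gcongr)
    rw [Real.cos_pi_div_three] at h
    linarith

theorem cos_pi_div_nonneg {m : ℕ} (h1 : m ≠ 1) : 0 ≤ Real.cos (Real.pi / m) := by
  by_cases h2 : m = 2
  · rw [h2]
    norm_num
  · linarith [one_le_two_mul_cos h1 h2]

-- A finite group preserves a positive definite form `β`. If `x` is the sum of the simple roots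
-- along a cycle, every coroot on the cycle is nonpositive at `x`, whence `β x x ≤ 0`.
open CoxeterMatrix.Realization in
include cs in
theorem isAcyclic_coxeterGraph [Finite W] : (coxeterGraph M).IsAcyclic := by
  classical
  have : Finite B := Finite.of_injective _ (simple_injective cs)
  let _ := Fintype.ofFinite B
  let _ := Fintype.ofFinite W
  intro u c hc
  let R := free M
  let β : (B →₀ ℝ) → (B →₀ ℝ) → ℝ := fun x y => ∑ w, ∑ k, R.action cs w x k * R.action cs w y k
  have hinv (i : B) (x y : B →₀ ℝ) :
      β (R.action cs (cs.simple i) x) (R.action cs (cs.simple i) y) = β x y := by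
    simp only [β, ← action_mul]
    exact Equiv.sum_comp (Equiv.mulRight (cs.simple i))
      fun w => ∑ k, R.action cs w x k * R.action cs w y k
  have hadd (x y z : B →₀ ℝ) : β x (y + z) = β x y + β x z := by
    simp only [β, map_add, Finsupp.add_apply, mul_add, Finset.sum_add_distrib]
  have hlin (x y z : B →₀ ℝ) (r : ℝ) : β (x - r • y) (-z) = -β x z + r * β y z := by
    simp only [β, map_sub, map_smul, map_neg, Finsupp.neg_apply, Finsupp.sub_apply,
      Finsupp.smul_apply, smul_eq_mul, Finset.mul_sum, ← Finset.sum_neg_distrib,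
      ← Finset.sum_add_distrib]
    refine Finset.sum_congr rfl fun w _ => Finset.sum_congr rfl fun k _ => ?_
    ring
  have hroot (i : B) (x : B →₀ ℝ) :
      β x (R.root i) = R.coroot i x / 2 * β (R.root i) (R.root i) := by
    have h := hinv i x (R.root i)
    rw [action_simple, action_simple, coroot_root_self, two_smul, sub_add_cancel_left, hlin] at h
    linarith
  have hnonneg (x : B →₀ ℝ) : 0 ≤ β x x :=
    Finset.sum_nonneg fun w _ => Finset.sum_nonneg fun k _ => mul_self_nonneg _
  have hpos (x : B →₀ ℝ) (k : B) (hk : x k ≠ 0) : 0 < β x x := by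
    refine Finset.sum_pos' (fun w _ => Finset.sum_nonneg fun k _ => mul_self_nonneg _)
      ⟨1, Finset.mem_univ _, Finset.sum_pos' (fun k _ => mul_self_nonneg _)
        ⟨k, Finset.mem_univ _, ?_⟩⟩
    rw [action_one]
    exact mul_self_pos.2 hk
  let S : Finset B := c.support.toFinset
  let x : B →₀ ℝ := ∑ v ∈ S, R.root v
  have hxu : x u ≠ 0 := by
    have hu : u ∈ S := by simp [S]
    simp [x, R, free, Finsupp.finsetSum_apply, Finsupp.single_apply, hu]
  have hβsum : β x x = ∑ v ∈ S, β x (R.root v) := by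
    have hz : β x 0 = 0 := by simp [β]
    exact map_sum (⟨⟨β x, hz⟩, hadd x⟩ : (B →₀ ℝ) →+ ℝ) R.root S
  -- The root of `v` contributes `2`, its two neighbours on the cycle at most `-1` each, and the
  -- others nothing positive.
  have hcor (v : B) (hv : v ∈ S) : R.coroot v x ≤ 0 := by
    have hv' : v ∈ c.support := by simpa [S] using hv
    have h2 := hc.ncard_neighborSet_toSubgraph_eq_two hv'
    obtain ⟨a, b, hab, hset⟩ := Set.ncard_eq_two.1 h2
    have ha : c.toSubgraph.Adj v a := by
      have : a ∈ c.toSubgraph.neighborSet v := by rw [hset]; simp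
      exact this
    have hb : c.toSubgraph.Adj v b := by
      have : b ∈ c.toSubgraph.neighborSet v := by rw [hset]; simp
      exact this
    have haS : a ∈ S := by
      simpa [S] using c.mem_verts_toSubgraph.1 ha.snd_mem
    have hbS : b ∈ S := by
      simpa [S] using c.mem_verts_toSubgraph.1 hb.snd_mem
    have haG : v ≠ a ∧ M v a ≠ 2 := ha.adj_sub
    have hbG : v ≠ b ∧ M v b ≠ 2 := hb.adj_sub
    have hle : ∑ y ∈ ((S.erase v).erase a).erase b, R.coroot v (R.root y) ≤ 0 := by
      refine Finset.sum_nonpos fun y hy => ?_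
      have hyv : v ≠ y := by
        simp only [Finset.mem_erase] at hy
        exact Ne.symm hy.2.2.1
      rw [R.coroot_root]
      linarith [cos_pi_div_nonneg (M.off_diagonal v y hyv)]
    have h3 := one_le_two_mul_cos (M.off_diagonal v a haG.1) haG.2
    have h4 := one_le_two_mul_cos (M.off_diagonal v b hbG.1) hbG.2
    have ha' : a ∈ S.erase v := Finset.mem_erase.2 ⟨haG.1.symm, haS⟩
    have hb' : b ∈ (S.erase v).erase a :=
      Finset.mem_erase.2 ⟨hab.symm, Finset.mem_erase.2 ⟨hbG.1.symm, hbS⟩⟩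
    rw [map_sum, ← Finset.add_sum_erase _ _ hv, ← Finset.add_sum_erase _ _ ha',
      ← Finset.add_sum_erase _ _ hb', coroot_root_self, R.coroot_root v a, R.coroot_root v b]
    linarith
  have h5 : β x x ≤ 0 := by
    rw [hβsum]
    refine Finset.sum_nonpos fun v hv => ?_
    rw [hroot]
    have := hcor v hv
    have := hnonneg (R.root v)
    nlinarith
  exact absurd (hpos x u hxu) (not_lt.2 h5)

/-- The graph of the odd bonds. -/
def oddGraph (M : CoxeterMatrix B) : SimpleGraph B where
  Adj i j := i ≠ j ∧ Odd (M i j)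
  symm := ⟨fun i j h => ⟨h.1.symm, by rw [M.symmetric]; exact h.2⟩⟩
  loopless := ⟨fun _ h => h.1 rfl⟩

theorem oddGraph_le : oddGraph M ≤ coxeterGraph M := fun i j h => ⟨h.1, fun h2 => by
  have := h.2
  rw [h2] at this
  exact absurd this (by decide)⟩

/-- The Coxeter graph restricted to `J`. -/
def restrictedGraph (J : Set W) : SimpleGraph B where
  Adj i j := (i ≠ j ∧ M i j ≠ 2) ∧ cs.simple i ∈ J ∧ cs.simple j ∈ J
  symm := ⟨fun i j h =>
    ⟨⟨h.1.1.symm, by rw [M.symmetric]; exact h.1.2⟩, h.2.2, h.2.1⟩⟩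
  loopless := ⟨fun _ h => h.1.1 rfl⟩

theorem restrictedGraph_le (J : Set W) : cs.restrictedGraph J ≤ coxeterGraph M :=
  fun _ _ h => h.1

/-- The map that is `-1` on the generators in the odd component of `i` and `1` on the others extends
to a character, since only odd bonds force equal values. -/
theorem reachable_oddGraph_of_isConj {i j : B} (h : IsConj (cs.simple i) (cs.simple j)) :
    (oddGraph M).Reachable i j := by
  classical
  let f : B → ℤˣ := fun k => if (oddGraph M).Reachable i k then -1 else 1
  have hf : M.IsLiftable f := by
    intro k l
    by_cases hkl : f k = f l
    · rw [hkl, Int.units_mul_self, one_pow]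
    · have hne : k ≠ l := fun e => hkl (by rw [e])
      have hev : Even (M k l) := by
        rw [← Nat.not_odd_iff_even]
        intro hodd
        have hadj : (oddGraph M).Reachable k l :=
          SimpleGraph.Adj.reachable (show (oddGraph M).Adj k l from ⟨hne, hodd⟩)
        apply hkl
        have : (oddGraph M).Reachable i k ↔ (oddGraph M).Reachable i l :=
          ⟨fun h => h.trans hadj, fun h => h.trans hadj.symm⟩
        simp only [f, this]
      obtain ⟨r, hr⟩ := hev
      rw [hr, ← two_mul, pow_mul, Int.units_sq, one_pow]
  have h1 := (cs.lift ⟨f, hf⟩).map_isConj h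
  rw [isConj_iff_eq, cs.lift_apply_simple hf, cs.lift_apply_simple hf] at h1
  by_contra hn
  simp only [f, if_neg hn, SimpleGraph.Reachable.refl, if_true] at h1
  exact absurd h1 (by decide)

theorem IsIrreducible.reachable {cs : CoxeterSystem M W} {J : Set W} (hJ : cs.IsIrreducible J)
    {i j : B} (hi : cs.simple i ∈ J) (hj : cs.simple j ∈ J) :
    (cs.restrictedGraph J).Reachable i j := by
  obtain ⟨hJS, -, hirr⟩ := hJ
  let J₁ : Set W := {s | s ∈ J ∧ ∃ k, (cs.restrictedGraph J).Reachable i k ∧ s = cs.simple k}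
  by_contra hn
  by_cases hj₁ : cs.simple j ∈ J₁
  · obtain ⟨-, k, hk, e⟩ := hj₁
    exact hn (CoxeterMatrix.Realization.simple_injective cs e ▸ hk)
  obtain ⟨_, ⟨ha, k, hk, rfl⟩, b, hb, hab⟩ := hirr J₁ (J \ J₁)
    (Set.union_sdiff_cancel fun s hs => hs.1) Set.disjoint_sdiff_right
    ⟨_, hi, i, SimpleGraph.Reachable.refl _, rfl⟩ ⟨_, hj, hj₁⟩
  obtain ⟨l, rfl⟩ := hJS hb.1
  apply hb.2
  refine ⟨hb.1, l, hk.trans (SimpleGraph.Adj.reachable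
    (show (cs.restrictedGraph J).Adj k l from ⟨⟨?_, ?_⟩, ha, hb.1⟩)), rfl⟩
  · rintro rfl
    exact hab (Commute.refl _)
  · intro h2
    apply hab
    have := cs.simple_mul_simple_pow k l
    rw [h2, pow_two] at this
    have h3 := eq_inv_of_mul_eq_one_left this
    rwa [mul_inv_rev, cs.inv_simple, cs.inv_simple] at h3

theorem exists_conj_simple_of_odd {i j : B} (h : Odd (M i j)) {J : Set W}
    (hi : cs.simple i ∈ J) (hj : cs.simple j ∈ J) :
    ∃ v ∈ closure J, v⁻¹ * cs.simple i * v = cs.simple j := by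
  obtain ⟨k, hk⟩ := h
  set r := cs.simple i * cs.simple j with hr
  have hpow : r ^ (2 * k + 1) = 1 := hk ▸ cs.simple_mul_simple_pow i j
  have hconj (n : ℕ) : (r ^ n)⁻¹ * cs.simple i = cs.simple i * r ^ n := by
    induction n with
    | zero => simp
    | succ n ih =>
      have e : r⁻¹ * cs.simple i = cs.simple i * r := by
        rw [hr]
        simp
      rw [pow_succ', mul_inv_rev, mul_assoc, e, ← mul_assoc, ih, mul_assoc, ← pow_succ, pow_succ']
  -- Conjugating `s_i` by `r ^ n` gives `s_i r ^ (2 * n)`, and `2 * (k + 1)` is `1` modulo `2 * k +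
  -- 1`.
  refine ⟨r ^ (k + 1), pow_mem (mul_mem (Subgroup.subset_closure hi)
    (Subgroup.subset_closure hj)) _, ?_⟩
  rw [hconj, mul_assoc, ← pow_add, show k + 1 + (k + 1) = 2 * k + 1 + 1 by ring, pow_succ, hpow,
    one_mul, hr, cs.simple_mul_simple_cancel_left]

/-- There is a path of odd bonds from `i` to `j`, and a path inside `J`. In a forest they coincide,
so all the odd conjugations take place in `W_J`. -/
theorem IsIrreducible.exists_conj_simple [Finite W] {cs : CoxeterSystem M W} {J : Set W}
    (hJ : cs.IsIrreducible J) {i j : B} (hi : cs.simple i ∈ J) (hj : cs.simple j ∈ J)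
    (h : IsConj (cs.simple i) (cs.simple j)) :
    ∃ v ∈ closure J, v⁻¹ * cs.simple i * v = cs.simple j := by
  classical
  obtain ⟨p, hp⟩ := (cs.reachable_oddGraph_of_isConj h).exists_isPath
  obtain ⟨q, hq⟩ := (hJ.reachable hi hj).exists_isPath
  have huniq := (cs.isAcyclic_coxeterGraph.subsingleton_path i j).elim
    ⟨p.mapLe oddGraph_le, hp.mapLe oddGraph_le⟩
    ⟨q.mapLe (cs.restrictedGraph_le J), hq.mapLe (cs.restrictedGraph_le J)⟩
  have hedges : p.edges = q.edges := by
    have := congrArg (fun r => r.1.edges) huniq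
    simpa using this
  have key : ∀ {a b : B} (p : (oddGraph M).Walk a b),
      (∀ e ∈ p.edges, e ∈ (cs.restrictedGraph J).edgeSet) →
      ∃ v ∈ closure J, v⁻¹ * cs.simple a * v = cs.simple b := by
    intro a b p
    induction p with
    | nil => exact fun _ => ⟨1, one_mem _, by simp⟩
    | @cons a b c hadj p ih =>
      intro he
      obtain ⟨v, hv, e⟩ := ih fun e h => he e (by simp [h])
      have h1 := he s(a, b) (by simp)
      rw [SimpleGraph.mem_edgeSet] at h1
      obtain ⟨v', hv', e'⟩ := cs.exists_conj_simple_of_odd hadj.2 h1.2.1 h1.2.2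
      refine ⟨v' * v, mul_mem hv' hv, ?_⟩
      rw [← e, ← e']
      group
  exact key p fun e he => q.edges_subset_edgeSet (hedges ▸ he)

end Supports

end CoxeterSystem

/-! ### Conjugates of parabolic subgroups -/

namespace CoxeterSystem

section Conjugation

open Subgroup

variable {B W : Type*} [Group W] {M : CoxeterMatrix B} (cs : CoxeterSystem M W)

theorem mem_conjSet {J : Set W} {w x : W} : x ∈ conjSet J w ↔ w * x * w⁻¹ ∈ J := by
  constructor
  · rintro ⟨y, hy, rfl⟩
    convert hy using 1
    group
  · intro h
    exact ⟨_, h, by group⟩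

theorem conjSet_one (J : Set W) : conjSet J 1 = J := by
  ext x
  simp [mem_conjSet]

theorem conjSet_conjSet (J : Set W) (v w : W) : conjSet (conjSet J v) w = conjSet J (v * w) := by
  ext x
  simp only [mem_conjSet, mul_inv_rev, mul_assoc]

theorem conjSet_inj {J K : Set W} {w : W} : conjSet J w = conjSet K w ↔ J = K := by
  constructor
  · intro h
    have := congrArg (fun L => conjSet L w⁻¹) h
    simpa [conjSet_conjSet, conjSet_one] using this
  · rintro rfl
    rfl

theorem conjSet_mono {J K : Set W} (h : J ⊆ K) (w : W) : conjSet J w ⊆ conjSet K w :=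
  Set.image_mono h

theorem mem_closure_conjSet {J : Set W} {w x : W} :
    x ∈ closure (conjSet J w) ↔ w * x * w⁻¹ ∈ closure J := by
  have h (J : Set W) (w x : W) (hx : x ∈ closure J) : w⁻¹ * x * w ∈ closure (conjSet J w) := by
    induction hx using Subgroup.closure_induction with
    | mem x hx => exact Subgroup.subset_closure ⟨x, hx, rfl⟩
    | one => simp
    | mul x y _ _ hx hy =>
      convert mul_mem hx hy using 1
      group
    | inv x _ hx =>
      convert inv_mem hx using 1
      group
  constructor
  · intro hx
    have := h _ w⁻¹ x hx
    rwa [conjSet_conjSet, mul_inv_cancel, conjSet_one, inv_inv] at this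
  · intro hx
    convert h _ w _ hx using 1
    group

theorem support_conj {J : Set W} (hJ : J ⊆ cs.simples) {d : W} (hd : conjSet J d ⊆ cs.simples)
    {u : W} (hu : u ∈ closure J) : cs.support (d⁻¹ * u * d) = conjSet (cs.support u) d := by
  have key {J : Set W} (hJ : J ⊆ cs.simples) {d : W} (hd : conjSet J d ⊆ cs.simples) {u : W}
      (hu : u ∈ closure J) : cs.support (d⁻¹ * u * d) ⊆ conjSet (cs.support u) d := by
    rw [cs.support_subset_iff
      ((conjSet_mono ((cs.support_subset_iff hJ).2 hu) d).trans hd), mem_closure_conjSet]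
    convert cs.mem_closure_support u using 1
    group
  refine subset_antisymm (key hJ hd hu) ?_
  have hu' : d⁻¹ * u * d ∈ closure (conjSet J d) := by
    rw [mem_closure_conjSet]
    convert hu using 1
    group
  have h := key hd (d := d⁻¹) (by rwa [conjSet_conjSet, mul_inv_cancel, conjSet_one]) hu'
  have e : d⁻¹⁻¹ * (d⁻¹ * u * d) * d⁻¹ = u := by group
  rw [e] at h
  have := conjSet_mono h d
  rwa [conjSet_conjSet, inv_mul_cancel, conjSet_one] at this

/-- A minimal coset representative conjugating `W_J` to `W_K` conjugates `J` to `K`. -/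
theorem conjSet_eq_of_minimal {J K : Set W} (hJ : J ⊆ cs.simples) (hK : K ⊆ cs.simples) {d : W}
    (hmin : ∀ t ∈ cs.parabolicReflections J, ¬ cs.IsLeftInversion d t)
    (hd : ∀ x, x ∈ closure K ↔ d * x * d⁻¹ ∈ closure J) : conjSet J d = K := by
  have hsub : conjSet J d ⊆ K := by
    rintro _ ⟨s, hs, rfl⟩
    have hsJ := cs.subset_parabolicReflections hJ hs
    have e : d * (d⁻¹ * s * d) * d⁻¹ = s := by group
    have hrK : d⁻¹ * s * d ∈ closure K := by
      rw [hd, e]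
      exact hsJ.2
    have hrefl : cs.IsReflection (d⁻¹ * s * d) := by simpa using hsJ.1.conj d⁻¹
    -- A reflection that is its own only inversion is simple, since every nontrivial element has a
    -- simple inversion.
    have huniq (t : W) (ht : cs.IsLeftInversion (d⁻¹ * s * d) t) : t = d⁻¹ * s * d := by
      have htK := cs.mem_closure_of_isLeftInversion hK hrK ht
      have htJ : d * t * d⁻¹ ∈ cs.parabolicReflections J := ⟨ht.1.conj d, (hd t).1 htK⟩
      have h1 : ¬ cs.IsLeftInversion d⁻¹ t := by
        rw [cs.isLeftInversion_inv_iff_conj ht.1]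
        exact hmin _ htJ
      have h2 := cs.isLeftInversion_mul_iff ht.1 d⁻¹ (s * d)
      rw [← mul_assoc, inv_inv, cs.isLeftInversion_mul_iff_of_minimal hmin hsJ.2 htJ] at h2
      have h3 : cs.IsLeftInversion s (d * t * d⁻¹) := by tauto
      obtain ⟨i, rfl⟩ := hJ hs
      rw [cs.isLeftInversion_simple_iff] at h3
      rw [← h3]
      group
    obtain ⟨r, hr, hrinv⟩ := cs.exists_simple_isLeftInversion hrefl.ne_one
    have hrS : d⁻¹ * s * d ∈ cs.simples := huniq r hrinv ▸ hr
    exact cs.mem_of_mem_simples_of_mem_closure hK hrS hrK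
  refine subset_antisymm hsub ((cs.closure_le_closure_iff hK (hsub.trans hK)).1 ?_)
  intro x hx
  rw [mem_closure_conjSet]
  exact (hd x).1 hx

theorem exists_conjSet_eq {J K : Set W} (hJ : J ⊆ cs.simples) (hK : K ⊆ cs.simples) {w : W}
    (hw : ∀ x, x ∈ closure K ↔ w * x * w⁻¹ ∈ closure J) :
    ∃ u ∈ closure J, (∀ t ∈ cs.parabolicReflections J, ¬ cs.IsLeftInversion (u * w) t) ∧
      conjSet J (u * w) = K := by
  obtain ⟨u, hu, hmin⟩ := cs.exists_mul_minimal J w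
  refine ⟨u, hu, hmin, cs.conjSet_eq_of_minimal hJ hK hmin fun x => ?_⟩
  have e : u * w * x * (u * w)⁻¹ = u * (w * x * w⁻¹) * u⁻¹ := by group
  rw [hw, e, Subgroup.mul_mem_cancel_right _ (inv_mem hu), Subgroup.mul_mem_cancel_left _ hu]

theorem coxeterClass_conjSet (J : Set W) (w : W) :
    cs.coxeterClass (conjSet J w) = cs.coxeterClass J := by
  ext K
  refine and_congr_right fun _ => ⟨?_, ?_⟩
  · rintro ⟨v, rfl⟩
    exact ⟨w * v, conjSet_conjSet J w v⟩
  · rintro ⟨v, rfl⟩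
    exact ⟨w⁻¹ * v, by rw [conjSet_conjSet, mul_inv_cancel_left]⟩

end Conjugation

/-! ### Counting -/

section Counting

open Subgroup

variable {B W : Type*} [Group W] {M : CoxeterMatrix B} (cs : CoxeterSystem M W)

/-- The length equation makes the palindromic word of `v⁻¹ s v` reduced, so all letters of `v`, and
`s`, belong to the support. -/
theorem IsSupportReflection.conj_mem {cs : CoxeterSystem M W} {J : Set W} {t s : W}
    (h : cs.IsSupportReflection J t s) :
    s ∈ J ∧ ∃ v ∈ closure J, t = v⁻¹ * s * v := by
  obtain ⟨ht, hsupp, ⟨i, rfl⟩, v, rfl, hlen⟩ := h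
  obtain ⟨ω, hω, rfl⟩ := cs.exists_isReduced v
  have hprod : cs.wordProd (ω.reverse ++ i :: ω) =
      (cs.wordProd ω)⁻¹ * cs.simple i * cs.wordProd ω := by
    rw [cs.wordProd_append, cs.wordProd_cons, cs.wordProd_reverse, mul_assoc]
  have hred : cs.IsReduced (ω.reverse ++ i :: ω) := by
    rw [IsReduced, hprod, hlen, hω.eq]
    simp
    ring
  have hmem (j : B) (hj : j ∈ ω.reverse ++ i :: ω) : cs.simple j ∈ J := by
    rw [← hsupp, ← hprod, cs.support_wordProd hred]
    exact ⟨j, hj, rfl⟩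
  exact ⟨hmem i (by simp), _, cs.wordProd_mem_closure fun j hj => hmem j (by simp [hj]), rfl⟩

theorem mem_minCosetReps_singleton {s x : W} (hs : s ∈ cs.simples) :
    x ∈ cs.minCosetReps {s} ↔ ¬ cs.IsLeftInversion x s := by
  have hsub : {s} ⊆ cs.simples := by simpa using hs
  rw [cs.mem_minCosetReps_iff hsub]
  refine ⟨fun h => h s (cs.subset_parabolicReflections hsub rfl), fun h t ht => ?_⟩
  exact cs.minimal_of_simple hsub (by simpa using h) ht

/-- The centralizer of `s` in `W_J` is twice as large as `X(J, {s})`. -/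
theorem card_centralizer {J : Set W} {s : W} (hs : s ∈ cs.simples)
    (hsJ : s ∈ J) : Nat.card {c // c ∈ closure J ∧ c⁻¹ * s * c = s} =
      2 * (cs.doubleCosetReps J {s}).ncard := by
  classical
  have hsr := cs.isReflection_of_mem_simples hs
  have hsmem : s ∈ closure J := Subgroup.subset_closure hsJ
  have hX (c : W) : c ∈ cs.doubleCosetReps J {s} ↔
      (c ∈ closure J ∧ c⁻¹ * s * c = s) ∧ ¬ cs.IsLeftInversion c s := by
    rw [doubleCosetReps, Set.mem_ofPred_eq, cs.mem_minCosetReps_singleton hs,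
      cs.mem_minCosetReps_singleton hs, cs.isLeftInversion_inv_iff_conj hsr, conjSet,
      Set.image_singleton, Set.singleton_eq_singleton_iff]
    constructor
    · rintro ⟨h1, h2, -, h4⟩
      exact ⟨⟨h1, h4⟩, h2⟩
    · rintro ⟨⟨h1, h2⟩, h3⟩
      have h4 : c * s * c⁻¹ = s := by
        nth_rewrite 1 [← h2]
        group
      rw [h4]
      exact ⟨h1, h3, h3, h2⟩
  have hcs (c : W) (h : c ∈ closure J ∧ c⁻¹ * s * c = s) :
      s * c ∈ closure J ∧ (s * c)⁻¹ * s * (s * c) = s := by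
    refine ⟨mul_mem hsmem h.1, ?_⟩
    have e : (s * c)⁻¹ * s * (s * c) = c⁻¹ * s * c := by group
    rw [e, h.2]
  -- Of `c` and `s c`, both centralizing `s`, exactly one does not have `s` as an inversion.
  let f : Bool × cs.doubleCosetReps J {s} → {c // c ∈ closure J ∧ c⁻¹ * s * c = s} := fun p =>
    if p.1 then ⟨s * p.2, hcs _ ((hX _).1 p.2.2).1⟩ else ⟨p.2, ((hX _).1 p.2.2).1⟩
  have hf : Function.Bijective f := by
    constructor
    · rintro ⟨b, x, hx⟩ ⟨b', x', hx'⟩ h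
      have hx1 := ((hX x).1 hx).2
      have hx1' := ((hX x').1 hx').2
      cases b <;> cases b' <;> simp only [f, if_true, if_false, Bool.false_eq_true, Subtype.mk.injEq]
        at h
      · simp [h]
      · rw [h, hsr.isLeftInversion_mul_right_iff, not_not] at hx1
        exact absurd hx1 hx1'
      · rw [← h, hsr.isLeftInversion_mul_right_iff, not_not] at hx1'
        exact absurd hx1' hx1
      · simpa using h
    · rintro ⟨c, hc⟩
      by_cases h : cs.IsLeftInversion c s
      · refine ⟨(true, ⟨s * c, (hX _).2 ⟨hcs c hc, ?_⟩⟩), Subtype.ext ?_⟩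
        · rw [hsr.isLeftInversion_mul_right_iff, not_not]
          exact h
        · simp only [f, if_true]
          rw [← mul_assoc, hsr.mul_self, one_mul]
      · exact ⟨(false, ⟨c, (hX _).2 ⟨hc, h⟩⟩), rfl⟩
  rw [← Nat.card_congr (Equiv.ofBijective f hf), Nat.card_prod, Nat.card_coe_set_eq]
  simp

variable {J : Set W} {t s : W}

theorem exists_conj_of_mem_conjSameSupport [Finite W] (hJ : cs.IsIrreducible J)
    (h : cs.IsSupportReflection J t s) {y : W} (hy : y ∈ cs.conjSameSupport t) :
    ∃ v ∈ closure J, v⁻¹ * t * v = y := by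
  obtain ⟨ht, hsupp, -, -⟩ := h
  obtain ⟨hy1, hy2⟩ := hy
  rw [hsupp] at hy1
  have hyr : cs.IsReflection y := by
    obtain ⟨c, rfl⟩ := isConj_iff.1 hy2
    exact ht.conj c
  obtain ⟨x, hx, r, hr, rfl⟩ := cs.exists_conj_of_mem_parabolicReflections hJ.1
    ⟨ht, hsupp ▸ cs.mem_closure_support t⟩
  obtain ⟨x', hx', r', hr', rfl⟩ := cs.exists_conj_of_mem_parabolicReflections hJ.1
    ⟨hyr, hy1 ▸ cs.mem_closure_support y⟩
  have hconj : IsConj r r' := by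
    have h1 : IsConj r (x * r * x⁻¹) := isConj_iff.2 ⟨x, rfl⟩
    have h2 : IsConj r' (x' * r' * x'⁻¹) := isConj_iff.2 ⟨x', rfl⟩
    exact (h1.trans hy2).trans h2.symm
  obtain ⟨i, rfl⟩ := hJ.1 hr
  obtain ⟨j, rfl⟩ := hJ.1 hr'
  obtain ⟨v, hv, e⟩ := hJ.exists_conj_simple hr hr' hconj
  refine ⟨x * v * x'⁻¹, mul_mem (mul_mem hx hv) (inv_mem hx'), ?_⟩
  rw [← e]
  group

/-- The map `v ↦ v⁻¹ t v` is onto `⌊t⌉`, and its fibres are cosets of the centralizer of `t` in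
`W_J`, which `v₀` conjugates to that of `s`. -/
theorem card_conj_full_support [Finite W] (hJ : cs.IsIrreducible J)
    (h : cs.IsSupportReflection J t s) :
    Nat.card {v // v ∈ closure J ∧ cs.support (v⁻¹ * t * v) = J} =
      (cs.conjSameSupport t).ncard * (2 * (cs.doubleCosetReps J {s}).ncard) := by
  obtain ⟨hsJ, v₀, hv₀, ht⟩ := h.conj_mem
  choose! v hv hvy using fun y (hy : y ∈ cs.conjSameSupport t) =>
    cs.exists_conj_of_mem_conjSameSupport hJ h hy
  rw [← cs.card_centralizer h.2.2.1 hsJ, ← Nat.card_coe_set_eq, ← Nat.card_prod]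
  have hfy (y c : W) (hy : y ∈ cs.conjSameSupport t) (hc : c⁻¹ * s * c = s) :
      (v₀⁻¹ * c * v₀ * v y)⁻¹ * t * (v₀⁻¹ * c * v₀ * v y) = y := by
    have e : (v₀⁻¹ * c * v₀ * v y)⁻¹ * t * (v₀⁻¹ * c * v₀ * v y) =
        (v y)⁻¹ * (v₀⁻¹ * (c⁻¹ * s * c) * v₀) * v y := by
      rw [ht]
      group
    rw [e, hc, ← ht, hvy y hy]
  refine (Nat.card_congr (Equiv.ofBijective (fun p : cs.conjSameSupport t ×
    {c // c ∈ closure J ∧ c⁻¹ * s * c = s} =>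
      (⟨v₀⁻¹ * p.2 * v₀ * v p.1, ?_, ?_⟩ :
        {v // v ∈ closure J ∧ cs.support (v⁻¹ * t * v) = J})) ⟨?_, ?_⟩)).symm
  · exact mul_mem (mul_mem (mul_mem (inv_mem hv₀) p.2.2.1) hv₀) (hv _ p.1.2)
  · rw [hfy _ _ p.1.2 p.2.2.2, p.1.2.1]
    exact h.2.1
  · rintro ⟨⟨y, hy⟩, c, hc⟩ ⟨⟨y', hy'⟩, c', hc'⟩ heq
    have heq' : v₀⁻¹ * c * v₀ * v y = v₀⁻¹ * c' * v₀ * v y' := congrArg Subtype.val heq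
    have h1 := hfy y c hy hc.2
    rw [heq', hfy y' c' hy' hc'.2] at h1
    subst h1
    have h2 : c = c' := by simpa using heq'
    subst h2
    rfl
  · rintro ⟨u, hu, hsu⟩
    have hy : u⁻¹ * t * u ∈ cs.conjSameSupport t :=
      ⟨hsu.trans h.2.1.symm, isConj_iff.2 ⟨u⁻¹, by simp⟩⟩
    refine ⟨⟨⟨_, hy⟩, v₀ * u * (v (u⁻¹ * t * u))⁻¹ * v₀⁻¹, ?_, ?_⟩, Subtype.ext ?_⟩
    · exact mul_mem (mul_mem (mul_mem hv₀ hu) (inv_mem (hv _ hy))) (inv_mem hv₀)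
    · have h1 := hvy _ hy
      set z := v (u⁻¹ * t * u)
      have hs' : s = v₀ * t * v₀⁻¹ := by
        rw [ht]
        group
      have e : (v₀ * u * z⁻¹ * v₀⁻¹)⁻¹ * s * (v₀ * u * z⁻¹ * v₀⁻¹) =
          v₀ * z * (u⁻¹ * t * u) * z⁻¹ * v₀⁻¹ := by
        rw [hs']
        group
      rw [e, ← h1, hs']
      group
    · simp only
      group

/-- The number of chambers from which the parabolic subgroup `W_J` is the one spanned by `t`. -/
theorem card_conj_parabolic [Finite W] (hJ : cs.IsIrreducible J)
    (h : cs.IsSupportReflection J t s) :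
    Nat.card {w // ∀ x, x ∈ closure (cs.support (w⁻¹ * t * w)) ↔ w * x * w⁻¹ ∈ closure J} =
      2 * ((cs.conjSameSupport t).ncard * (cs.coxeterClass J).ncard *
        (cs.doubleCosetReps cs.simples J).ncard * (cs.doubleCosetReps J {s}).ncard) := by
  have hJS := hJ.1
  have htJ : t ∈ closure J := h.2.1 ▸ cs.mem_closure_support t
  choose! d hd using fun K (hK : K ∈ cs.coxeterClass J) => hK.2
  have hX (x : W) : x ∈ cs.doubleCosetReps cs.simples J ↔
      (∀ t ∈ cs.parabolicReflections J, ¬ cs.IsLeftInversion x t) ∧ conjSet J x = J := by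
    rw [doubleCosetReps, Set.mem_ofPred_eq, cs.mem_minCosetReps_iff hJS,
      cs.mem_minCosetReps_iff hJS]
    constructor
    · exact fun h => ⟨h.2.1, h.2.2.2⟩
    · rintro ⟨h1, h2⟩
      refine ⟨?_, h1, fun r hr => ?_, h2⟩
      · have : closure cs.simples = ⊤ := cs.subgroup_closure_range_simple
        rw [this]
        trivial
      · rw [cs.isLeftInversion_inv_iff_conj hr.1]
        refine h1 _ ⟨hr.1.conj x, ?_⟩
        rw [← mem_closure_conjSet, h2]
        exact hr.2
  have hcalc (K : Set W) (hK : K ∈ cs.coxeterClass J) (x v : W) (hx : conjSet J x = J)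
      (hv : v ∈ closure J) : cs.support ((v * x * d K)⁻¹ * t * (v * x * d K)) =
        conjSet (cs.support (v⁻¹ * t * v)) (x * d K) := by
    have hvt : v⁻¹ * t * v ∈ closure J := mul_mem (mul_mem (inv_mem hv) htJ) hv
    have e : (v * x * d K)⁻¹ * t * (v * x * d K) = (x * d K)⁻¹ * (v⁻¹ * t * v) * (x * d K) := by
      group
    rw [e]
    refine cs.support_conj hJS ?_ hvt
    rw [← conjSet_conjSet, hx, ← hd K hK]
    exact hK.1
  have hmul (a b c e : ℕ) : 2 * (a * b * c * e) = b * (c * (a * (2 * e))) := by ring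
  rw [hmul, ← cs.card_conj_full_support hJ h, ← Nat.card_coe_set_eq (cs.doubleCosetReps _ _),
    ← Nat.card_coe_set_eq (cs.coxeterClass J), ← Nat.card_prod, ← Nat.card_prod]
  -- In `w = v x d_K`, the set `K` is the support seen from `w`, and `v` and `x` come from the
  -- minimal representative `x` of `W_J w d_K⁻¹`, which normalizes `J`.
  refine (Nat.card_congr (Equiv.ofBijective (fun p : cs.coxeterClass J ×
    cs.doubleCosetReps cs.simples J × {v // v ∈ closure J ∧ cs.support (v⁻¹ * t * v) = J} =>
      (⟨p.2.2 * p.2.1 * d p.1, ?_⟩ : {w // ∀ x, x ∈ closure (cs.support (w⁻¹ * t * w)) ↔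
        w * x * w⁻¹ ∈ closure J})) ⟨?_, ?_⟩)).symm
  · obtain ⟨⟨K, hK⟩, ⟨x, hx⟩, v, hv, hvs⟩ := p
    intro g
    have hx' := ((hX x).1 hx).2
    simp only
    rw [hcalc K hK x v hx' hv, hvs, mem_closure_conjSet]
    have e : v * x * d K * g * (v * x * d K)⁻¹ = v * (x * d K * g * (x * d K)⁻¹) * v⁻¹ := by
      group
    rw [e, Subgroup.mul_mem_cancel_right _ (inv_mem hv), Subgroup.mul_mem_cancel_left _ hv]
  · rintro ⟨⟨K, hK⟩, ⟨x, hx⟩, v, hv, hvs⟩ ⟨⟨K', hK'⟩, ⟨x', hx'⟩, v', hv', hvs'⟩ heq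
    have heq' : v * x * d K = v' * x' * d K' := congrArg Subtype.val heq
    obtain ⟨hx1, hx2⟩ := (hX x).1 hx
    obtain ⟨hx1', hx2'⟩ := (hX x').1 hx'
    have h1 := hcalc K hK x v hx2 hv
    rw [heq', hcalc K' hK' x' v' hx2' hv', hvs, hvs', ← conjSet_conjSet, ← conjSet_conjSet, hx2,
      hx2', ← hd K hK, ← hd K' hK'] at h1
    subst h1
    rw [mul_left_inj] at heq'
    have h2 : v'⁻¹ * v = 1 := by
      refine cs.minimal_unique hJS (mul_mem (inv_mem hv') hv) (x := x)
        (fun r hr => hx1 r (cs.subset_parabolicReflections hJS hr)) fun r hr => ?_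
      rw [mul_assoc, heq', inv_mul_cancel_left]
      exact hx1' r (cs.subset_parabolicReflections hJS hr)
    rw [inv_mul_eq_one] at h2
    subst h2
    rw [mul_right_inj] at heq'
    subst heq'
    rfl
  · rintro ⟨w, hw⟩
    set K := cs.support (w⁻¹ * t * w) with hKdef
    have hKS : K ⊆ cs.simples := cs.support_subset_simples _
    obtain ⟨u, hu, -, hK⟩ := cs.exists_conjSet_eq hJS hKS hw
    have hKmem : K ∈ cs.coxeterClass J := ⟨hKS, _, hK.symm⟩
    have hn (x : W) : x ∈ closure J ↔ w * (d K)⁻¹ * x * (w * (d K)⁻¹)⁻¹ ∈ closure J := by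
      have e : w * (d K)⁻¹ * x * (w * (d K)⁻¹)⁻¹ = w * ((d K)⁻¹ * x * d K) * w⁻¹ := by group
      have e' : d K * ((d K)⁻¹ * x * d K) * (d K)⁻¹ = x := by group
      have h2 : (d K)⁻¹ * x * d K ∈ closure K ↔ x ∈ closure J := by
        have h3 := mem_closure_conjSet (J := J) (w := d K) (x := (d K)⁻¹ * x * d K)
        rwa [← hd K hKmem, e'] at h3
      rw [e, ← hw, h2]
    obtain ⟨y, hy, hmin, hyJ⟩ := cs.exists_conjSet_eq hJS hJS hn
    have hxX := (hX _).2 ⟨hmin, hyJ⟩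
    have e : y⁻¹ * (y * (w * (d K)⁻¹)) * d K = w := by group
    have h1 := hcalc K hKmem _ y⁻¹ hyJ (inv_mem hy)
    rw [e, ← hKdef, ← conjSet_conjSet] at h1
    replace h1 := conjSet_inj.1 ((hd K hKmem).symm.trans h1)
    replace h1 := conjSet_inj.1 (hyJ.trans h1)
    exact ⟨⟨⟨K, hKmem⟩, ⟨_, hxX⟩, y⁻¹, inv_mem hy, h1.symm⟩, Subtype.ext e⟩

end Counting

/-! ### The determinant -/

section Determinant

open Classical Subgroup Finset

variable {B W : Type*} [Group W] [Fintype W] {M : CoxeterMatrix B} (cs : CoxeterSystem M W)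

/-- A parabolic subgroup is generated by its reflections, so a flat determines it. -/
theorem conjReflections_eq_iff {J K : Set W} (hJ : J ⊆ cs.simples) (hK : K ⊆ cs.simples)
    {w x : W} : cs.conjReflections K w = cs.conjReflections J x ↔
      ∀ g, g ∈ closure K ↔ x⁻¹ * w * g * (x⁻¹ * w)⁻¹ ∈ closure J := by
  have key {J K : Set W} {w x : W} (hK : K ⊆ cs.simples)
      (h : cs.conjReflections K w = cs.conjReflections J x) (g : W) (hg : g ∈ closure K) :
      x⁻¹ * w * g * (x⁻¹ * w)⁻¹ ∈ closure J := by
    rw [← cs.closure_parabolicReflections hK] at hg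
    have hle : closure (cs.parabolicReflections K) ≤
        (closure J).comap (MulAut.conj (x⁻¹ * w)).toMonoidHom := by
      rw [Subgroup.closure_le]
      intro r hr
      rw [SetLike.mem_coe, mem_comap_conj]
      have h1 : w * r * w⁻¹ ∈ cs.conjReflections K w := by
        rw [mem_conjReflections]
        convert hr using 1
        group
      rw [h, mem_conjReflections] at h1
      exact h1.2
    exact hle hg
  constructor
  · intro h g
    refine ⟨key hK h g, fun hg => ?_⟩
    have := key hJ h.symm _ hg
    convert this using 1
    group
  · intro h
    ext r
    rw [mem_conjReflections, mem_conjReflections]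
    have e : x⁻¹ * w * (w⁻¹ * r * w) * (x⁻¹ * w)⁻¹ = x⁻¹ * r * x := by group
    refine and_congr ?_ (by rw [h, e])
    have h1 := cs.isReflection_conj_iff w⁻¹ r
    have h2 := cs.isReflection_conj_iff x⁻¹ r
    rw [inv_inv] at h1 h2
    rw [h1, h2]

theorem card_hull_eq {J : Set W} {t s : W} (hJ : cs.IsIrreducible J)
    (h : cs.IsSupportReflection J t s) (y : W) :
    #{w | cs.hull (y⁻¹ * t * y) w = cs.conjReflections J y⁻¹} =
      2 * ((cs.conjSameSupport t).ncard * (cs.coxeterClass J).ncard *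
        (cs.doubleCosetReps cs.simples J).ncard * (cs.doubleCosetReps J {s}).ncard) := by
  rw [← cs.card_conj_parabolic hJ h, ← Fintype.card_subtype, ← Nat.card_eq_fintype_card]
  refine Nat.card_congr ((Equiv.mulLeft y).subtypeEquiv fun w => ?_)
  have e : w⁻¹ * (y⁻¹ * t * y) * w = (y * w)⁻¹ * t * (y * w) := by group
  rw [hull, e, cs.conjReflections_eq_iff hJ.1 (cs.support_subset_simples _), inv_inv]
  rfl

variable {J : cs.irreducibleClasses → Set W} {t s : cs.irreducibleClasses → W}
  {Y : cs.irreducibleClasses → Set W}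

omit [Fintype W] in
theorem isIrreducible_of_mem {c : Set (Set W)} (hc : c ∈ cs.irreducibleClasses) {K : Set W}
    (hK : K ∈ c) : cs.IsIrreducible K ∧ c = cs.coxeterClass K := by
  obtain ⟨J, ⟨hJS, hne, hirr⟩, rfl⟩ := hc
  obtain ⟨hKS, w, rfl⟩ := hK
  refine ⟨⟨hKS, hne.image _, ?_⟩, (cs.coxeterClass_conjSet J w).symm⟩
  intro J₁ J₂ hunion hdisj hne₁ hne₂
  have hback (J : Set W) : conjSet (conjSet J w⁻¹) w = J := by
    rw [conjSet_conjSet, inv_mul_cancel, conjSet_one]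
  obtain ⟨a, ha, b, hb, hab⟩ := hirr (conjSet J₁ w⁻¹) (conjSet J₂ w⁻¹) (by
      rw [← conjSet_inj (w := w)]
      simp only [conjSet, ← Set.image_union, hunion]
      exact hback _) (by
      rw [Set.disjoint_left] at hdisj ⊢
      intro z h1 h2
      rw [mem_conjSet] at h1 h2
      exact hdisj h1 h2) (hne₁.image _) (hne₂.image _)
  rw [mem_conjSet, inv_inv] at ha hb
  refine ⟨_, ha, _, hb, fun hc => hab ?_⟩
  have := hc.conj w
  simpa [mul_assoc] using this

theorem det_blockMatrix_eq (hJ : ∀ c : cs.irreducibleClasses, J c ∈ (c : Set (Set W)))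
    (ht : ∀ c, cs.IsSupportReflection (J c) (t c) (s c))
    (hY : ∀ c, Subgroup.IsComplement
      (Subgroup.normalizer (Subgroup.closure (J c) : Set W) : Set W) (Y c)) :
    (cs.blockMatrix (fun t => (MvPolynomial.X t : MvPolynomial W ℤ)) cs.simples).det =
      ∏ c, ∏ w : Y c, (1 - (∏ u ∈ cs.conjReflections (J c) (w : W)⁻¹, MvPolynomial.X u) ^ 2) ^
        ((cs.conjSameSupport (t c)).ncard * (cs.coxeterClass (J c)).ncard *
          (cs.doubleCosetReps cs.simples (J c)).ncard *
          (cs.doubleCosetReps (J c) {s c}).ncard) := by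
  obtain ⟨e, hdet, he⟩ := cs.exists_det_sq_eq
  have hirr (c : cs.irreducibleClasses) := (cs.isIrreducible_of_mem c.2 (hJ c)).1
  have hclass (c : cs.irreducibleClasses) := (cs.isIrreducible_of_mem c.2 (hJ c)).2
  set f := (cs.blockMatrix (fun t => (MvPolynomial.X t : MvPolynomial W ℤ)) cs.simples).det
  let n : cs.irreducibleClasses → ℕ := fun c =>
    (cs.conjSameSupport (t c)).ncard * (cs.coxeterClass (J c)).ncard *
      (cs.doubleCosetReps cs.simples (J c)).ncard * (cs.doubleCosetReps (J c) {s c}).ncard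
  let A : (Σ c, Y c) → Finset W := fun p => cs.conjReflections (J p.1) (p.2 : W)⁻¹
  let P : Finset W → MvPolynomial W ℤ := fun A => 1 - (∏ u ∈ A, MvPolynomial.X u) ^ 2
  let g : MvPolynomial W ℤ := ∏ p : Σ c, Y c, P (A p) ^ n p.1
  have hg : ∏ c, ∏ w : Y c, (1 - (∏ u ∈ cs.conjReflections (J c) (w : W)⁻¹,
      (MvPolynomial.X u : MvPolynomial W ℤ)) ^ 2) ^ n c = g :=
    (Fintype.prod_sigma' fun c (w : Y c) => P (A ⟨c, w⟩) ^ n c).symm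
  have hA_mem (p) : A p ∈ cs.flats :=
    cs.mem_flats.2 ⟨_, (hirr p.1).1, (hirr p.1).2.1, _, rfl⟩
  have he_A (p) : e (A p) = 2 * n p.1 := by
    obtain ⟨c, y⟩ := p
    rw [he _ (hA_mem _) ((y : W)⁻¹ * t c * y), cs.card_hull_eq (hirr c) (ht c) y]
    refine cs.mem_conjReflections.2 ?_
    have h1 : (y : W)⁻¹⁻¹ * ((y : W)⁻¹ * t c * y) * (y : W)⁻¹ = t c := by group
    rw [h1]
    exact ⟨(ht c).1, (ht c).2.1 ▸ cs.mem_closure_support (t c)⟩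
  -- Equal flats come from conjugate parabolic subgroups, hence from one class, and then `y'` and
  -- `y` differ by an element of the normalizer.
  have hA_inj : Function.Injective A := by
    rintro ⟨c, y⟩ ⟨c', y'⟩ h
    have h1 := (cs.conjReflections_eq_iff (hirr c').1 (hirr c).1).1 h
    simp only [inv_inv] at h1
    have hc : c = c' := by
      obtain ⟨u, -, -, h2⟩ := cs.exists_conjSet_eq (hirr c').1 (hirr c).1 h1
      apply Subtype.ext
      rw [hclass c, hclass c', ← h2, cs.coxeterClass_conjSet]
    subst hc
    have hnorm : (y' : W) * (y : W)⁻¹ ∈ Subgroup.normalizer (Subgroup.closure (J c) : Set W) :=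
      Subgroup.mem_normalizer_iff.2 h1
    have h2 := @(hY c).1 (⟨_, hnorm⟩, y) (⟨1, one_mem _⟩, y') (by simp)
    have h3 : y = y' := (Prod.ext_iff.1 h2).2
    rw [h3]
  -- A nonzero exponent makes `a` the hull of some reflection, hence conjugate to the flat of an
  -- irreducible support.
  have hA_surj (a : Finset W) (ha : a ∈ cs.flats) (hea : e a ≠ 0) : ∃ p, A p = a := by
    obtain ⟨K₀, hK₀S, hK₀ne, x, rfl⟩ := cs.mem_flats.1 ha
    obtain ⟨r, hr⟩ := cs.conjReflections_nonempty hK₀S hK₀ne x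
    have hrr := cs.isReflection_of_mem_conjReflections hr
    rw [he _ ha r hr, Ne, Finset.card_eq_zero, ← Ne, ← Finset.nonempty_iff_ne_empty] at hea
    obtain ⟨w, hw⟩ := hea
    rw [mem_filter, hull] at hw
    rw [← hw.2]
    have hwr : cs.IsReflection (w⁻¹ * r * w) := by simpa using hrr.conj w⁻¹
    set K := cs.support (w⁻¹ * r * w)
    have hKirr := cs.isIrreducible_support hwr
    let c : cs.irreducibleClasses := ⟨cs.coxeterClass K, K, hKirr, rfl⟩
    obtain ⟨-, z, hz⟩ : J c ∈ cs.coxeterClass K := hJ c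
    obtain ⟨⟨⟨m, hm⟩, y⟩, hmy⟩ := (hY c).2 (w * z)⁻¹
    have hmy' : m * y = (w * z)⁻¹ := hmy
    refine ⟨⟨c, y⟩, ?_⟩
    rw [cs.conjReflections_eq_iff hKirr.1 (hirr c).1]
    intro q
    have hm' := Subgroup.mem_normalizer_iff.1 hm
    have h1 : w⁻¹ * (y : W)⁻¹ * q * (w⁻¹ * (y : W)⁻¹)⁻¹ =
        z * (m * q * m⁻¹) * z⁻¹ := by
      have hy : (y : W) = m⁻¹ * (w * z)⁻¹ := by rw [← hmy', inv_mul_cancel_left]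
      rw [hy]
      group
    rw [h1, ← mem_closure_conjSet, ← hz]
    exact hm' q
  have hsq : f ^ 2 = g ^ 2 := by
    rw [hdet, ← Finset.prod_pow]
    have h1 : ∏ p : Σ c, Y c, (P (A p) ^ n p.1) ^ 2 = ∏ p : Σ c, Y c, P (A p) ^ e (A p) := by
      refine Finset.prod_congr rfl fun p _ => ?_
      rw [← pow_mul, he_A, mul_comm]
    rw [h1, ← Finset.prod_image (f := fun a => P a ^ e a) (g := A) fun p _ q _ h => hA_inj h]
    symm
    refine Finset.prod_subset (fun a ha => ?_) fun a ha hna => ?_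
    · obtain ⟨p, -, rfl⟩ := mem_image.1 ha
      exact hA_mem p
    · have : e a = 0 := by
        by_contra h0
        obtain ⟨p, hp⟩ := hA_surj a ha h0
        exact hna (mem_image.2 ⟨p, mem_univ _, hp⟩)
      rw [this, pow_zero]
  change f = ∏ c, ∏ w : Y c, (1 - (∏ u ∈ cs.conjReflections (J c) (w : W)⁻¹,
      (MvPolynomial.X u : MvPolynomial W ℤ)) ^ 2) ^ n c
  rw [hg]
  -- At the origin the matrix is the identity and every factor of `g` is `1`, which excludes the
  -- negative sign.
  rcases sq_eq_sq_iff_eq_or_eq_neg.1 hsq with h | h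
  · exact h
  · exfalso
    have h1 := congrArg (MvPolynomial.eval (0 : W → ℤ)) h
    have hg0 : MvPolynomial.eval (0 : W → ℤ) g = 1 := by
      simp only [g, map_prod, map_pow]
      refine Finset.prod_eq_one fun p _ => ?_
      obtain ⟨r, hr⟩ := cs.conjReflections_nonempty (hirr p.1).1 (hirr p.1).2.1 (p.2 : W)⁻¹
      simp only [P, map_sub, map_one, map_pow, map_prod, MvPolynomial.eval_X, Pi.zero_apply]
      rw [Finset.prod_eq_zero (i := r) hr rfl]
      simp
    have hf0 : MvPolynomial.eval (0 : W → ℤ) f = 1 := by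
      simp only [f]
      rw [map_det_blockMatrix]
      have : cs.blockMatrix (fun t => MvPolynomial.eval (0 : W → ℤ) (MvPolynomial.X t))
          cs.simples = 1 := by
        ext w w'
        rw [blockMatrix_simples_apply, Matrix.one_apply]
        split_ifs with hw
        · rw [hw, sep_self, prod_empty]
        · obtain ⟨r, -, hr⟩ := cs.exists_simple_isLeftInversion (w := w⁻¹ * w')
            fun h => hw (inv_mul_eq_one.1 h)
          refine Finset.prod_eq_zero (i := w * r * w⁻¹) (cs.mem_sep_iff.2 ?_) (by simp)
          convert! hr using 1
          group
      rw [this, Matrix.det_one]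
    rw [map_neg, hg0, hf0] at h1
    norm_num at h1

end Determinant

end CoxeterSystem

theorem mainTheorem5 {B W V : Type*} [Group W] [Finite W] {M : CoxeterMatrix B}
    (cs : CoxeterSystem M W) [NormedAddCommGroup V] [NormedSpace ℝ V] [FiniteDimensional ℝ V]
    (R : M.Realization V) :
    (∀ J : Set W, cs.IsIrreducible J → ∃ t s, cs.IsSupportReflection J t s) ∧
    ∀ (J : cs.irreducibleClasses → Set W) (t s : cs.irreducibleClasses → W)
      (Y : cs.irreducibleClasses → Set W),
      (∀ c : cs.irreducibleClasses, J c ∈ (c : Set (Set W))) →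
      (∀ c, cs.IsSupportReflection (J c) (t c) (s c)) →
      (∀ c, Subgroup.IsComplement
        (Subgroup.normalizer (Subgroup.closure (J c) : Set W) : Set W) (Y c)) →
      Arrangement.varchenkoDet (R.arrangement cs) =
        ∏ᶠ c : cs.irreducibleClasses, ∏ᶠ w : Y c,
          (1 - ∏ᶠ u : cs.parabolicReflections (J c),
              R.hyperplaneVar cs (cs.conjReflection u w) ^ 2) ^
            ((cs.conjSameSupport (t c)).ncard * (cs.coxeterClass (J c)).ncard *
              (cs.doubleCosetReps cs.simples (J c)).ncard *
              (cs.doubleCosetReps (J c) {s c}).ncard) := by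
  classical
  refine ⟨fun J hJ => cs.exists_isSupportReflection hJ, fun J t s Y hJ ht hY => ?_⟩
  let _ : Fintype W := Fintype.ofFinite W
  -- Specialise the variables of the group elements; those of non-reflections go to `0`, but they
  -- occur in no separating set and in no flat.
  have h := congrArg (MvPolynomial.eval₂Hom (Int.castRingHom _) (R.reflectionVar cs))
    (cs.det_blockMatrix_eq hJ ht hY)
  rw [cs.map_det_blockMatrix] at h
  simp only [MvPolynomial.coe_eval₂Hom, MvPolynomial.eval₂_X] at h
  rw [R.varchenkoDet_eq cs, h, ← MvPolynomial.coe_eval₂Hom, map_prod, finprod_eq_prod_of_fintype]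
  refine Finset.prod_congr rfl fun c _ => ?_
  rw [map_prod, finprod_eq_prod_of_fintype]
  refine Finset.prod_congr rfl fun w _ => ?_
  rw [map_pow, map_sub, map_one, map_pow, map_prod, finprod_eq_prod_of_fintype, Finset.prod_pow]
  simp only [MvPolynomial.coe_eval₂Hom, MvPolynomial.eval₂_X]
  congr 3
  symm
  refine Finset.prod_bij (fun u _ => (w : W)⁻¹ * u * w) ?_ ?_ ?_ ?_
  · intro u _
    rw [cs.mem_conjReflections]
    convert u.2 using 1
    group
  · intro u _ u' _ huu
    apply Subtype.ext
    simpa using huu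
  · intro r hr
    refine ⟨⟨_, cs.mem_conjReflections.1 hr⟩, Finset.mem_univ _, ?_⟩
    simp only
    group
  · intro u _
    have hr : cs.IsReflection ((w : W)⁻¹ * u * w) := (cs.conjReflection u w).2
    rw [CoxeterMatrix.Realization.reflectionVar, dif_pos hr]
    rfl
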